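/- **Setting.** Let $\mathcal{C}ob$ be the category whose objects are finite collections of circles with an integer degree shift $\{m\}$, and whose morphisms $A\{m\}\to B\{n\}$ are compact orientable surfaces with boundary $A\sqcup B$, up to homeomorphism relative to the boundary, of degree $\chi(S)+n-m=0$. Let $\mathcal{C}ob_{/l}$ be the category with the same objects whose morphisms are formal $\mathbb{Z}$-linear combinations of such surfaces modulo the local relations S (a surface with a sphere component is $0$), T (a torus component may be replaced by the factor $2$) and 4TU (for four discs $1,2,3,4$ on a surface, adding the tube $12$ plus adding the tube $34$ equals adding the tube $13$ plus adding the tube $24$). Let $D$ be a diagram in the plane of a non-empty oriented link, with $n_+$ positive and $n_-$ negative crossings, and let $[D]$ be its geometric (Bar-Natan) complex in $\operatorname{Kom}(\operatorname{Mat}(\mathcal{C}ob_{/l}))$: in homological degree $r$ it is the column of the complete smoothings of $D$ with exactly $r+n_-$ one-smoothings, each with degree shift $r+n_+-n_-$, and its differential is the usual signed sum of saddle cobordisms over the edges of the cube of smoothings. Mark $D$ at a point $p$ of the underlying curve. The special circle of a smoothing is the circle through $p$. Let $|\{m\}$ (the special line) be the object consisting of a single circle with shift $m$. A curtain is a connected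 surface whose boundary consists of one incoming and one outgoing special circle, and the special 1-handle operator $H$, of degree $-2$, adds a handle to the component bounded by the special circle. **Theorem 5.1.** Fix $D$ and $p$ as above. 1. For all $m,n\in\mathbb{Z}$, the subgroup of $\operatorname{Hom}_{\mathcal{C}ob_{/l}}(|\{m\},|\{n\})$ generated by the surfaces for which the two special circles bound the same component is generated by $H^k$ (the curtain of genus $k$) with $n=m+2k$, and it is free on it; it is $0$ if there is no such $k\ge 0$. Thus sending $\mathbb{Z}[H]\{m\}$ to $|\{m\}$, and multiplication by $H$ to the special 1-handle operator, defines a faithful additive functor $L$ from the category of graded free $\mathbb{Z}[H]$-modules of finite rank with a homogeneous basis (and $\mathbb{Z}[H]$-linear maps of degree $0$) to $\operatorname{Mat}(\mathcal{C}ob_{/l})$. 2. Let $M^r$ be the graded free $\mathbb{Z}[H]$-module with one basis element for each smoothing $v$ in homological degree $r$ together with a choice of a sign $\epsilon_c\in\{+1,-1\}$ for each non-special circle $c$ of $v$, where this basis element spans a copy of $\mathbb{Z}[H]\{r+n_+-n_-+\sum_c\epsilon_c\}$. There are degree-$0$ maps $d^r\colon M^r\to M^{r+1}$ with $d^{r+1}d^r=0$,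 all of whose matrix entries are monomials $c\,H^k$ ($c\in\mathbb{Z}$, $k\ge0$), such that $[D]$ is isomorphic in $\operatorname{Kom}(\operatorname{Mat}(\mathcal{C}ob_{/l}))$, and hence also in the homotopy category $\operatorname{Kom}_{/h}(\operatorname{Mat}(\mathcal{C}ob_{/l}))$, to $L(M^\bullet,d)$, a complex of columns of special lines whose maps are matrices with monomial entries in $H$. The isomorphism of complexes can be chosen so that every matrix entry of it and of its inverse is a $\mathbb{Z}$-linear combination of surfaces in which the special circle and the special line bound the same component. -/

import Mathlib

namespace BarNatan

open CategoryTheory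

section Gluing

open Classical in
/-- Sum of the weights `w i` over the fibre of `φ` at `q`. -/
noncomputable def push {I Q : Type} [Fintype I] (φ : I → Q) (w : I → ℤ) (q : Q) : ℤ :=
  ∑ i, if φ i = q then w i else 0

theorem push_push {I J K : Type} [Fintype I] [Fintype J] (φ : I → J) (ψ : J → K) (w : I → ℤ) :
    push ψ (push φ w) = push (fun i => ψ (φ i)) w := by
  classical
  funext q
  simp only [push]
  have : ∀ j : J, (if ψ j = q then ∑ i, (if φ i = j then w i else 0) else 0)
      = ∑ i, if φ i = j then (if ψ j = q then w i else 0) else 0 := by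
    intro j
    split_ifs <;> simp
  simp_rw [this]
  rw [Finset.sum_comm]
  simp

theorem push_add {I Q : Type} [Fintype I] (φ : I → Q) (w w' : I → ℤ) :
    push φ (fun i => w i + w' i) = fun q => push φ w q + push φ w' q := by
  classical
  funext q
  simp only [push, ← Finset.sum_add_distrib]
  refine Finset.sum_congr rfl fun i _ => ?_
  split_ifs <;> simp

theorem push_sum {I J Q : Type} [Fintype I] [Fintype J] (φ : I ⊕ J → Q) (w : I ⊕ J → ℤ) (q : Q) :
    push φ w q = push (fun i => φ (Sum.inl i)) (fun i => w (Sum.inl i)) q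
      + push (fun j => φ (Sum.inr j)) (fun j => w (Sum.inr j)) q := by
  classical
  simp only [push, Fintype.sum_sum_type]

theorem push_equiv {I J Q : Type} [Fintype I] [Fintype J] (e : I ≃ J) (φ : J → Q) (w : J → ℤ)
    (q : Q) : push (fun i => φ (e i)) (fun i => w (e i)) q = push φ w q := by
  classical
  simp only [push]
  exact e.sum_comp (fun j => if φ j = q then w j else 0)

theorem push_injective {I Q : Type} [Fintype I] (φ : I → Q) (h : Function.Injective φ)
    (w : I → ℤ) (i : I) : push φ w (φ i) = w i := by
  classical
  simp only [push]
  rw [Finset.sum_eq_single i]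
  · simp
  · intro j _ hj
    rw [if_neg]
    exact fun he => hj (h he)
  · simp

theorem sum_push {I Q : Type} [Fintype I] [Fintype Q] (φ : I → Q) (w : I → ℤ) :
    ∑ q, push φ w q = ∑ i, w i := by
  classical
  simp only [push]
  rw [Finset.sum_comm]
  simp

/-- The set of components obtained from a set `I` of pieces by joining, for every
`e : E`, the pieces `s e` and `t e`. -/
def Glue {I E : Type} (s t : E → I) : Type :=
  Quot fun i j => ∃ e, s e = i ∧ t e = j

/-- The component containing a given piece. -/
def Glue.mk {I E : Type} (s t : E → I) (i : I) : Glue s t := Quot.mk _ i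

theorem Glue.mk_surjective {I E : Type} (s t : E → I) : Function.Surjective (Glue.mk s t) :=
  Quot.mk_surjective

theorem Glue.sound {I E : Type} (s t : E → I) (e : E) :
    Glue.mk s t (s e) = Glue.mk s t (t e) := Quot.sound ⟨e, rfl, rfl⟩

noncomputable instance {I E : Type} [Fintype I] (s t : E → I) : Fintype (Glue s t) :=
  @Fintype.ofFinite _ (Finite.of_surjective _ (Glue.mk_surjective s t))

/-- A connected graph with `V` vertices and `E` edges has `V ≤ E + 1`. -/
theorem Glue.connected_bound {I E : Type} [Fintype I] [Fintype E] (s t : E → I) (q : Glue s t) :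
    push (Glue.mk s t) (fun _ => 1) q ≤ push (fun e => Glue.mk s t (s e)) (fun _ => 1) q + 1 := by
  classical
  let V := {i : I // Glue.mk s t i = q}
  let F := {e : E // Glue.mk s t (s e) = q}
  let G : SimpleGraph V := SimpleGraph.fromRel fun x y => ∃ e, s e = x.1 ∧ t e = y.1
  have hadj : ∀ x y : V, (∃ e, s e = x.1 ∧ t e = y.1) → G.Reachable x y := by
    intro x y h
    by_cases hxy : x = y
    · subst hxy; exact SimpleGraph.Reachable.refl _
    · exact SimpleGraph.Adj.reachable ((SimpleGraph.fromRel_adj _ _ _).2 ⟨hxy, Or.inl h⟩)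
  have hreach : ∀ i j : I, Relation.EqvGen (fun i j => ∃ e, s e = i ∧ t e = j) i j →
      ∀ (hi : Glue.mk s t i = q) (hj : Glue.mk s t j = q), G.Reachable ⟨i, hi⟩ ⟨j, hj⟩ := by
    intro i j h
    induction h with
    | rel x y h => intro hi hj; exact hadj ⟨x, hi⟩ ⟨y, hj⟩ h
    | refl x => intro hi hj; exact SimpleGraph.Reachable.refl _
    | symm x y _ ih => intro hi hj; exact (ih hj hi).symm
    | trans x y z h1 h2 ih1 ih2 =>
      intro hi hj
      have hy : Glue.mk s t y = q := by
        rw [← hj]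
        exact Quot.eqvGen_sound h2
      exact (ih1 hi hy).trans (ih2 hy hj)
  obtain ⟨i0, hi0⟩ := Glue.mk_surjective s t q
  have hconn : G.Connected := by
    have : Nonempty V := ⟨⟨i0, hi0⟩⟩
    refine SimpleGraph.Connected.mk ?_
    intro x y
    exact hreach x.1 y.1 (Quot.eqvGen_exact (x.2.trans y.2.symm)) x.2 y.2
  have h1 := hconn.card_vert_le_card_edgeSet_add_one
  have h2 : Nat.card G.edgeSet ≤ Nat.card F := by
    have hF : ∀ f : F, Glue.mk s t (t f.1) = q := fun f => (Glue.sound s t f.1).symm.trans f.2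
    let g : F → Sym2 V := fun f => s(⟨s f.1, f.2⟩, ⟨t f.1, hF f⟩)
    have hsub : G.edgeSet ⊆ Set.range g := by
      intro z
      induction z using Sym2.ind with
      | _ x y =>
        intro hz
        rw [SimpleGraph.mem_edgeSet, SimpleGraph.fromRel_adj] at hz
        obtain ⟨-, ⟨e, he1, he2⟩ | ⟨e, he1, he2⟩⟩ := hz
        · refine ⟨⟨e, by rw [he1]; exact x.2⟩, ?_⟩
          simp only [g]
          exact congrArg₂ (fun a b => s(a, b)) (Subtype.ext he1) (Subtype.ext he2)
        · refine ⟨⟨e, by rw [he1]; exact y.2⟩, ?_⟩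
          simp only [g]
          rw [Sym2.eq_swap]
          exact congrArg₂ (fun a b => s(a, b)) (Subtype.ext he2) (Subtype.ext he1)
    calc Nat.card G.edgeSet ≤ Nat.card (Set.range g) :=
          Nat.card_mono (Set.toFinite _) hsub
      _ ≤ Nat.card F := Finite.card_range_le g
  have h3 : push (Glue.mk s t) (fun _ => 1) q = (Nat.card V : ℤ) := by
    simp [push, V, Fintype.card_subtype]
  have h4 : push (fun e => Glue.mk s t (s e)) (fun _ => 1) q = (Nat.card F : ℤ) := by
    simp [push, F, Fintype.card_subtype]
  rw [h3, h4]
  have := h1.trans (Nat.add_le_add_right h2 1)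
  exact_mod_cast this

/-- The genus of a component `q` obtained by gluing pieces of genus `g i` along circles (one for
every `e : E`, joining the pieces `s e` and `t e`). By additivity of the Euler characteristic,
`genus q - 1 = ∑ (g i - 1) + (number of gluing circles in q)`. -/
noncomputable def glueGenus {I E : Type} [Fintype I] [Fintype E] (g : I → ℕ) (s t : E → I)
    (q : Glue s t) : ℕ :=
  (1 + push (Glue.mk s t) (fun i => (g i : ℤ) - 1) q
    + push (fun e => Glue.mk s t (s e)) (fun _ => 1) q).toNat

theorem glueGenus_spec {I E : Type} [Fintype I] [Fintype E] (g : I → ℕ) (s t : E → I)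
    (q : Glue s t) :
    (glueGenus g s t q : ℤ) - 1 = push (Glue.mk s t) (fun i => (g i : ℤ) - 1) q
      + push (fun e => Glue.mk s t (s e)) (fun _ => 1) q := by
  classical
  have h := Glue.connected_bound s t q
  have h2 : - push (Glue.mk s t) (fun _ => 1) q
      ≤ push (Glue.mk s t) (fun i => (g i : ℤ) - 1) q := by
    simp only [push, ← Finset.sum_neg_distrib]
    refine Finset.sum_le_sum fun i _ => ?_
    split_ifs
    · have : (0 : ℤ) ≤ g i := Int.natCast_nonneg _
      linarith
    · simp
  rw [glueGenus, Int.toNat_of_nonneg (by linarith)]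
  ring

end Gluing

/-- A compact orientable surface whose boundary circles are labelled by `A ⊕ B`, described (up to
homeomorphism relative to the boundary) by the set of its connected components, the genus of
each component, and the component on which each boundary circle lies. It is regarded as a
cobordism from the circles `A` to the circles `B`. -/
structure Surf (A B : Type) where
  comps : Type
  [fintype : Fintype comps]
  genus : comps → ℕ
  bdry : A ⊕ B → comps

attribute [instance] Surf.fintype

namespace Surf

variable {A B C D : Type}

/-- Two surfaces are homeomorphic relative to the boundary. -/
def Homeo (F G : Surf A B) : Prop :=
  ∃ e : F.comps ≃ G.comps, (∀ i, G.genus (e i) = F.genus i) ∧ ∀ x, G.bdry x = e (F.bdry x)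

instance setoid (A B : Type) : Setoid (Surf A B) where
  r := Homeo
  iseqv :=
    { refl := fun _ => ⟨Equiv.refl _, fun _ => rfl, fun _ => rfl⟩
      symm := by
        rintro F G ⟨e, h1, h2⟩
        refine ⟨e.symm, fun i => ?_, fun x => ?_⟩
        · rw [← h1, Equiv.apply_symm_apply]
        · rw [h2, Equiv.symm_apply_apply]
      trans := by
        rintro F G K ⟨e, h1, h2⟩ ⟨e', h1', h2'⟩
        refine ⟨e.trans e', fun i => ?_, fun x => ?_⟩
        · simp [h1, h1']
        · simp [h2, h2'] }

/-- Genus minus one. -/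
def wt (F : Surf A B) (i : F.comps) : ℤ := (F.genus i : ℤ) - 1

/-- The Euler characteristic. -/
def euler [Fintype A] [Fintype B] (F : Surf A B) : ℤ :=
  (∑ i, (2 - 2 * (F.genus i : ℤ))) - Fintype.card A - Fintype.card B

theorem euler_eq [Fintype A] [Fintype B] (F : Surf A B) :
    F.euler = -2 * (∑ i, F.wt i) - Fintype.card A - Fintype.card B := by
  simp only [euler, wt, Finset.mul_sum]
  congr 2
  refine Finset.sum_congr rfl fun i _ => ?_
  ring

/-- The cylinder `A × [0,1]`. -/
def cyl (A : Type) [Fintype A] : Surf A A where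
  comps := A
  genus _ := 0
  bdry := Sum.elim id id

/-- The result of gluing `F` and `G` along the circles `B`. -/
noncomputable def comp [Fintype B] (F : Surf A B) (G : Surf B C) : Surf A C where
  comps := Glue (I := F.comps ⊕ G.comps) (fun b : B => Sum.inl (F.bdry (Sum.inr b)))
    (fun b : B => Sum.inr (G.bdry (Sum.inl b)))
  genus := glueGenus (Sum.elim F.genus G.genus) _ _
  bdry := Sum.elim (fun a => Glue.mk _ _ (Sum.inl (F.bdry (Sum.inl a))))
    (fun c => Glue.mk _ _ (Sum.inr (G.bdry (Sum.inr c))))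

/-- Remove a disc from the component `i` and a disc from the component `j` and connect the two
holes by a tube. -/
noncomputable def tube (F : Surf A B) (i j : F.comps) : Surf A B where
  comps := Glue (E := Unit) (fun _ => i) (fun _ => j)
  genus := glueGenus F.genus _ _
  bdry x := Glue.mk _ _ (F.bdry x)

/-- Disjoint union with a closed connected surface of genus `g`. -/
def addClosed (F : Surf A B) (g : ℕ) : Surf A B where
  comps := F.comps ⊕ Unit
  genus := Sum.elim F.genus fun _ => g
  bdry x := Sum.inl (F.bdry x)

/-- The component of the glued surface that contains a given component of a piece. -/
def compMk [Fintype B] (F : Surf A B) (G : Surf B C) : F.comps ⊕ G.comps → (F.comp G).comps :=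
  Glue.mk _ _

/-- `φ` exhibits `H` as the result of gluing pieces `I` along circles `E`. -/
structure IsGluing {I E : Type} [Fintype I] [Fintype E] (w : I → ℤ) (s t : E → I)
    (b : A ⊕ B → I) (H : Surf A B) (φ : I → H.comps) : Prop where
  surj : Function.Surjective φ
  glue : ∀ e, φ (s e) = φ (t e)
  univ : ∀ (X : Type) (f : I → X), (∀ e, f (s e) = f (t e)) → ∃ f' : H.comps → X, ∀ i, f' (φ i) = f i
  wt : ∀ q, H.wt q = push φ w q + push (fun e => φ (s e)) (fun _ => 1) q
  bdry : ∀ x, H.bdry x = φ (b x)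

theorem homeo_of_bijection {F G : Surf A B} (f : F.comps → G.comps) (g : G.comps → F.comps)
    (hgf : ∀ i, g (f i) = i) (hfg : ∀ i, f (g i) = i) (hw : ∀ i, G.wt (f i) = F.wt i)
    (hb : ∀ x, G.bdry x = f (F.bdry x)) : F ≈ G := by
  refine ⟨⟨f, g, hgf, hfg⟩, fun i => ?_, hb⟩
  have := hw i
  simp only [Surf.wt] at this
  change G.genus (f i) = F.genus i
  omega

theorem push_bij {I Q R : Type} [Fintype I] (f : Q → R) (hf : Function.Injective f) (φ : I → Q)
    (w : I → ℤ) (q : Q) : push (fun i => f (φ i)) w (f q) = push φ w q := by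
  classical
  simp only [push]
  refine Finset.sum_congr rfl fun i _ => ?_
  simp [hf.eq_iff]

theorem IsGluing.homeo {I E : Type} [Fintype I] [Fintype E] {w : I → ℤ} {s t : E → I}
    {b : A ⊕ B → I} {H H' : Surf A B} {φ : I → H.comps} {φ' : I → H'.comps}
    (h : IsGluing w s t b H φ) (h' : IsGluing w s t b H' φ') : H ≈ H' := by
  obtain ⟨f, hf⟩ := h.univ _ φ' h'.glue
  obtain ⟨g, hg⟩ := h'.univ _ φ h.glue
  have hgf : ∀ i, g (f i) = i := by
    intro i
    obtain ⟨j, rfl⟩ := h.surj i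
    rw [hf, hg]
  have hfg : ∀ i, f (g i) = i := by
    intro i
    obtain ⟨j, rfl⟩ := h'.surj i
    rw [hg, hf]
  have hinj : Function.Injective f := Function.LeftInverse.injective hgf
  refine homeo_of_bijection f g hgf hfg (fun i => ?_) (fun x => ?_)
  · rw [h.wt, h'.wt, ← push_bij f hinj φ, ← push_bij f hinj (fun e => φ (s e))]
    simp only [hf]
  · rw [h.bdry, h'.bdry, hf]

theorem isGluing_comp [Fintype B] (F : Surf A B) (G : Surf B C) :
    IsGluing (Sum.elim F.wt G.wt) (fun b : B => Sum.inl (F.bdry (Sum.inr b)))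
      (fun b : B => Sum.inr (G.bdry (Sum.inl b)))
      (Sum.elim (fun a => Sum.inl (F.bdry (Sum.inl a))) fun c => Sum.inr (G.bdry (Sum.inr c)))
      (F.comp G) (compMk F G) where
  surj := Glue.mk_surjective _ _
  glue e := Glue.sound _ _ e
  univ X f hf := ⟨Quot.lift f (by rintro i j ⟨e, rfl, rfl⟩; exact hf e), fun i => rfl⟩
  wt q := by
    refine (glueGenus_spec _ _ _ q).trans ?_
    congr 2
    funext i
    cases i <;> rfl
  bdry x := by cases x <;> rfl

theorem IsGluing.precomp {I J E : Type} [Fintype I] [Fintype J] [Fintype E] {w : I → ℤ}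
    {s t : E → I} {b : A ⊕ B → I} {H : Surf A B} {φ : I → H.comps} (h : IsGluing w s t b H φ)
    (e : J ≃ I) (w' : J → ℤ) (s' t' : E → J) (b' : A ⊕ B → J) (hw : ∀ j, w (e j) = w' j)
    (hs : ∀ x, e (s' x) = s x) (ht : ∀ x, e (t' x) = t x) (hb : ∀ x, e (b' x) = b x) :
    IsGluing w' s' t' b' H (fun j => φ (e j)) where
  surj := h.surj.comp e.surjective
  glue x := by simp only [hs, ht]; exact h.glue x
  univ X f hf := by
    obtain ⟨f', hf'⟩ := h.univ X (fun i => f (e.symm i)) (by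
      intro x
      rw [← hs, ← ht]
      simpa using hf x)
    exact ⟨f', fun i => by rw [hf']; simp⟩
  wt q := by
    rw [h.wt]
    congr 1
    · rw [← push_equiv e]
      simp only [hw]
    · simp only [hs]
  bdry x := by rw [h.bdry, hb]

theorem comp_congr [Fintype B] {F F' : Surf A B} {G G' : Surf B C} (hF : F ≈ F') (hG : G ≈ G') :
    F.comp G ≈ F'.comp G' := by
  obtain ⟨e, he1, he2⟩ := hF
  obtain ⟨e', he1', he2'⟩ := hG
  refine (isGluing_comp F G).homeo
    ((isGluing_comp F' G').precomp (Equiv.sumCongr e e') _ _ _ _ ?_ ?_ ?_ ?_)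
  · rintro (i | i) <;> simp [Surf.wt, he1, he1']
  · intro x; simp [he2]
  · intro x; simp [he2']
  · rintro (x | x) <;> simp [he2, he2']

theorem cyl_comp [Fintype A] (F : Surf A B) : (cyl A).comp F ≈ F := by
  refine (isGluing_comp (cyl A) F).homeo (φ' := Sum.elim (fun a => F.bdry (Sum.inl a)) id) ?_
  refine ⟨fun i => ⟨Sum.inr i, rfl⟩, fun e => rfl, fun X f hf => ⟨fun i => f (Sum.inr i), ?_⟩,
    fun q => ?_, ?_⟩
  · rintro (a | i)
    · exact (hf a).symm
    · rfl
  · have h0 : ∀ (φ : A → F.comps), push (I := (cyl A).comps) φ (cyl A).wt q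
        = push (I := A) φ (fun _ => -1) q := by
      intro φ; simp [push, Surf.wt, cyl]; rfl
    have h1 := push_injective (id : F.comps → F.comps) Function.injective_id F.wt q
    have h3 := congrFun (push_add (fun a : A => F.bdry (Sum.inl a)) (fun _ => -1) (fun _ => 1)) q
    have h4 : push (fun a : A => F.bdry (Sum.inl a)) (fun i => (-1 : ℤ) + 1) q = 0 := by
      simp [push]
    have h5 := h0 fun a : A => F.bdry (Sum.inl a)
    refine Eq.trans ?_ (congrArg₂ (· + ·) (push_sum (I := (cyl A).comps) (J := F.comps) _ _ q)
      rfl).symm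
    change _ = (push (I := (cyl A).comps) (fun a : A => F.bdry (Sum.inl a)) (cyl A).wt q
      + push (id : F.comps → F.comps) F.wt q)
      + push (fun a : A => F.bdry (Sum.inl a)) (fun _ => 1) q
    simp only [id] at h1 ⊢
    linarith
  · rintro (x | x) <;> rfl

theorem comp_cyl [Fintype B] (F : Surf A B) : F.comp (cyl B) ≈ F := by
  refine (isGluing_comp F (cyl B)).homeo (φ' := Sum.elim id (fun a => F.bdry (Sum.inr a))) ?_
  refine ⟨fun i => ⟨Sum.inl i, rfl⟩, fun e => rfl, fun X f hf => ⟨fun i => f (Sum.inl i), ?_⟩,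
    fun q => ?_, ?_⟩
  · rintro (i | a)
    · rfl
    · exact (hf a)
  · have h0 : ∀ (φ : B → F.comps), push (I := (cyl B).comps) φ (cyl B).wt q
        = push (I := B) φ (fun _ => -1) q := by
      intro φ; simp [push, Surf.wt, cyl]; rfl
    have h1 := push_injective (id : F.comps → F.comps) Function.injective_id F.wt q
    have h3 := congrFun (push_add (fun a : B => F.bdry (Sum.inr a)) (fun _ => -1) (fun _ => 1)) q
    have h4 : push (fun a : B => F.bdry (Sum.inr a)) (fun i => (-1 : ℤ) + 1) q = 0 := by
      simp [push]
    have h5 := h0 fun a : B => F.bdry (Sum.inr a)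
    refine Eq.trans ?_ (congrArg₂ (· + ·) (push_sum (I := F.comps) (J := (cyl B).comps) _ _ q)
      rfl).symm
    change _ = (push (id : F.comps → F.comps) F.wt q
      + push (I := (cyl B).comps) (fun a : B => F.bdry (Sum.inr a)) (cyl B).wt q)
      + push (fun a : B => F.bdry (Sum.inr a)) (fun _ => 1) q
    simp only [id] at h1 ⊢
    linarith
  · rintro (x | x) <;> rfl

/-- Gluing three surfaces at once, first two first. -/
theorem isGluing_comp_comp [Fintype B] [Fintype C] (F : Surf A B) (G : Surf B C) (K : Surf C D) :
    ∃ φ, IsGluing (I := F.comps ⊕ (G.comps ⊕ K.comps)) (E := B ⊕ C)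
      (Sum.elim F.wt (Sum.elim G.wt K.wt))
      (Sum.elim (fun b => Sum.inl (F.bdry (Sum.inr b)))
        (fun c => Sum.inr (Sum.inl (G.bdry (Sum.inr c)))))
      (Sum.elim (fun b => Sum.inr (Sum.inl (G.bdry (Sum.inl b))))
        (fun c => Sum.inr (Sum.inr (K.bdry (Sum.inl c)))))
      (Sum.elim (fun a => Sum.inl (F.bdry (Sum.inl a)))
        fun d => Sum.inr (Sum.inr (K.bdry (Sum.inr d))))
      ((F.comp G).comp K) φ := by
  have h1 := isGluing_comp F G
  have h2 := isGluing_comp (F.comp G) K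
  set φ1 : F.comps ⊕ G.comps → (F.comp G).comps := compMk F G
  set φ2 : (F.comp G).comps ⊕ K.comps → ((F.comp G).comp K).comps := compMk _ _
  refine ⟨Sum.elim (fun i => φ2 (Sum.inl (φ1 (Sum.inl i))))
    (Sum.elim (fun i => φ2 (Sum.inl (φ1 (Sum.inr i)))) fun i => φ2 (Sum.inr i)), ?_⟩
  refine ⟨?_, ?_, ?_, ?_, ?_⟩
  · intro q
    obtain ⟨x | x, rfl⟩ := h2.surj q
    · obtain ⟨y | y, rfl⟩ := h1.surj x
      · exact ⟨Sum.inl y, rfl⟩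
      · exact ⟨Sum.inr (Sum.inl y), rfl⟩
    · exact ⟨Sum.inr (Sum.inr x), rfl⟩
  · rintro (b | c)
    · simp only [Sum.elim_inl, Sum.elim_inr]
      rw [h1.glue]
    · simp only [Sum.elim_inl, Sum.elim_inr]
      rw [← h2.glue]
      rfl
  · intro X f hf
    obtain ⟨f1, hf1⟩ := h1.univ X (Sum.elim (fun i => f (Sum.inl i)) fun i => f (Sum.inr (Sum.inl i)))
      (fun b => hf (Sum.inl b))
    obtain ⟨f2, hf2⟩ := h2.univ X (Sum.elim f1 fun i => f (Sum.inr (Sum.inr i))) (by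
      intro c
      have := hf (Sum.inr c)
      simp only [Sum.elim_inr, Sum.elim_inl] at this ⊢
      rw [← this, h1.bdry, hf1]
      rfl)
    refine ⟨f2, ?_⟩
    rintro (i | i | i)
    · simp [hf2, hf1]
    · simp [hf2, hf1]
    · simp [hf2]
  · intro q
    rw [h2.wt, push_sum, push_sum, push_sum]
    simp only [Sum.elim_inl, Sum.elim_inr]
    have e1 : (fun i => (F.comp G).wt i) = fun i => push φ1 (Sum.elim F.wt G.wt) i
        + push (fun e => φ1 (Sum.inl (F.bdry (Sum.inr e)))) (fun _ => 1) i := by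
      funext i; exact h1.wt i
    have e2 := congrFun (push_add (fun i => φ2 (Sum.inl i)) (push φ1 (Sum.elim F.wt G.wt))
      (push (fun e => φ1 (Sum.inl (F.bdry (Sum.inr e)))) (fun _ => 1))) q
    rw [← e1, push_push, push_push, push_sum] at e2
    have e3 : (fun e => φ2 (Sum.inl ((F.comp G).bdry (Sum.inr e))))
        = fun e => φ2 (Sum.inl (φ1 (Sum.inr (G.bdry (Sum.inr e))))) := by
      funext e; rw [h1.bdry]; rfl
    have e4 : push (fun i => φ2 (Sum.inl i)) (fun i => (F.comp G).wt i) q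
      = push (fun i => φ2 (Sum.inl i)) ((F.comp G).wt) q := rfl
    rw [e3]
    simp only [Sum.elim_inl, Sum.elim_inr] at e2
    rw [push_sum (I := B) (J := C)]
    simp only [Sum.elim_inl, Sum.elim_inr]
    linarith
  · rintro (x | x)
    · rw [h2.bdry]; simp only [Sum.elim_inl]; rw [h1.bdry]; rfl
    · rw [h2.bdry]; rfl

theorem isGluing_comp_comp' [Fintype B] [Fintype C] (F : Surf A B) (G : Surf B C) (K : Surf C D) :
    ∃ φ, IsGluing (I := F.comps ⊕ (G.comps ⊕ K.comps)) (E := B ⊕ C)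
      (Sum.elim F.wt (Sum.elim G.wt K.wt))
      (Sum.elim (fun b => Sum.inl (F.bdry (Sum.inr b)))
        (fun c => Sum.inr (Sum.inl (G.bdry (Sum.inr c)))))
      (Sum.elim (fun b => Sum.inr (Sum.inl (G.bdry (Sum.inl b))))
        (fun c => Sum.inr (Sum.inr (K.bdry (Sum.inl c)))))
      (Sum.elim (fun a => Sum.inl (F.bdry (Sum.inl a)))
        fun d => Sum.inr (Sum.inr (K.bdry (Sum.inr d))))
      (F.comp (G.comp K)) φ := by
  have h1 := isGluing_comp G K
  have h2 := isGluing_comp F (G.comp K)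
  set φ1 : G.comps ⊕ K.comps → (G.comp K).comps := compMk _ _
  set φ2 : F.comps ⊕ (G.comp K).comps → (F.comp (G.comp K)).comps := compMk _ _
  refine ⟨Sum.elim (fun i => φ2 (Sum.inl i)) (fun i => φ2 (Sum.inr (φ1 i))), ?_⟩
  refine ⟨?_, ?_, ?_, ?_, ?_⟩
  · intro q
    obtain ⟨x | x, rfl⟩ := h2.surj q
    · exact ⟨Sum.inl x, rfl⟩
    · obtain ⟨y, rfl⟩ := h1.surj x
      exact ⟨Sum.inr y, rfl⟩
  · rintro (b | c)
    · simp only [Sum.elim_inl, Sum.elim_inr]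
      rw [h2.glue, h1.bdry]
      rfl
    · simp only [Sum.elim_inr]
      rw [← h1.glue]
  · intro X f hf
    obtain ⟨f1, hf1⟩ := h1.univ X (fun i => f (Sum.inr i)) (fun c => hf (Sum.inr c))
    obtain ⟨f2, hf2⟩ := h2.univ X (Sum.elim (fun i => f (Sum.inl i)) f1) (by
      intro b
      have := hf (Sum.inl b)
      simp only [Sum.elim_inl, Sum.elim_inr] at this ⊢
      rw [this, h1.bdry, hf1]
      rfl)
    refine ⟨f2, ?_⟩
    rintro (i | i)
    · simp [hf2]
    · simp [hf2, hf1]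
  · intro q
    rw [h2.wt, push_sum, push_sum]
    simp only [Sum.elim_inl, Sum.elim_inr]
    have e1 : (fun i => (G.comp K).wt i) = fun i => push φ1 (Sum.elim G.wt K.wt) i
        + push (fun e => φ1 (Sum.inl (G.bdry (Sum.inr e)))) (fun _ => 1) i := by
      funext i; exact h1.wt i
    have e2 := congrFun (push_add (fun i => φ2 (Sum.inr i)) (push φ1 (Sum.elim G.wt K.wt))
      (push (fun e => φ1 (Sum.inl (G.bdry (Sum.inr e)))) (fun _ => 1))) q
    rw [← e1, push_push, push_push] at e2
    have e4 : push (fun i => φ2 (Sum.inr i)) (fun i => (G.comp K).wt i) q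
      = push (fun i => φ2 (Sum.inr i)) ((G.comp K).wt) q := rfl
    rw [push_sum (I := B) (J := C)]
    simp only [Sum.elim_inl, Sum.elim_inr]
    have e5 : ∀ u : G.comps ⊕ K.comps → ℤ, push (fun i => φ2 (Sum.inr (φ1 i))) (fun i => u i) q
      = push (fun i => φ2 (Sum.inr (φ1 i))) u q := fun _ => rfl
    linarith
  · rintro (x | x)
    · rw [h2.bdry]; rfl
    · rw [h2.bdry]; simp only [Sum.elim_inr]; rw [h1.bdry]; rfl

theorem comp_assoc [Fintype B] [Fintype C] (F : Surf A B) (G : Surf B C) (K : Surf C D) :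
    (F.comp G).comp K ≈ F.comp (G.comp K) := by
  obtain ⟨φ, h⟩ := isGluing_comp_comp F G K
  obtain ⟨φ', h'⟩ := isGluing_comp_comp' F G K
  exact h.homeo h'

theorem euler_congr [Fintype A] [Fintype B] {F G : Surf A B} (h : F ≈ G) : F.euler = G.euler := by
  obtain ⟨e, he, -⟩ := h
  simp only [euler]
  congr 2
  rw [← e.sum_comp]
  simp [he]

theorem euler_cyl [Fintype A] : (cyl A).euler = 0 := by
  have h : ∑ i : (cyl A).comps, (2 - 2 * ((cyl A).genus i : ℤ)) = ∑ _i : A, (2 : ℤ) := by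
    simp [cyl]
    rfl
  rw [euler, h]
  simp
  ring

theorem euler_comp [Fintype A] [Fintype B] [Fintype C] (F : Surf A B) (G : Surf B C) :
    (F.comp G).euler = F.euler + G.euler := by
  have h := isGluing_comp F G
  have h2 : ∑ q, (F.comp G).wt q = (∑ i, F.wt i + ∑ i, G.wt i) + Fintype.card B := by
    rw [Finset.sum_congr rfl fun q _ => h.wt q, Finset.sum_add_distrib, sum_push, sum_push]
    simp
  rw [euler_eq, euler_eq, euler_eq, h2]
  ring

end Surf

end BarNatan

namespace BarNatan

open CategoryTheory

/-- An object: a finite collection of circles together with a degree shift `{shift}`. -/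
structure Cob where
  circles : Type
  [fintype : Fintype circles]
  shift : ℤ

attribute [instance] Cob.fintype

/-- The Euler characteristic of a homeomorphism class of surfaces. -/
def eulerClass {A B : Type} [Fintype A] [Fintype B] (S : Quotient (Surf.setoid A B)) : ℤ :=
  Quotient.lift Surf.euler (fun _ _ h => Surf.euler_congr h) S

/-- A morphism `A{m} ⟶ B{n}` is a cobordism of degree zero up to homeomorphism, where the degree
of a cobordism `S` from `A{m}` to `B{n}` is `χ(S) + n - m`. -/
def Cob.Hom (X Y : Cob) : Type 1 :=
  {S : Quotient (Surf.setoid X.circles Y.circles) // eulerClass S + Y.shift - X.shift = 0}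

noncomputable def Cob.compClass {A B C : Type} [Fintype B] (S : Quotient (Surf.setoid A B))
    (T : Quotient (Surf.setoid B C)) : Quotient (Surf.setoid A C) :=
  Quotient.map₂ Surf.comp (fun _ _ h _ _ h' => Surf.comp_congr h h') S T

noncomputable instance : Category Cob where
  Hom := Cob.Hom
  id X := ⟨⟦Surf.cyl X.circles⟧, by
    have : eulerClass ⟦Surf.cyl X.circles⟧ = 0 := Surf.euler_cyl
    rw [this]; ring⟩
  comp {X Y Z} S T := ⟨Cob.compClass S.1 T.1, by
    obtain ⟨S, hS⟩ := S
    obtain ⟨T, hT⟩ := T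
    induction S using Quotient.inductionOn with | _ S => ?_
    induction T using Quotient.inductionOn with | _ T => ?_
    change S.euler + _ - _ = 0 at hS
    change T.euler + _ - _ = 0 at hT
    change (S.comp T).euler + _ - _ = 0
    rw [Surf.euler_comp]
    linarith⟩
  id_comp := by
    rintro X Y ⟨S, hS⟩
    induction S using Quotient.inductionOn with | _ S => ?_
    exact Subtype.ext (Quotient.sound (Surf.cyl_comp S))
  comp_id := by
    rintro X Y ⟨S, hS⟩
    induction S using Quotient.inductionOn with | _ S => ?_
    exact Subtype.ext (Quotient.sound (Surf.comp_cyl S))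
  assoc := by
    rintro X Y Z W ⟨S, hS⟩ ⟨T, hT⟩ ⟨U, hU⟩
    induction S using Quotient.inductionOn with | _ S => ?_
    induction T using Quotient.inductionOn with | _ T => ?_
    induction U using Quotient.inductionOn with | _ U => ?_
    exact Subtype.ext (Quotient.sound (Surf.comp_assoc S T U))

/-- The homeomorphism class of the surface underlying a morphism. -/
def Cob.surf {X Y : Cob} (f : X ⟶ Y) : Quotient (Surf.setoid X.circles Y.circles) :=
  Subtype.val f

/-- A surface of degree zero as a morphism. -/
def Cob.ofSurf {X Y : Cob} (S : Surf X.circles Y.circles)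
    (h : S.euler + Y.shift - X.shift = 0) : X ⟶ Y :=
  ⟨⟦S⟧, h⟩

/-- A cobordism as a formal `ℤ`-linear combination of cobordisms. -/
noncomputable def Cob.lin {X Y : Cob} (f : X ⟶ Y) : Free.of ℤ X ⟶ Free.of ℤ Y :=
  (Free.embedding ℤ Cob).map f

/-- The local relations S (a surface with a sphere component vanishes), T (a torus component may
be replaced by the factor `2`) and 4TU (for four discs `1, 2, 3, 4` on a surface `F`, lying on
the components `p 0, p 1, p 2, p 3`, tubing along `12` or `34` has the same sum as tubing along
`13` or `24`). -/
inductive LocalRel {X Y : Cob} : (Free.of ℤ X ⟶ Free.of ℤ Y) → Prop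
  | sphere (F : Surf X.circles Y.circles) (f : X ⟶ Y) (hf : Cob.surf f = ⟦F.addClosed 0⟧) :
      LocalRel (Cob.lin f)
  | torus (F : Surf X.circles Y.circles) (f g : X ⟶ Y) (hf : Cob.surf f = ⟦F.addClosed 1⟧)
      (hg : Cob.surf g = ⟦F⟧) : LocalRel (Cob.lin f - (2 : ℤ) • Cob.lin g)
  | fourTube (F : Surf X.circles Y.circles) (p : Fin 4 → F.comps)
      (f₁₂ f₃₄ f₁₃ f₂₄ : X ⟶ Y) (h₁₂ : Cob.surf f₁₂ = ⟦F.tube (p 0) (p 1)⟧)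
      (h₃₄ : Cob.surf f₃₄ = ⟦F.tube (p 2) (p 3)⟧) (h₁₃ : Cob.surf f₁₃ = ⟦F.tube (p 0) (p 2)⟧)
      (h₂₄ : Cob.surf f₂₄ = ⟦F.tube (p 1) (p 3)⟧) :
      LocalRel (Cob.lin f₁₂ + Cob.lin f₃₄ - Cob.lin f₁₃ - Cob.lin f₂₄)

/-- The ideal of morphisms generated by the local relations. -/
noncomputable def localIdeal (X Y : Free ℤ Cob) : AddSubgroup (X ⟶ Y) :=
  AddSubgroup.closure {φ | ∃ (X' Y' : Cob) (f : X ⟶ Free.of ℤ X')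
    (ρ : Free.of ℤ X' ⟶ Free.of ℤ Y') (g : Free.of ℤ Y' ⟶ Y), LocalRel ρ ∧ φ = f ≫ ρ ≫ g}

/-- Equality modulo the local relations. -/
def localHomRel : HomRel (Free ℤ Cob) := fun X Y f g => f - g ∈ localIdeal X Y

theorem localIdeal_comp_left {X Y Z : Free ℤ Cob} (f : X ⟶ Y) {φ : Y ⟶ Z}
    (h : φ ∈ localIdeal Y Z) : f ≫ φ ∈ localIdeal X Z := by
  induction h using AddSubgroup.closure_induction with
  | mem x hx =>
    obtain ⟨X', Y', a, ρ, b, hρ, rfl⟩ := hx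
    exact AddSubgroup.subset_closure ⟨X', Y', f ≫ a, ρ, b, hρ, by simp⟩
  | zero => rw [Limits.comp_zero]; exact zero_mem _
  | add x y _ _ hx hy => rw [Preadditive.comp_add]; exact add_mem hx hy
  | neg x _ hx => rw [Preadditive.comp_neg]; exact neg_mem hx

theorem localIdeal_comp_right {X Y Z : Free ℤ Cob} {φ : X ⟶ Y} (g : Y ⟶ Z)
    (h : φ ∈ localIdeal X Y) : φ ≫ g ∈ localIdeal X Z := by
  induction h using AddSubgroup.closure_induction with
  | mem x hx =>
    obtain ⟨X', Y', a, ρ, b, hρ, rfl⟩ := hx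
    exact AddSubgroup.subset_closure ⟨X', Y', a, ρ, b ≫ g, hρ, by simp⟩
  | zero => rw [Limits.zero_comp]; exact zero_mem _
  | add x y _ _ hx hy => rw [Preadditive.add_comp]; exact add_mem hx hy
  | neg x _ hx => rw [Preadditive.neg_comp]; exact neg_mem hx

instance : Congruence localHomRel where
  comp_left {_ _ _} f {g g'} h := by
    simp only [localHomRel] at h ⊢
    rw [← Preadditive.comp_sub]
    exact localIdeal_comp_left f h
  comp_right g h := by
    simp only [localHomRel] at h ⊢
    rw [← Preadditive.sub_comp]
    exact localIdeal_comp_right g h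
  equivalence :=
    { refl := fun f => by simp [localHomRel, zero_mem]
      symm := fun {f g} h => by
        simp only [localHomRel] at h ⊢
        rw [← neg_sub]; exact neg_mem h
      trans := fun {f g k} h h' => by
        simp only [localHomRel] at h h' ⊢
        rw [← sub_add_sub_cancel f g k]; exact add_mem h h' }

/-- The category of cobordisms modulo the local relations: formal `ℤ`-linear combinations of
(degree zero) cobordisms, modulo S, T and 4TU. -/
abbrev CobL := CategoryTheory.Quotient localHomRel

noncomputable instance : Preadditive CobL :=
  Quotient.preadditive localHomRel (by
    intro X Y f₁ f₂ g₁ g₂ h h'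
    simp only [localHomRel] at h h' ⊢
    rw [add_sub_add_comm]
    exact add_mem h h')

/-- An object of `CobL`. -/
def CobL.of (X : Cob) : CobL := ⟨Free.of ℤ X⟩

/-- The class of a cobordism in `CobL`. -/
noncomputable def CobL.mk {X Y : Cob} (f : X ⟶ Y) : CobL.of X ⟶ CobL.of Y :=
  (Quotient.functor localHomRel).map (Cob.lin f)

theorem CobL.mk_id (X : Cob) : CobL.mk (𝟙 X) = 𝟙 (CobL.of X) := by
  simp only [CobL.mk, Cob.lin, CategoryTheory.Functor.map_id]
  rfl

theorem CobL.mk_comp {X Y Z : Cob} (f : X ⟶ Y) (g : Y ⟶ Z) :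
    CobL.mk (f ≫ g) = CobL.mk f ≫ CobL.mk g := by
  simp only [CobL.mk, Cob.lin, CategoryTheory.Functor.map_comp]
  exact Functor.map_comp _ _ _

/-! ### The special line -/

/-- The curtain with `k` handles: the connected surface of genus `k` from one circle to one circle. -/
def curtainSurf (k : ℕ) : Surf Unit Unit where
  comps := Unit
  genus _ := k
  bdry _ := ()

/-- The special line (a single circle) with degree shift `m`. -/
def lineObj (m : ℤ) : Cob where
  circles := Unit
  shift := m

theorem euler_curtain (k : ℕ) : (curtainSurf k).euler = -2 * k := by
  have h : ∑ i : (curtainSurf k).comps, (2 - 2 * ((curtainSurf k).genus i : ℤ))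
      = ∑ _i : Unit, (2 - 2 * (k : ℤ)) := rfl
  rw [Surf.euler, h]
  simp
  ring

/-- The `k`-th power of the special 1-handle operator on the special line. -/
noncomputable def handlePow {m n : ℤ} (k : ℕ) (h : n = m + 2 * k) : lineObj m ⟶ lineObj n :=
  Cob.ofSurf (curtainSurf k) (by
    have h' : (curtainSurf k).euler = -2 * k := euler_curtain k
    change (curtainSurf k).euler + n - m = 0
    linarith)

theorem handlePow_zero (m : ℤ) (h : m = m + 2 * (0 : ℕ)) : handlePow 0 h = 𝟙 (lineObj m) := by
  refine Subtype.ext (Quotient.sound ?_)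
  exact ⟨Equiv.refl _, fun _ => rfl, fun _ => rfl⟩

theorem curtain_comp (k l : ℕ) : (curtainSurf k).comp (curtainSurf l) ≈ curtainSurf (k + l) := by
  refine (Surf.isGluing_comp (curtainSurf k) (curtainSurf l)).homeo (φ' := fun _ => ()) ?_
  refine ⟨fun i => ⟨Sum.inl i, rfl⟩, fun e => rfl, fun X f hf => ⟨fun _ => f (Sum.inl ()), ?_⟩,
    fun q => ?_, fun _ => rfl⟩
  · rintro (⟨⟩ | ⟨⟩)
    · rfl
    · exact hf ()
  · change ((k + l : ℕ) : ℤ) - 1 = push (I := Unit ⊕ Unit) (Q := Unit) (fun _ => ())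
      (Sum.elim (fun _ => (k : ℤ) - 1) fun _ => (l : ℤ) - 1) ()
      + push (I := Unit) (Q := Unit) (fun _ => ()) (fun _ => 1) ()
    simp [push]
    ring

theorem handlePow_comp {m n r : ℤ} (k l : ℕ) (h : n = m + 2 * k) (h' : r = n + 2 * l)
    (h'' : r = m + 2 * (k + l : ℕ)) : handlePow k h ≫ handlePow l h' = handlePow (k + l) h'' :=
  Subtype.ext (Quotient.sound (curtain_comp k l))

end BarNatan

namespace BarNatan

open CategoryTheory

/-- A graded free `ℤ[H]`-module of finite rank with a homogeneous basis indexed by `index`; the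
basis element `i` spans a copy of `ℤ[H]{deg i}`. -/
structure GrFree where
  index : Type
  [fintype : Fintype index]
  deg : index → ℤ

attribute [instance] GrFree.fintype

namespace GrFree

/-- The underlying free `ℤ[H]`-module; `H` is the variable of the polynomial ring. -/
abbrev module (M : GrFree) : Type := M.index → Polynomial ℤ

open Classical in
/-- The coefficient of a linear map at a pair of basis elements. -/
noncomputable def entry {M N : GrFree} (f : M.module →ₗ[Polynomial ℤ] N.module) (i : M.index)
    (j : N.index) : Polynomial ℤ := f (Pi.single i 1) j

/-- The `ℤ[H]`-linear maps of degree zero, where `H` has degree `-2`. -/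
noncomputable def homSubgroup (M N : GrFree) :
    AddSubgroup (M.module →ₗ[Polynomial ℤ] N.module) where
  carrier := {f | ∀ i j k, (entry f i j).coeff k ≠ 0 → N.deg j = M.deg i + 2 * k}
  zero_mem' := by intro i j k h; simp [entry] at h
  add_mem' := by
    intro f g hf hg i j k h
    by_cases h0 : (entry f i j).coeff k = 0
    · refine hg i j k fun h1 => h ?_
      simp only [entry] at h0 h1 ⊢
      simp [h0, h1]
    · exact hf i j k h0
  neg_mem' := by
    intro f hf i j k h
    refine hf i j k fun h1 => h ?_
    simp only [entry] at h1 ⊢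
    simp [h1]

theorem entry_id (M : GrFree) [DecidableEq M.index] (i j : M.index) :
    entry (M := M) (N := M) LinearMap.id i j = if i = j then 1 else 0 := by
  simp only [entry, LinearMap.id_coe, id, Pi.single_apply]
  simp only [eq_comm]

theorem entry_comp {M N K : GrFree} (f : M.module →ₗ[Polynomial ℤ] N.module)
    (g : N.module →ₗ[Polynomial ℤ] K.module) (i : M.index) (k : K.index) :
    entry (g.comp f) i k = ∑ j, entry f i j * entry g j k := by
  classical
  simp only [entry, LinearMap.comp_apply]
  conv_lhs => rw [LinearMap.pi_apply_eq_sum_univ g]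
  simp only [Finset.sum_apply, Pi.smul_apply, smul_eq_mul]
  refine Finset.sum_congr rfl fun j _ => ?_
  refine congrArg₂ (· * ·) rfl (congrFun (congrArg g ?_) k)
  funext l
  simp [Pi.single_apply, eq_comm]

noncomputable instance : Category GrFree where
  Hom M N := homSubgroup M N
  id M := ⟨LinearMap.id, by
    classical
    intro i j k h
    rw [entry_id] at h
    split_ifs at h with hij
    · subst hij
      rw [Polynomial.coeff_one] at h
      split_ifs at h with hk
      · subst hk; simp
      · exact absurd rfl h
    · simp at h⟩
  comp f g := ⟨g.1.comp f.1, by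
    intro i k n h
    rw [entry_comp, Polynomial.finsetSum_coeff] at h
    obtain ⟨j, -, hj⟩ := Finset.exists_ne_zero_of_sum_ne_zero h
    rw [Polynomial.coeff_mul] at hj
    obtain ⟨⟨a, b⟩, hab, hj⟩ := Finset.exists_ne_zero_of_sum_ne_zero hj
    have h1 := f.2 i j a (left_ne_zero_of_mul hj)
    have h2 := g.2 j k b (right_ne_zero_of_mul hj)
    rw [Finset.HasAntidiagonal.mem_antidiagonal] at hab
    simp only at hab
    subst hab
    push_cast
    linarith⟩
  id_comp f := Subtype.ext (LinearMap.comp_id _)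
  comp_id f := Subtype.ext (LinearMap.id_comp _)
  assoc f g h := Subtype.ext (LinearMap.comp_assoc _ _ _)

/-- The linear map underlying a morphism. -/
def toLin {M N : GrFree} (f : M ⟶ N) : M.module →ₗ[Polynomial ℤ] N.module := Subtype.val f

noncomputable instance : Preadditive GrFree where
  homGroup M N := inferInstanceAs (AddCommGroup (homSubgroup M N))
  add_comp _ _ _ _ _ _ := Subtype.ext (LinearMap.comp_add _ _ _)
  comp_add _ _ _ _ _ _ := Subtype.ext (LinearMap.add_comp _ _ _)

/-- The matrix of a morphism with respect to the homogeneous bases. -/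
noncomputable def coef {M N : GrFree} (f : M ⟶ N) (i : M.index) (j : N.index) : Polynomial ℤ :=
  entry (toLin f) i j

end GrFree

/-- The morphism between special lines given by a polynomial in the special 1-handle operator:
the sum of `c_k • H^k` over all terms `c_k X^k` of degree zero. -/
noncomputable def polyH (m n : ℤ) (p : Polynomial ℤ) :
    CobL.of (lineObj m) ⟶ CobL.of (lineObj n) :=
  p.sum fun k c => if h : n = m + 2 * k then c • CobL.mk (handlePow k h) else 0

theorem polyH_zero (m n : ℤ) : polyH m n 0 = 0 := Polynomial.sum_zero_index _

theorem polyH_add (m n : ℤ) (p q : Polynomial ℤ) :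
    polyH m n (p + q) = polyH m n p + polyH m n q := by
  refine Polynomial.sum_add_index p q _ (fun k => ?_) (fun k a b => ?_)
  · split_ifs <;> simp
  · split_ifs <;> simp [add_smul]

theorem polyH_monomial (m n : ℤ) (k : ℕ) (c : ℤ) :
    polyH m n (Polynomial.monomial k c)
      = if h : n = m + 2 * k then c • CobL.mk (handlePow k h) else 0 := by
  refine Polynomial.sum_monomial_index c _ ?_
  split_ifs <;> simp

theorem polyH_one (m : ℤ) : polyH m m 1 = 𝟙 _ := by
  have h : m = m + 2 * (0 : ℕ) := by simp
  rw [← Polynomial.monomial_zero_one, polyH_monomial, dif_pos h, handlePow_zero, one_smul,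
    CobL.mk_id]

theorem polyH_sum {ι : Type} (s : Finset ι) (m n : ℤ) (p : ι → Polynomial ℤ) :
    polyH m n (∑ i ∈ s, p i) = ∑ i ∈ s, polyH m n (p i) := by
  classical
  induction s using Finset.induction_on with
  | empty => simp [polyH_zero]
  | insert a s ha ih => rw [Finset.sum_insert ha, Finset.sum_insert ha, polyH_add, ih]

/-- A polynomial all of whose terms have degree `n - m` is a monomial. -/
theorem eq_monomial_of_homogeneous {m n : ℤ} {p : Polynomial ℤ}
    (hp : ∀ k, p.coeff k ≠ 0 → n = m + 2 * k) (h0 : p ≠ 0) :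
    ∃ (k : ℕ) (c : ℤ), n = m + 2 * k ∧ p = Polynomial.monomial k c := by
  obtain ⟨k, hk⟩ : ∃ k, p.coeff k ≠ 0 := by
    by_contra h
    push Not at h
    exact h0 (Polynomial.ext (by simpa using h))
  refine ⟨k, p.coeff k, hp k hk, ?_⟩
  ext l
  rw [Polynomial.coeff_monomial]
  split_ifs with h
  · rw [h]
  · by_contra hl
    have h1 := hp k hk
    have h2 := hp l hl
    omega

theorem polyH_mul {m n r : ℤ} {p q : Polynomial ℤ} (hp : ∀ k, p.coeff k ≠ 0 → n = m + 2 * k)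
    (hq : ∀ k, q.coeff k ≠ 0 → r = n + 2 * k) :
    polyH m r (p * q) = polyH m n p ≫ polyH n r q := by
  by_cases h0 : p = 0
  · simp [h0, polyH_zero]
  by_cases h1 : q = 0
  · simp [h1, polyH_zero]
  obtain ⟨k, c, hk, rfl⟩ := eq_monomial_of_homogeneous hp h0
  obtain ⟨l, d, hl, rfl⟩ := eq_monomial_of_homogeneous hq h1
  have h2 : r = m + 2 * (k + l : ℕ) := by push_cast; linarith
  rw [Polynomial.monomial_mul_monomial, polyH_monomial, polyH_monomial, polyH_monomial,
    dif_pos hk, dif_pos hl, dif_pos h2, Preadditive.zsmul_comp, Preadditive.comp_zsmul,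
    ← CobL.mk_comp, handlePow_comp k l hk hl h2, smul_smul]

/-- A column of special lines, one for each basis element. -/
def specialLineObj (M : GrFree) : Mat_ CobL where
  ι := M.index
  X i := CobL.of (lineObj (M.deg i))

/-- Replace every entry of a matrix over `ℤ[H]` by the corresponding combination of curtains. -/
noncomputable def specialLineMap {M N : GrFree} (f : M ⟶ N) :
    specialLineObj M ⟶ specialLineObj N :=
  fun i j => polyH (M.deg i) (N.deg j) (GrFree.coef f i j)

/-- The functor that replaces each copy of `ℤ[H]{m}` by the special line with shift `m` and
multiplication by `H` by the special 1-handle operator. -/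
noncomputable def specialLine : GrFree ⥤ Mat_ CobL where
  obj := specialLineObj
  map := specialLineMap
  map_id M := by
    classical
    refine Mat_.hom_ext _ _ fun i j => ?_
    have h : GrFree.coef (𝟙 M) i j = if i = j then 1 else 0 := GrFree.entry_id M i j
    by_cases hij : i = j
    · subst hij
      rw [Mat_.id_apply_self, specialLineMap, h, if_pos rfl]
      exact polyH_one _
    · rw [Mat_.id_apply_of_ne _ _ _ hij, specialLineMap, h, if_neg hij]
      exact polyH_zero _ _
  map_comp {M N K} f g := by
    refine Mat_.hom_ext _ _ fun i k => ?_
    have h : GrFree.coef (f ≫ g) i k = ∑ j, GrFree.coef f i j * GrFree.coef g j k :=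
      GrFree.entry_comp _ _ _ _
    rw [Mat_.comp_apply, specialLineMap, h, polyH_sum]
    refine Finset.sum_congr rfl fun j _ => ?_
    exact polyH_mul (fun l hl => f.2 i j l hl) (fun l hl => g.2 j k l hl)

instance : specialLine.Additive where
  map_add {M N f g} := by
    refine Mat_.hom_ext _ _ fun i j => ?_
    exact polyH_add _ _ _ _

end BarNatan

namespace BarNatan

section Cycles

open Equiv.Perm

theorem card_orbits {α : Type} [Fintype α] [DecidableEq α] (σ : Equiv.Perm α) :
    Nat.card (Quotient (SameCycle.setoid σ)) + σ.support.card
      = Multiset.card σ.cycleType + Fintype.card α := by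
  classical
  let F : α → σ.cycleFactorsFinset ⊕ {x : α // σ x = x} := fun x =>
    if h : σ x = x then Sum.inr ⟨x, h⟩
    else Sum.inl ⟨cycleOf σ x, cycleOf_mem_cycleFactorsFinset_iff.2 (mem_support.2 h)⟩
  have hF : ∀ x y, SameCycle σ x y ↔ F x = F y := by
    intro x y
    by_cases hx : σ x = x
    · by_cases hy : σ y = y
      · simp only [F, hx, hy, dif_pos]
        constructor
        · intro h
          congr 2
          obtain ⟨i, hi⟩ := h
          rw [← hi]
          exact (zpow_apply_eq_self_of_apply_eq_self hx i).symm
        · intro h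
          simp only [Sum.inr.injEq, Subtype.mk.injEq] at h
          rw [h]
      · simp only [F, hx, hy, dif_pos, dif_neg, not_false_eq_true]
        constructor
        · intro h
          exact absurd (h.apply_eq_self_iff.1 hx) hy
        · intro h; simp at h
    · by_cases hy : σ y = y
      · simp only [F, hx, hy, dif_pos, dif_neg, not_false_eq_true]
        constructor
        · intro h
          exact absurd (h.apply_eq_self_iff.2 hy) hx
        · intro h; simp at h
      · simp only [F, hx, hy, dif_neg, not_false_eq_true]
        constructor
        · intro h
          simp only [h.cycleOf_eq]
        · intro h
          simp only [Sum.inl.injEq, Subtype.mk.injEq] at h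
          have h1 : y ∈ support (cycleOf σ y) := by
            rw [mem_support_cycleOf_iff]
            exact ⟨SameCycle.refl _ _, mem_support.2 hy⟩
          rw [← h, mem_support_cycleOf_iff] at h1
          exact h1.1
  have hsurj : Function.Surjective F := by
    rintro (⟨c, hc⟩ | ⟨x, hx⟩)
    · have hcyc := (mem_cycleFactorsFinset_iff.1 hc).1
      obtain ⟨x, hx⟩ := hcyc.nonempty_support
      have h1 := cycle_is_cycleOf hx hc
      refine ⟨x, ?_⟩
      have h2 : σ x ≠ x := mem_support.1 (mem_cycleFactorsFinset_support_le hc hx)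
      simp only [F, h2, dif_neg, not_false_eq_true]
      congr 2
      exact h1.symm
    · exact ⟨x, by simp only [F, hx, dif_pos]⟩
  have e : Quotient (SameCycle.setoid σ) ≃ σ.cycleFactorsFinset ⊕ {x : α // σ x = x} :=
    Equiv.ofBijective (Quotient.lift F fun x y h => (hF x y).1 h) ⟨by
      rintro ⟨x⟩ ⟨y⟩ h
      exact Quotient.sound ((hF x y).2 h), fun z => by
      obtain ⟨x, hx⟩ := hsurj z
      exact ⟨⟦x⟧, hx⟩⟩
  rw [Nat.card_congr e, Nat.card_sum]
  have h1 : Nat.card σ.cycleFactorsFinset = Multiset.card σ.cycleType := by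
    rw [cycleType_def]; simp
  have h2 : Nat.card {x : α // σ x = x} = σ.supportᶜ.card := by
    rw [Nat.card_eq_fintype_card, Fintype.card_subtype]
    congr 1
    ext x
    simp
  rw [h1, h2, add_assoc, Finset.card_compl_add_card]

/-- Multiplying a permutation by a transposition changes the parity of the number of cycles. -/
theorem card_orbits_swap {α : Type} [Fintype α] [DecidableEq α] (σ : Equiv.Perm α) {a b : α}
    (hab : a ≠ b) : Odd (Nat.card (Quotient (SameCycle.setoid σ))
      + Nat.card (Quotient (SameCycle.setoid (σ * Equiv.swap a b)))) := by
  have key : ∀ τ : Equiv.Perm α, (-1 : ℤˣ) ^ (Nat.card (Quotient (SameCycle.setoid τ)))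
      = (-1) ^ (Fintype.card α) * sign τ := by
    intro τ
    have h := card_orbits τ
    rw [sign_of_cycleType, sum_cycleType, ← pow_add]
    have h2 : Fintype.card α + (τ.support.card + Multiset.card τ.cycleType)
      = Nat.card (Quotient (SameCycle.setoid τ)) + 2 * τ.support.card := by omega
    rw [h2, pow_add, pow_mul]
    simp
  have h1 := key σ
  have h2 := key (σ * Equiv.swap a b)
  rw [Equiv.Perm.sign_mul, sign_swap hab] at h2
  rw [← Nat.not_even_iff_odd]
  intro he
  have h3 := he.neg_one_pow (α := ℤˣ)
  rw [pow_add, h1, h2] at h3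
  have h4 : ∀ x y : ℤˣ, x * y * (x * (y * -1)) = -1 := by decide
  rw [h4] at h3
  exact absurd h3 (by decide)

end Cycles

/-- The combinatorial data of an oriented link diagram on an oriented surface. There are `n`
crossings. The four edge ends ("darts") at each crossing are numbered counterclockwise
`0, 1, 2, 3`, starting with the incoming end of the lower strand, so that the lower strand runs
from `0` to `2` and the upper strand joins `1` and `3`. The edges of the diagram match the darts
in pairs through `opp`. In addition there may be `loops` crossingless circles. -/
structure DiagramData where
  n : ℕ
  /-- whether a crossing is positive -/
  positive : Fin n → Bool
  opp : Fin n × Fin 4 → Fin n × Fin 4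
  opp_opp : ∀ d, opp (opp d) = d
  loops : ℕ

namespace DiagramData

variable (D : DiagramData)

/-- The edge ends of the crossings. -/
abbrev Dart : Type := Fin D.n × Fin 4

/-- Whether the strand through a dart is oriented towards the crossing. At a positive crossing the
upper strand runs from `3` to `1`, at a negative crossing from `1` to `3`. -/
def incoming (d : D.Dart) : Bool :=
  ![true, !D.positive d.1, false, D.positive d.1] d.2

/-- The next dart in counterclockwise order around the same crossing. -/
def rot (d : D.Dart) : D.Dart := (d.1, d.2 + 1)

/-- The faces: the orbits of "follow the edge, then turn to the next dart". -/
abbrev Face : Type := Quot fun d e : D.Dart => e = D.rot (D.opp d)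

/-- The connected components of the underlying 4-valent graph. -/
abbrev Piece : Type := Quot fun d e : D.Dart => e = D.rot d ∨ e = D.opp d

end DiagramData

/-- An oriented link diagram in the plane (or on the sphere): the orientations of the strands match
along the edges, and the closed surface obtained from the underlying 4-valent graph (with `n`
vertices and `2 n` edges) by gluing a disc to each face is a union of spheres. The latter is Euler's
formula `V - E + F = 2 c`, where `c` is the number of connected components of the graph. -/
structure LinkDiagram extends DiagramData where
  oriented : ∀ d, toDiagramData.incoming (opp d) = !toDiagramData.incoming d
  planar : (n : ℤ) - 2 * n + Nat.card toDiagramData.Face = 2 * Nat.card toDiagramData.Piece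

namespace LinkDiagram

variable (D : LinkDiagram)

/-- The underlying curve cut at the crossings: the half-edges and the crossingless circles. -/
abbrev Arc : Type := D.Dart ⊕ Fin D.loops

/-- How a smoothing connects the darts at a crossing: the `0`-smoothing (`false`) joins `0, 1` and
`2, 3`, the `1`-smoothing (`true`) joins `0, 3` and `1, 2`. -/
def turn (v : Fin D.n → Bool) (d : D.Dart) : D.Dart :=
  (d.1, if v d.1 then ![3, 2, 1, 0] d.2 else ![1, 0, 3, 2] d.2)

/-- Adjacent arcs in the smoothing `v`. -/
inductive Step (v : Fin D.n → Bool) : D.Arc → D.Arc → Prop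
  | edge (d : D.Dart) : Step v (Sum.inl d) (Sum.inl (D.opp d))
  | turn (d : D.Dart) : Step v (Sum.inl d) (Sum.inl (D.turn v d))

/-- Two arcs lie on the same circle of the smoothing `v`. -/
def sameCircle (v : Fin D.n → Bool) : Setoid D.Arc := Relation.EqvGen.setoid (D.Step v)

/-- The circles of the smoothing `v`. -/
abbrev Circles (v : Fin D.n → Bool) : Type := Quotient (D.sameCircle v)

noncomputable instance quotFintype (R : Setoid D.Arc) : Fintype (Quotient R) :=
  Fintype.ofFinite _

/-- For smoothings `v` and `w` that differ at one crossing: the cobordism from the circles of `v`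
to the circles of `w` which is a saddle near that crossing and a cylinder elsewhere. A component
consists of circles sharing arcs; all components have genus zero (they are cylinders and one
pair of pants). -/
noncomputable def saddleSurf (v w : Fin D.n → Bool) : Surf (D.Circles v) (D.Circles w) where
  comps := Quotient (D.sameCircle v ⊔ D.sameCircle w)
  genus _ := 0
  bdry := Sum.elim
    (Quotient.lift (fun a => (⟦a⟧ : Quotient (D.sameCircle v ⊔ D.sameCircle w)))
      fun _ _ h => Quotient.sound ((le_sup_left : D.sameCircle v ≤ _) h))
    (Quotient.lift (fun a => (⟦a⟧ : Quotient (D.sameCircle v ⊔ D.sameCircle w)))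
      fun _ _ h => Quotient.sound ((le_sup_right : D.sameCircle w ≤ _) h))

theorem incoming_card : Fintype.card {d : D.Dart // D.incoming d = true} = 2 * D.n := by
  have h : ∀ i : Fin D.n, (∑ k : Fin 4, if D.incoming (i, k) = true then 1 else 0) = 2 := by
    intro i
    rw [Fin.sum_univ_four]
    have hb : ∀ b : Bool, ((((if (![true, !b, false, b] : Fin 4 → Bool) 0 = true then 1 else 0)
        + if (![true, !b, false, b] : Fin 4 → Bool) 1 = true then 1 else 0)
        + if (![true, !b, false, b] : Fin 4 → Bool) 2 = true then 1 else 0)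
        + if (![true, !b, false, b] : Fin 4 → Bool) 3 = true then 1 else 0) = 2 := by decide
    exact hb (D.positive i)
  rw [Fintype.card_subtype, Finset.card_filter, Fintype.sum_prod_type]
  simp_rw [h]
  simp [mul_comm]

theorem sum_darts (G : D.Dart → ZMod 2) :
    ∑ d, G d = ∑ e : {d : D.Dart // D.incoming d = true}, (G e.1 + G (D.opp e.1)) := by
  classical
  let oppE : {d : D.Dart // D.incoming d = true} ≃ {d : D.Dart // ¬ D.incoming d = true} :=
    { toFun := fun d => ⟨D.opp d.1, by rw [D.oriented, d.2]; simp⟩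
      invFun := fun d => ⟨D.opp d.1, by
        rw [D.oriented]
        have := d.2
        simpa using this⟩
      left_inv := fun d => Subtype.ext (D.opp_opp _)
      right_inv := fun d => Subtype.ext (D.opp_opp _) }
  rw [Finset.sum_add_distrib, ← Fintype.sum_subtype_add_sum_subtype (fun d => D.incoming d = true) G]
  congr 1
  exact (oppE.sum_comp fun d => G d.1).symm

/-- A planar diagram has a checkerboard colouring: the darts can be two-coloured so that opposite
ends of an edge, as well as neighbouring darts at a crossing, have different colours. -/
theorem exists_colouring : ∃ κ : D.Dart → ZMod 2,
    (∀ d, κ (D.opp d) = κ d + 1) ∧ ∀ d, κ (D.rot d) = κ d + 1 := by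
  classical
  let Eg := {d : D.Dart // D.incoming d = true}
  have : Fintype D.Face := Fintype.ofFinite _
  have : Fintype D.Piece := Fintype.ofFinite _
  let fm : D.Dart → D.Face := Quot.mk _
  let pm : D.Dart → D.Piece := Quot.mk _
  have hfm : ∀ d, fm (D.rot d) = fm (D.opp d) := by
    intro d
    exact (Quot.sound (by simp only [D.opp_opp])).symm
  have hp1 : ∀ d, pm (D.rot d) = pm d := by
    intro d; symm; apply Quot.sound; left; rfl
  have hp2 : ∀ d, pm (D.opp d) = pm d := by
    intro d; symm; apply Quot.sound; right; rfl
  let B : Matrix (Fin D.n) Eg (ZMod 2) := fun i e =>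
    (if e.1.1 = i then 1 else 0) + (if (D.opp e.1).1 = i then 1 else 0)
  let δ : (D.Face → ZMod 2) →ₗ[ZMod 2] (Eg → ZMod 2) :=
    { toFun := fun κ e => κ (fm e.1) + κ (fm (D.opp e.1))
      map_add' := by intro x y; funext e; simp only [Pi.add_apply]; ring
      map_smul' := by intro c x; funext e; simp; ring }
  let Λ : (D.Piece → ZMod 2) →ₗ[ZMod 2] (Fin D.n → ZMod 2) :=
    LinearMap.funLeft (ZMod 2) (ZMod 2) fun i => pm (i, 0)
  let Γ : (D.Piece → ZMod 2) →ₗ[ZMod 2] (D.Face → ZMod 2) :=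
    LinearMap.funLeft (ZMod 2) (ZMod 2) (Quot.lift pm (by
      rintro d e rfl
      rw [hp1, hp2]))
  have hB : ∀ Y : D.Dart → ZMod 2, (∀ d, Y (D.opp d) = Y d) → ∀ i,
      B.mulVecLin (fun e : Eg => Y e.1) i = ∑ k, Y (i, k) := by
    intro Y hY i
    have h1 := D.sum_darts fun d => if d.1 = i then Y d else 0
    rw [Fintype.sum_prod_type, Finset.sum_comm] at h1
    simp only [Finset.sum_ite_eq', Finset.mem_univ, if_true] at h1
    rw [h1, Matrix.mulVecLin_apply, Matrix.mulVec, dotProduct]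
    refine Finset.sum_congr rfl fun e _ => ?_
    simp only [B, hY]
    split_ifs <;> ring
  have h2 : ∀ x : ZMod 2, x + x = 0 := by decide
  have hadd : ∀ x y : ZMod 2, x + y = 0 → x = y := by decide
  have hrange : LinearMap.range δ ≤ LinearMap.ker B.mulVecLin := by
    rintro _ ⟨κ, rfl⟩
    rw [LinearMap.mem_ker]
    funext i
    have h3 := hB (fun d => κ (fm d) + κ (fm (D.opp d))) (by
      intro d; simp only [D.opp_opp]; ring) i
    refine Eq.trans h3 ?_
    have h4 : ∀ k : Fin 4, κ (fm (D.opp (i, k))) = κ (fm (i, k + 1)) := by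
      intro k
      rw [← hfm]
      rfl
    simp only [h4]
    rw [Fin.sum_univ_four]
    have h5 : (0 : Fin 4) + 1 = 1 ∧ (1 : Fin 4) + 1 = 2 ∧ (2 : Fin 4) + 1 = 3
      ∧ (3 : Fin 4) + 1 = 0 := by decide
    obtain ⟨h5, h6, h7, h8⟩ := h5
    rw [h5, h6, h7, h8]
    have h9 : ∀ a b c d : ZMod 2, a + b + (b + c) + (c + d) + (d + a) = 0 := by decide
    exact h9 _ _ _ _
  have hker1 : LinearMap.ker B.transpose.mulVecLin ≤ LinearMap.range Λ := by
    intro x hx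
    rw [LinearMap.mem_ker] at hx
    have h3 : ∀ e : Eg, x e.1.1 = x (D.opp e.1).1 := by
      intro e
      have h4 := congrFun hx e
      rw [Matrix.mulVecLin_apply, Matrix.mulVec, dotProduct] at h4
      change ∑ i, ((if e.1.1 = i then 1 else 0) + (if (D.opp e.1).1 = i then 1 else 0)) * x i = 0
        at h4
      simp only [add_mul, ite_mul, one_mul, zero_mul,
        Finset.sum_add_distrib, Finset.sum_ite_eq, Finset.mem_univ, if_true] at h4
      exact hadd _ _ h4
    have h4 : ∀ d : D.Dart, x d.1 = x (D.opp d).1 := by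
      intro d
      by_cases hd : D.incoming d = true
      · exact h3 ⟨d, hd⟩
      · have h5 := h3 ⟨D.opp d, by rw [D.oriented]; simpa using hd⟩
        simp only [D.opp_opp] at h5
        exact h5.symm
    refine ⟨Quot.lift (fun d : D.Dart => x d.1) (by
      rintro d e (rfl | rfl)
      · rfl
      · exact h4 d), ?_⟩
    rfl
  have hker2 : LinearMap.ker δ ≤ LinearMap.range Γ := by
    intro κ hκ
    rw [LinearMap.mem_ker] at hκ
    have h3 : ∀ e : Eg, κ (fm e.1) = κ (fm (D.opp e.1)) := fun e => hadd _ _ (congrFun hκ e)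
    have h4 : ∀ d : D.Dart, κ (fm d) = κ (fm (D.opp d)) := by
      intro d
      by_cases hd : D.incoming d = true
      · exact h3 ⟨d, hd⟩
      · have h5 := h3 ⟨D.opp d, by rw [D.oriented]; simpa using hd⟩
        simp only [D.opp_opp] at h5
        exact h5.symm
    refine ⟨Quot.lift (fun d : D.Dart => κ (fm d)) (by
      rintro d e (rfl | rfl)
      · rw [hfm, ← h4]
      · exact h4 d), ?_⟩
    funext f
    obtain ⟨d, rfl⟩ := Quot.exists_rep f
    rfl
  have hc1 : Module.finrank (ZMod 2) (LinearMap.ker B.transpose.mulVecLin) ≤ Nat.card D.Piece := by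
    refine (Submodule.finrank_mono hker1).trans ((LinearMap.finrank_range_le Λ).trans ?_)
    simp
  have hc2 : Module.finrank (ZMod 2) (LinearMap.ker δ) ≤ Nat.card D.Piece := by
    refine (Submodule.finrank_mono hker2).trans ((LinearMap.finrank_range_le Γ).trans ?_)
    simp
  have hr1 := LinearMap.finrank_range_add_finrank_ker B.transpose.mulVecLin
  have hr2 := LinearMap.finrank_range_add_finrank_ker δ
  have hr3 := LinearMap.finrank_range_add_finrank_ker B.mulVecLin
  have hr4 : Module.finrank (ZMod 2) (LinearMap.range B.transpose.mulVecLin)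
      = Module.finrank (ZMod 2) (LinearMap.range B.mulVecLin) := Matrix.rank_transpose B
  have hEg : Fintype.card Eg = 2 * D.n := D.incoming_card
  rw [Module.finrank_fintype_fun_eq_card] at hr1 hr2 hr3
  rw [Fintype.card_fin] at hr1
  rw [hEg] at hr3
  have hpl := D.planar
  rw [← Nat.card_eq_fintype_card] at hr2
  have heq : LinearMap.range δ = LinearMap.ker B.mulVecLin :=
    Submodule.eq_of_le_of_finrank_le hrange (by omega)
  have hone : (fun _ : Eg => (1 : ZMod 2)) ∈ LinearMap.range δ := by
    rw [heq, LinearMap.mem_ker]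
    funext i
    refine (hB (fun _ => 1) (fun _ => rfl) i).trans ?_
    simp
    rfl
  obtain ⟨κ, hκ⟩ := hone
  have h3 : ∀ d : D.Dart, κ (fm d) + κ (fm (D.opp d)) = 1 := by
    intro d
    by_cases hd : D.incoming d = true
    · exact congrFun hκ ⟨d, hd⟩
    · have h5 := congrFun hκ ⟨D.opp d, by rw [D.oriented]; simpa using hd⟩
      change κ (fm (D.opp d)) + κ (fm (D.opp (D.opp d))) = 1 at h5
      rw [D.opp_opp] at h5
      rw [add_comm]
      exact h5
  have h4 : ∀ x y : ZMod 2, x + y = 1 → y = x + 1 := by decide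
  refine ⟨fun d => κ (fm d), fun d => h4 _ _ (h3 d), fun d => ?_⟩
  simp only [hfm]
  exact h4 _ _ (h3 d)

end LinkDiagram

end BarNatan

namespace BarNatan
namespace LinkDiagram

variable (D : LinkDiagram)

theorem turn_turn (v : Fin D.n → Bool) (d : D.Dart) : D.turn v (D.turn v d) = d := by
  obtain ⟨i, k⟩ := d
  refine Prod.ext rfl ?_
  simp only [turn]
  cases v i <;> fin_cases k <;> rfl

theorem turn_colour {κ : D.Dart → ZMod 2} (hκ : ∀ d, κ (D.rot d) = κ d + 1)
    (v : Fin D.n → Bool) (d : D.Dart) : κ (D.turn v d) = κ d + 1 := by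
  obtain ⟨i, k⟩ := d
  have h0 : κ (i, 1) = κ (i, 0) + 1 := hκ (i, 0)
  have h1 : κ (i, 2) = κ (i, 1) + 1 := hκ (i, 1)
  have h2 : κ (i, 3) = κ (i, 2) + 1 := hκ (i, 2)
  have e : ∀ x : ZMod 2, x + 1 + 1 = x := by decide
  rw [h0, e] at h1
  rw [h1] at h2
  cases hv : v i <;> fin_cases k <;> simp [turn, hv, h0, h1, h2, e]

/-- The permutation of the darts of one colour whose cycles are the circles of a smoothing. -/
def circlePerm {κ : D.Dart → ZMod 2} (h1 : ∀ d, κ (D.opp d) = κ d + 1)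
    (h2 : ∀ d, κ (D.rot d) = κ d + 1) (v : Fin D.n → Bool) :
    Equiv.Perm {d : D.Dart // κ d = 0} where
  toFun d := ⟨D.opp (D.turn v d.1), by
    rw [h1, D.turn_colour h2, d.2]; decide⟩
  invFun d := ⟨D.turn v (D.opp d.1), by
    rw [D.turn_colour h2, h1, d.2]; decide⟩
  left_inv d := Subtype.ext (by simp only [D.opp_opp, D.turn_turn])
  right_inv d := Subtype.ext (by simp only [D.opp_opp, D.turn_turn])

theorem card_circles {κ : D.Dart → ZMod 2} (h1 : ∀ d, κ (D.opp d) = κ d + 1)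
    (h2 : ∀ d, κ (D.rot d) = κ d + 1) (v : Fin D.n → Bool) :
    Nat.card (D.Circles v)
      = Nat.card (Quotient (Equiv.Perm.SameCycle.setoid (D.circlePerm h1 h2 v))) + D.loops := by
  classical
  let P := D.circlePerm h1 h2 v
  have hne : ∀ d, ¬ κ d = 0 → κ (D.opp d) = 0 := by
    intro d hd
    rw [h1]
    have : ∀ x : ZMod 2, ¬ x = 0 → x + 1 = 0 := by decide
    exact this _ hd
  have hne' : ∀ d, κ d = 0 → ¬ κ d + 1 = 0 := by
    intro d hd
    rw [hd]; decide
  have hP : ∀ d, (Quotient.mk (Equiv.Perm.SameCycle.setoid P) (P d)) = Quotient.mk _ d := by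
    intro d
    exact Quotient.sound (Equiv.Perm.sameCycle_apply_left.2 (Equiv.Perm.SameCycle.refl _ _))
  let g : D.Arc → Quotient (Equiv.Perm.SameCycle.setoid P) ⊕ Fin D.loops :=
    Sum.elim (fun d => Sum.inl (if h : κ d = 0 then Quotient.mk _ ⟨d, h⟩
      else Quotient.mk _ ⟨D.opp d, hne d h⟩)) Sum.inr
  have hstep : ∀ a b, D.Step v a b → g a = g b := by
    rintro _ _ (d | d)
    · simp only [g, Sum.elim_inl]
      by_cases hd : κ d = 0
      · have hd' : ¬ κ (D.opp d) = 0 := by rw [h1]; exact hne' d hd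
        rw [dif_pos hd, dif_neg hd']
        simp only [D.opp_opp]
      · rw [dif_neg hd, dif_pos (hne d hd)]
    · simp only [g, Sum.elim_inl]
      have ht := D.turn_colour h2 v d
      by_cases hd : κ d = 0
      · have hd' : ¬ κ (D.turn v d) = 0 := by rw [ht]; exact hne' d hd
        rw [dif_pos hd, dif_neg hd', ← hP ⟨d, hd⟩]
        rfl
      · have hd' : κ (D.turn v d) = 0 := by
          rw [ht]
          have : ∀ x : ZMod 2, ¬ x = 0 → x + 1 = 0 := by decide
          exact this _ hd
        rw [dif_neg hd, dif_pos hd', ← hP ⟨D.turn v d, hd'⟩]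
        congr 2
        refine Subtype.ext ?_
        simp only [P, circlePerm, Equiv.coe_fn_mk, D.turn_turn]
  have hrel : ∀ a b, Relation.EqvGen (D.Step v) a b → g a = g b := by
    intro a b h
    induction h with
    | rel a b h => exact hstep a b h
    | refl a => rfl
    | symm a b _ ih => exact ih.symm
    | trans a b c _ _ ih1 ih2 => exact ih1.trans ih2
  let f0 : {d : D.Dart // κ d = 0} → D.Circles v := fun d => ⟦Sum.inl d.1⟧
  have hf1 : ∀ d, f0 (P d) = f0 d := by
    intro d
    refine Quotient.sound ?_
    exact ((Relation.EqvGen.rel _ _ (Step.turn d.1)).trans _ _ _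
      (Relation.EqvGen.rel _ _ (Step.edge _))).symm
  have hf2 : ∀ (d : {d : D.Dart // κ d = 0}) (n : ℕ), f0 ((P ^ n) d) = f0 d := by
    intro d n
    induction n with
    | zero => rfl
    | succ n ih => rw [pow_succ', Equiv.Perm.mul_apply, hf1, ih]
  have hf3 : ∀ d e, Equiv.Perm.SameCycle P d e → f0 d = f0 e := by
    intro d e h
    obtain ⟨n, hn⟩ := h.exists_nat_pow_eq
    rw [← hn, hf2]
  have e : D.Circles v ≃ Quotient (Equiv.Perm.SameCycle.setoid P) ⊕ Fin D.loops :=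
    { toFun := Quotient.lift g hrel
      invFun := Sum.elim (Quotient.lift f0 hf3) fun l => ⟦Sum.inr l⟧
      left_inv := by
        rintro ⟨d | l⟩
        · change Sum.elim (Quotient.lift f0 hf3) _ (g (Sum.inl d)) = _
          simp only [g, Sum.elim_inl]
          split_ifs with h
          · rfl
          · refine Quotient.sound ?_
            exact (Relation.EqvGen.rel _ _ (Step.edge d)).symm
        · rfl
      right_inv := by
        rintro (⟨d, hd⟩ | l)
        · change g (Sum.inl d) = _
          simp only [g, Sum.elim_inl]
          rw [dif_pos hd]
          rfl
        · rfl }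
  rw [Nat.card_congr e, Nat.card_sum]
  simp [P]

theorem odd_card {v : Fin D.n → Bool} {i : Fin D.n} (hv : v i = false) :
    Odd (Nat.card (D.Circles v) + Nat.card (D.Circles (Function.update v i true))) := by
  classical
  obtain ⟨κ, h1, h2⟩ := D.exists_colouring
  have fk : ∀ k : Fin 4, k ≠ k + 2 := by decide
  have fl : ∀ k l : Fin 4, l = k ∨ l = k + 2 ∨ l = k + 1 ∨ l = k + 3 := by decide
  have ft : ∀ k : Fin 4, (![3, 2, 1, 0] : Fin 4 → Fin 4) k = (![1, 0, 3, 2] : Fin 4 → Fin 4) (k + 2)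
      ∧ (![3, 2, 1, 0] : Fin 4 → Fin 4) (k + 2) = (![1, 0, 3, 2] : Fin 4 → Fin 4) k := by decide
  have e : ∀ x : ZMod 2, x + 1 + 1 = x := by decide
  have hr : ∀ k : Fin 4, κ (i, k + 2) = κ (i, k) := by
    intro k
    have h3 := h2 (D.rot (i, k))
    rw [h2 (i, k), e] at h3
    rw [← h3]
    congr 1
    refine Prod.ext rfl ?_
    simp only [DiagramData.rot]
    fin_cases k <;> rfl
  obtain ⟨k, hk⟩ : ∃ k : Fin 4, κ (i, k) = 0 := by
    by_cases h : κ (i, 0) = 0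
    · exact ⟨0, h⟩
    · refine ⟨0 + 1, ?_⟩
      have h3 := h2 (i, 0)
      have h4 : ∀ x : ZMod 2, ¬ x = 0 → x + 1 = 0 := by decide
      exact h3.trans (h4 _ h)
  let a : {d : D.Dart // κ d = 0} := ⟨(i, k), hk⟩
  let b : {d : D.Dart // κ d = 0} := ⟨(i, k + 2), by rw [hr, hk]⟩
  have hab : a ≠ b := by
    intro h
    exact fk k (congrArg (fun x => x.1.2) h)
  have hP : D.circlePerm h1 h2 (Function.update v i true)
      = D.circlePerm h1 h2 v * Equiv.swap a b := by
    ext1 d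
    refine Subtype.ext ?_
    rw [Equiv.Perm.mul_apply]
    simp only [circlePerm, Equiv.coe_fn_mk]
    congr 1
    by_cases hd : d.1.1 = i
    · have hcase : d = a ∨ d = b := by
        obtain ⟨⟨j, l⟩, hl⟩ := d
        simp only at hd
        subst hd
        have h3 := fl k l
        have h4 : κ (j, k + 1) ≠ 0 := by
          have := h2 (j, k)
          rw [hk] at this
          change κ (j, k + 1) = _ at this
          rw [this]; decide
        have h5 : κ (j, k + 3) ≠ 0 := by
          have h6 := hr (k + 1)
          rw [add_assoc] at h6
          change κ (j, k + 3) = _ at h6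
          rw [h6]; exact h4
        rcases h3 with rfl | rfl | rfl | rfl
        · left; rfl
        · right; rfl
        · exact absurd hl h4
        · exact absurd hl h5
      rcases hcase with rfl | rfl
      · rw [Equiv.swap_apply_left]
        simp only [a, b, turn, Function.update_self, hv]
        refine Prod.ext rfl ?_
        exact (ft k).1
      · rw [Equiv.swap_apply_right]
        simp only [a, b, turn, Function.update_self, hv]
        refine Prod.ext rfl ?_
        exact (ft k).2
    · have h3 : d ≠ a := by rintro rfl; exact hd rfl
      have h4 : d ≠ b := by rintro rfl; exact hd rfl
      rw [Equiv.swap_apply_of_ne_of_ne h3 h4]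
      simp only [turn, Function.update_of_ne hd]
  have h3 := card_orbits_swap (D.circlePerm h1 h2 v) hab
  rw [← hP] at h3
  rw [D.card_circles h1 h2, D.card_circles h1 h2]
  obtain ⟨m, hm⟩ := h3
  exact ⟨m + D.loops, by omega⟩

end LinkDiagram
end BarNatan

namespace BarNatan
namespace LinkDiagram

variable (D : LinkDiagram)

/-- A base point near the crossing `i`. -/
def base (i : Fin D.n) : D.Arc := Sum.inl (i, 0)

theorem sameCircle_edge (v : Fin D.n → Bool) (d : D.Dart) :
    D.sameCircle v (Sum.inl d) (Sum.inl (D.opp d)) := Relation.EqvGen.rel _ _ (Step.edge d)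

theorem sameCircle_turn (v : Fin D.n → Bool) (d : D.Dart) :
    D.sameCircle v (Sum.inl d) (Sum.inl (D.turn v d)) := Relation.EqvGen.rel _ _ (Step.turn d)

theorem sameCircle_le {v : Fin D.n → Bool} {S : Setoid D.Arc}
    (h1 : ∀ d : D.Dart, S (Sum.inl d) (Sum.inl (D.opp d)))
    (h2 : ∀ d : D.Dart, S (Sum.inl d) (Sum.inl (D.turn v d))) : D.sameCircle v ≤ S := by
  intro a b h
  induction h with
  | rel a b h =>
    cases h with
    | edge d => exact h1 d
    | turn d => exact h2 d
  | refl a => exact S.refl a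
  | symm a b _ ih => exact S.symm ih
  | trans a b c _ _ ih1 ih2 => exact S.trans ih1 ih2

theorem turn_congr {v w : Fin D.n → Bool} {d : D.Dart} (h : v d.1 = w d.1) :
    D.turn v d = D.turn w d := by simp only [turn, h]

/-- Near a crossing there are at most two circles. -/
theorem sameCircle_dart (v : Fin D.n → Bool) (i : Fin D.n) (k : Fin 4) :
    D.sameCircle v (Sum.inl (i, k)) (Sum.inl (i, 0))
      ∨ D.sameCircle v (Sum.inl (i, k)) (Sum.inl (i, 2)) := by
  have h := D.sameCircle_turn v (i, k)
  cases hv : v i <;> simp only [turn, hv] at h <;> fin_cases k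
  · exact Or.inl (Setoid.refl' _ _)
  · exact Or.inl h
  · exact Or.inr (Setoid.refl' _ _)
  · exact Or.inr h
  · exact Or.inl (Setoid.refl' _ _)
  · exact Or.inr h
  · exact Or.inr (Setoid.refl' _ _)
  · exact Or.inl h

/-- All darts at the crossing where the smoothings differ lie on one component of the saddle. -/
theorem sup_dart {v w : Fin D.n → Bool} {i : Fin D.n} (hi : v i ≠ w i) (k : Fin 4) :
    (D.sameCircle v ⊔ D.sameCircle w) (Sum.inl (i, k)) (D.base i) := by
  have hv : ∀ d, (D.sameCircle v ⊔ D.sameCircle w) (Sum.inl d) (Sum.inl (D.turn v d)) := fun d =>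
    (le_sup_left : D.sameCircle v ≤ _) (D.sameCircle_turn v d)
  have hw : ∀ d, (D.sameCircle v ⊔ D.sameCircle w) (Sum.inl d) (Sum.inl (D.turn w d)) := fun d =>
    (le_sup_right : D.sameCircle w ≤ _) (D.sameCircle_turn w d)
  set J := D.sameCircle v ⊔ D.sameCircle w
  have key : ∀ x y : Fin D.n → Bool, x i = false → y i = true →
      (∀ d, J (Sum.inl d) (Sum.inl (D.turn x d))) → (∀ d, J (Sum.inl d) (Sum.inl (D.turn y d))) →
      J (Sum.inl (i, k)) (D.base i) := by
    intro x y hx hy h1 h2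
    have a1 := h1 (i, 1)
    have a2 := h2 (i, 2)
    have a3 := h2 (i, 3)
    simp only [turn, hx, hy] at a1 a2 a3
    fin_cases k
    · exact Setoid.refl' _ _
    · exact a1
    · exact Setoid.trans' _ a2 a1
    · exact a3
  cases hx : v i
  · cases hy : w i
    · exact absurd (hx.trans hy.symm) hi
    · exact key v w hx hy hv hw
  · cases hy : w i
    · exact key w v hy hx hw hv
    · exact absurd (hx.trans hy.symm) hi

/-- Away from the saddle the components are cylinders. -/
theorem sup_cases {v w : Fin D.n → Bool} {i : Fin D.n} (h : ∀ j, j ≠ i → v j = w j)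
    {a b : D.Arc} (hab : (D.sameCircle v ⊔ D.sameCircle w) a b) :
    D.sameCircle v a b ∨ ((∃ k : Fin 4, D.sameCircle v a (Sum.inl (i, k)))
      ∧ ∃ k : Fin 4, D.sameCircle v b (Sum.inl (i, k))) := by
  let A : D.Arc → Prop := fun a => ∃ k : Fin 4, D.sameCircle v a (Sum.inl (i, k))
  have hA : ∀ a b, D.sameCircle v a b → A a → A b := by
    rintro a b hab ⟨k, hk⟩
    exact ⟨k, Setoid.trans' _ (Setoid.symm' _ hab) hk⟩
  let S : Setoid D.Arc :=
    { r := fun a b => D.sameCircle v a b ∨ (A a ∧ A b)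
      iseqv :=
        { refl := fun a => Or.inl (Setoid.refl' _ a)
          symm := by
            rintro a b (h | h)
            · exact Or.inl (Setoid.symm' _ h)
            · exact Or.inr ⟨h.2, h.1⟩
          trans := by
            rintro a b c (h | h) (h' | h')
            · exact Or.inl (Setoid.trans' _ h h')
            · exact Or.inr ⟨hA _ _ (Setoid.symm' _ h) h'.1, h'.2⟩
            · exact Or.inr ⟨h.1, hA _ _ h' h.2⟩
            · exact Or.inr ⟨h.1, h'.2⟩ } }
  have hle : D.sameCircle v ⊔ D.sameCircle w ≤ S := by
    refine sup_le (fun a b h => Or.inl h) (D.sameCircle_le (fun d => Or.inl (D.sameCircle_edge v d))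
      fun d => ?_)
    by_cases hd : d.1 = i
    · subst hd
      exact Or.inr ⟨⟨d.2, Setoid.refl' _ _⟩, ⟨_, Setoid.refl' _ _⟩⟩
    · rw [← D.turn_congr (h d.1 hd)]
      exact Or.inl (D.sameCircle_turn v d)
  exact hle hab

theorem push_one {I Q : Type} [Fintype I] [DecidableEq Q] (φ : I → Q) (q : Q) :
    push φ (fun _ => 1) q = ((Finset.univ.filter fun i => φ i = q).card : ℤ) := by
  classical
  simp only [push]
  rw [Finset.sum_boole]
  try congr!

theorem push_left_of_ne {v w : Fin D.n → Bool} {i : Fin D.n} (hi : v i ≠ w i)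
    (h : ∀ j, j ≠ i → v j = w j) (φ : D.Circles v → Quotient (D.sameCircle v ⊔ D.sameCircle w))
    (hφ : ∀ a, φ (Quotient.mk _ a) = Quotient.mk _ a) (c : Quotient (D.sameCircle v ⊔ D.sameCircle w))
    (hc : c ≠ ⟦D.base i⟧) : push φ (fun _ => 1) c = 1 := by
  classical
  obtain ⟨a, rfl⟩ := Quotient.exists_rep c
  rw [push_one]
  have : (Finset.univ.filter fun z => φ z = ⟦a⟧) = {⟦a⟧} := by
    ext z
    obtain ⟨b, rfl⟩ := Quotient.exists_rep z
    simp only [Finset.mem_filter, Finset.mem_univ, true_and, Finset.mem_singleton, hφ]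
    constructor
    · intro hba
      rcases D.sup_cases h (Quotient.exact hba) with h1 | ⟨-, k, hk⟩
      · exact Quotient.sound h1
      · exfalso
        apply hc
        refine Quotient.sound ?_
        exact Setoid.trans' _ ((le_sup_left : D.sameCircle v ≤ _) hk) (D.sup_dart hi k)
    · intro hba
      exact Quotient.sound ((le_sup_left : D.sameCircle v ≤ _) (Quotient.exact hba))
  rw [this]
  simp

theorem push_left_base {v w : Fin D.n → Bool} {i : Fin D.n}
    (h : ∀ j, j ≠ i → v j = w j) (φ : D.Circles v → Quotient (D.sameCircle v ⊔ D.sameCircle w))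
    (hφ : ∀ a, φ (Quotient.mk _ a) = Quotient.mk _ a) : 1 ≤ push φ (fun _ => 1) ⟦D.base i⟧
      ∧ push φ (fun _ => 1) ⟦D.base i⟧ ≤ 2 := by
  classical
  rw [push_one]
  constructor
  · have : 0 < (Finset.univ.filter fun z => φ z = ⟦D.base i⟧).card := by
      rw [Finset.card_pos]
      exact ⟨⟦D.base i⟧, by simp [hφ]⟩
    exact_mod_cast this
  · have hsub : (Finset.univ.filter fun z => φ z = ⟦D.base i⟧)
        ⊆ {(⟦Sum.inl (i, 0)⟧ : D.Circles v), ⟦Sum.inl (i, 2)⟧} := by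
      intro z
      obtain ⟨b, rfl⟩ := Quotient.exists_rep z
      simp only [Finset.mem_filter, Finset.mem_univ, true_and, Finset.mem_insert,
        Finset.mem_singleton, hφ]
      intro hb
      rcases D.sup_cases h (Quotient.exact hb) with h1 | ⟨⟨k, hk⟩, -⟩
      · exact Or.inl (Quotient.sound h1)
      · rcases D.sameCircle_dart v i k with h2 | h2
        · exact Or.inl (Quotient.sound (Setoid.trans' _ hk h2))
        · exact Or.inr (Quotient.sound (Setoid.trans' _ hk h2))
    have := (Finset.card_le_card hsub).trans Finset.card_le_two
    exact_mod_cast this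

open Classical in
/-- Every component of a saddle cobordism has two boundary circles, except for the pair of pants,
which has three. -/
theorem saddle_fibre {v w : Fin D.n → Bool} {i : Fin D.n} (hv : v i = false)
    (hw : w = Function.update v i true) (c : (D.saddleSurf v w).comps) :
    push (fun z => (D.saddleSurf v w).bdry (Sum.inl z)) (fun _ => 1) c
      + push (fun z => (D.saddleSurf v w).bdry (Sum.inr z)) (fun _ => 1) c
      = 2 + if (Quotient.mk _ (D.base i) : Quotient (D.sameCircle v ⊔ D.sameCircle w)) = c
        then 1 else 0 := by
  have hodd : Odd (Nat.card (D.Circles v) + Nat.card (D.Circles w)) := hw ▸ D.odd_card hv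
  have hi : v i ≠ w i := by rw [hw, hv]; simp
  have hj : ∀ j, j ≠ i → v j = w j := by
    intro j hj; rw [hw, Function.update_of_ne hj]
  let Q := Quotient (D.sameCircle v ⊔ D.sameCircle w)
  let φ : D.Circles v → Q := fun z => (D.saddleSurf v w).bdry (Sum.inl z)
  let ψ : D.Circles w → Q := fun z => (D.saddleSurf v w).bdry (Sum.inr z)
  have e : D.sameCircle w ⊔ D.sameCircle v = D.sameCircle v ⊔ D.sameCircle w := sup_comm _ _
  have aux : ∀ (R : Setoid D.Arc), R = D.sameCircle v ⊔ D.sameCircle w →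
      (∀ (φ' : D.Circles w → Quotient R) (_ : ∀ a, φ' (Quotient.mk _ a) = Quotient.mk R a) (c : Quotient R),
        (c ≠ Quotient.mk R (D.base i) → push φ' (fun _ => 1) c = 1)
        ∧ (1 ≤ push φ' (fun _ => 1) (Quotient.mk R (D.base i))
          ∧ push φ' (fun _ => 1) (Quotient.mk R (D.base i)) ≤ 2)) := by
    intro R hR
    rw [sup_comm] at hR
    subst hR
    intro φ' hφ' c
    exact ⟨fun hc => D.push_left_of_ne hi.symm (fun j h => (hj j h).symm) φ' hφ' c hc,
      D.push_left_base (fun j h => (hj j h).symm) φ' hφ'⟩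
  have aux' := aux _ rfl ψ (fun a => rfl)
  have hne : ∀ c : Q, c ≠ ⟦D.base i⟧ → push φ (fun _ => 1) c + push ψ (fun _ => 1) c = 2 := by
    intro c hc
    rw [D.push_left_of_ne hi hj φ (fun a => rfl) c hc, (aux' c).1 hc]
    norm_num
  have h1 := D.push_left_base hj φ (fun a => rfl)
  have h2 := (aux' c).2
  have hsum : ∑ q : Q, (push φ (fun _ => 1) q + push ψ (fun _ => 1) q)
      = (Nat.card (D.Circles v) + Nat.card (D.Circles w) : ℕ) := by
    rw [Finset.sum_add_distrib, sum_push, sum_push]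
    simp
  rw [← Finset.add_sum_erase _ _ (Finset.mem_univ (⟦D.base i⟧ : Q)),
    Finset.sum_congr rfl (fun q hq => hne q (Finset.ne_of_mem_erase hq)), Finset.sum_const] at hsum
  obtain ⟨m, hm⟩ := hodd
  rw [hm] at hsum
  change push φ (fun _ => 1) c + push ψ (fun _ => 1) c = _
  split_ifs with hc
  · have hc' : c = (⟦D.base i⟧ : Q) := hc.symm
    rw [hc']
    simp only [nsmul_eq_mul] at hsum
    push_cast at hsum
    omega
  · rw [hne c (fun h => hc h.symm)]
    norm_num

theorem euler_saddle {v w : Fin D.n → Bool} {i : Fin D.n} (hv : v i = false)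
    (hw : w = Function.update v i true) : (D.saddleSurf v w).euler = -1 := by
  classical
  have h := fun c => D.saddle_fibre hv hw c
  have h1 : ∑ c, (push (fun z => (D.saddleSurf v w).bdry (Sum.inl z)) (fun _ => 1) c
      + push (fun z => (D.saddleSurf v w).bdry (Sum.inr z)) (fun _ => 1) c)
      = (Fintype.card (D.Circles v) : ℤ) + Fintype.card (D.Circles w) := by
    rw [Finset.sum_add_distrib, sum_push, sum_push]
    simp
  rw [Finset.sum_congr rfl fun c _ => h c, Finset.sum_add_distrib] at h1
  have h2 : ∑ c : (D.saddleSurf v w).comps, (if (Quotient.mk _ (D.base i) :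
      Quotient (D.sameCircle v ⊔ D.sameCircle w)) = c then (1 : ℤ) else 0) = 1 :=
    Finset.sum_ite_eq_of_mem _ _ _ (Finset.mem_univ _)
  rw [h2] at h1
  have h3 : ∑ c : (D.saddleSurf v w).comps, (2 - 2 * ((D.saddleSurf v w).genus c : ℤ))
      = ∑ c : (D.saddleSurf v w).comps, 2 := by
    refine Finset.sum_congr rfl fun c _ => ?_
    simp [saddleSurf]
  rw [Surf.euler, h3]
  linarith

open Classical in
/-- A composition of two saddles at different crossings does not depend on their order. -/
theorem saddle_comp {u v w : Fin D.n → Bool} {i j : Fin D.n} (hij : i ≠ j) (hui : u i = false)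
    (huj : u j = false) (hv : v = Function.update u i true) (hw : w = Function.update v j true) :
    ∃ φ : D.Arc → ((D.saddleSurf u v).comp (D.saddleSurf v w)).comps,
      Function.Surjective φ ∧ (∀ a b, φ a = φ b ↔ (D.sameCircle u ⊔ D.sameCircle w) a b)
      ∧ (∀ a, ((D.saddleSurf u v).comp (D.saddleSurf v w)).bdry (Sum.inl ⟦a⟧) = φ a)
      ∧ (∀ a, ((D.saddleSurf u v).comp (D.saddleSurf v w)).bdry (Sum.inr ⟦a⟧) = φ a)
      ∧ ∀ q, 2 * ((D.saddleSurf u v).comp (D.saddleSurf v w)).wt q =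
        (if φ (D.base i) = q then 1 else 0) + (if φ (D.base j) = q then 1 else 0)
        - push (fun z => ((D.saddleSurf u v).comp (D.saddleSurf v w)).bdry (Sum.inl z))
          (fun _ => 1) q
        - push (fun z => ((D.saddleSurf u v).comp (D.saddleSurf v w)).bdry (Sum.inr z))
          (fun _ => 1) q := by
  have hvj : v j = false := by rw [hv, Function.update_of_ne hij.symm, huj]
  set S := D.saddleSurf u v with hS
  set T := D.saddleSurf v w with hT
  have hg := Surf.isGluing_comp S T
  set μ := Surf.compMk S T with hμ
  let m1 : D.Arc → S.comps := fun a => (⟦a⟧ : Quotient (D.sameCircle u ⊔ D.sameCircle v))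
  let m2 : D.Arc → T.comps := fun a => (⟦a⟧ : Quotient (D.sameCircle v ⊔ D.sameCircle w))
  have hm : ∀ a, μ (Sum.inl (m1 a)) = μ (Sum.inr (m2 a)) := fun a => hg.glue ⟦a⟧
  let φ : D.Arc → (S.comp T).comps := fun a => μ (Sum.inl (m1 a))
  have hu : ∀ a b, D.sameCircle u a b → φ a = φ b := by
    intro a b h
    have : m1 a = m1 b := Quotient.sound ((le_sup_left : D.sameCircle u ≤ _) h)
    simp only [φ, this]
  have hw' : ∀ a b, D.sameCircle w a b → φ a = φ b := by
    intro a b h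
    have : m2 a = m2 b := Quotient.sound ((le_sup_right : D.sameCircle w ≤ _) h)
    simp only [φ, hm, this]
  have hle : D.sameCircle v ≤ D.sameCircle u ⊔ D.sameCircle w := by
    refine D.sameCircle_le (fun d => (le_sup_left : D.sameCircle u ≤ _) (D.sameCircle_edge u d))
      fun d => ?_
    by_cases hd : d.1 = i
    · have : v d.1 = w d.1 := by rw [hw, Function.update_of_ne (by rw [hd]; exact hij)]
      rw [D.turn_congr this]
      exact (le_sup_right : D.sameCircle w ≤ _) (D.sameCircle_turn w d)
    · have : v d.1 = u d.1 := by rw [hv, Function.update_of_ne hd]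
      rw [D.turn_congr this]
      exact (le_sup_left : D.sameCircle u ≤ _) (D.sameCircle_turn u d)
  have hbl : ∀ a, (S.comp T).bdry (Sum.inl ⟦a⟧) = φ a := fun a => hg.bdry (Sum.inl ⟦a⟧)
  have hbr : ∀ a, (S.comp T).bdry (Sum.inr ⟦a⟧) = φ a := fun a =>
    (hg.bdry (Sum.inr ⟦a⟧)).trans (hm a).symm
  refine ⟨φ, ?_, ?_, hbl, hbr, ?_⟩
  · intro q
    obtain ⟨x | x, rfl⟩ := hg.surj q
    · obtain ⟨a, rfl⟩ := Quotient.exists_rep x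
      exact ⟨a, rfl⟩
    · obtain ⟨a, rfl⟩ := Quotient.exists_rep x
      exact ⟨a, hm a⟩
  · intro a b
    constructor
    · intro h
      let R := D.sameCircle u ⊔ D.sameCircle w
      obtain ⟨f', hf'⟩ := hg.univ (Quotient R)
        (Sum.elim (Quotient.lift (fun a => Quotient.mk R a) fun x y hxy => Quotient.sound
            ((sup_le le_sup_left hle : D.sameCircle u ⊔ D.sameCircle v ≤ R) hxy))
          (Quotient.lift (fun a => Quotient.mk R a) fun x y hxy => Quotient.sound
            ((sup_le hle le_sup_right : D.sameCircle v ⊔ D.sameCircle w ≤ R) hxy))) (by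
        intro z
        obtain ⟨x, rfl⟩ := Quotient.exists_rep z
        rfl)
      have h1 : ∀ a, f' (φ a) = Quotient.mk R a := fun a => hf' (Sum.inl (m1 a))
      exact Quotient.exact ((h1 a).symm.trans ((congrArg f' h).trans (h1 b)))
    · intro h
      have : D.sameCircle u ⊔ D.sameCircle w ≤ Setoid.ker φ := sup_le hu hw'
      exact this h
  · intro q
    have hwt := hg.wt q
    rw [push_sum] at hwt
    simp only [Sum.elim_inl, Sum.elim_inr] at hwt
    have eS : ∀ c, S.wt c = -1 := fun c => by
      change ((0 : ℕ) : ℤ) - 1 = -1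
      norm_num
    have eT : ∀ c, T.wt c = -1 := fun c => by
      change ((0 : ℕ) : ℤ) - 1 = -1
      norm_num
    have fS := fun c => D.saddle_fibre hui hv c
    have fT := fun c => D.saddle_fibre hvj hw c
    have p1 := congrFun (push_push (fun z => S.bdry (Sum.inl z)) (fun c => μ (Sum.inl c))
      (fun _ => 1)) q
    have p2 := congrFun (push_push (fun z => S.bdry (Sum.inr z)) (fun c => μ (Sum.inl c))
      (fun _ => 1)) q
    have p3 := congrFun (push_push (fun z => T.bdry (Sum.inl z)) (fun c => μ (Sum.inr c))
      (fun _ => 1)) q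
    have p4 := congrFun (push_push (fun z => T.bdry (Sum.inr z)) (fun c => μ (Sum.inr c))
      (fun _ => 1)) q
    have hpoint : ∀ {I Q : Type} [Fintype I] (g : I → Q) (x : I) (q : Q),
        push g (fun c => if x = c then 1 else 0) q = if g x = q then 1 else 0 := by
      intro I Q _ g x q
      simp only [push]
      rw [Finset.sum_eq_single x]
      · simp
      · intro b _ hb
        simp [hb.symm]
      · simp
    have hconst : ∀ {I Q : Type} [Fintype I] (g : I → Q) (q : Q) (r : ℤ),
        push g (fun _ => r) q = r * push g (fun _ => 1) q := by
      intro I Q _ g q r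
      simp only [push, Finset.mul_sum]
      refine Finset.sum_congr rfl fun x _ => ?_
      split_ifs <;> simp
    have qS : push (fun c => μ (Sum.inl c)) (fun c => push (fun z => S.bdry (Sum.inl z)) (fun _ => 1) c
        + push (fun z => S.bdry (Sum.inr z)) (fun _ => 1) c) q
        = 2 * push (fun c => μ (Sum.inl c)) (fun _ => 1) q + if φ (D.base i) = q then 1 else 0 := by
      have t := congrFun (push_add (fun c => μ (Sum.inl c)) (fun _ => 2)
        (fun c => if m1 (D.base i) = c then 1 else 0)) q
      refine (congrArg (fun F => push (fun c => μ (Sum.inl c)) F q) (funext fS)).trans (t.trans ?_)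
      rw [hconst _ _ 2, hpoint]
    have qT : push (fun c => μ (Sum.inr c)) (fun c => push (fun z => T.bdry (Sum.inl z)) (fun _ => 1) c
        + push (fun z => T.bdry (Sum.inr z)) (fun _ => 1) c) q
        = 2 * push (fun c => μ (Sum.inr c)) (fun _ => 1) q + if φ (D.base j) = q then 1 else 0 := by
      have t := congrFun (push_add (fun c => μ (Sum.inr c)) (fun _ => 2)
        (fun c => if m2 (D.base j) = c then 1 else 0)) q
      refine (congrArg (fun F => push (fun c => μ (Sum.inr c)) F q) (funext fT)).trans (t.trans ?_)
      rw [hconst _ _ 2, hpoint]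
      simp only [φ, hm]
    rw [push_add] at qS qT
    rw [show (fun i => S.wt i) = fun _ => -1 from funext eS,
      show (fun i => T.wt i) = fun _ => -1 from funext eT, hconst _ _ (-1),
      hconst (fun j => μ (Sum.inr j)) _ (-1)] at hwt
    have r1 : (fun z => (S.comp T).bdry (Sum.inl z)) = fun z => μ (Sum.inl (S.bdry (Sum.inl z))) :=
      funext fun z => hg.bdry (Sum.inl z)
    have r2 : (fun z => (S.comp T).bdry (Sum.inr z)) = fun z => μ (Sum.inr (T.bdry (Sum.inr z))) :=
      funext fun z => hg.bdry (Sum.inr z)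
    have r3 : (fun z => μ (Sum.inr (T.bdry (Sum.inl z)))) = fun z => μ (Sum.inl (S.bdry (Sum.inr z))) :=
      funext fun z => (hg.glue z).symm
    rw [r1, r2]
    rw [r3] at p3
    simp only at qS qT
    rw [p1, p2] at qS
    rw [p3, p4] at qT
    linarith

open Classical in
theorem homeo_of_arcs {A B I : Type} [Fintype A] [Fintype B] {K K' : Surf A B} {pa : I → A}
    {pb : I → B} (ha : Function.Surjective pa) (hb : Function.Surjective pb) {R : Setoid I}
    {x y : I} {φ : I → K.comps} {φ' : I → K'.comps}
    (s : Function.Surjective φ) (k : ∀ a b, φ a = φ b ↔ R a b)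
    (bl : ∀ a, K.bdry (Sum.inl (pa a)) = φ a) (br : ∀ a, K.bdry (Sum.inr (pb a)) = φ a)
    (hq : ∀ q, 2 * K.wt q = (if φ x = q then 1 else 0) + (if φ y = q then 1 else 0)
      - push (fun z => K.bdry (Sum.inl z)) (fun _ => 1) q
      - push (fun z => K.bdry (Sum.inr z)) (fun _ => 1) q)
    (s' : Function.Surjective φ') (k' : ∀ a b, φ' a = φ' b ↔ R a b)
    (bl' : ∀ a, K'.bdry (Sum.inl (pa a)) = φ' a) (br' : ∀ a, K'.bdry (Sum.inr (pb a)) = φ' a)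
    (hq' : ∀ q, 2 * K'.wt q = (if φ' y = q then 1 else 0) + (if φ' x = q then 1 else 0)
      - push (fun z => K'.bdry (Sum.inl z)) (fun _ => 1) q
      - push (fun z => K'.bdry (Sum.inr z)) (fun _ => 1) q) : K ≈ K' := by
  obtain ⟨f, hf⟩ : ∃ f : K.comps → K'.comps, ∀ a, f (φ a) = φ' a := by
    refine ⟨fun q => φ' (s q).choose, fun a => ?_⟩
    rw [k', ← k]
    exact (s (φ a)).choose_spec
  obtain ⟨g, hg⟩ : ∃ g : K'.comps → K.comps, ∀ a, g (φ' a) = φ a := by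
    refine ⟨fun q => φ (s' q).choose, fun a => ?_⟩
    rw [k, ← k']
    exact (s' (φ' a)).choose_spec
  have hgf : ∀ q, g (f q) = q := by
    intro q
    obtain ⟨a, rfl⟩ := s q
    rw [hf, hg]
  have hfg : ∀ q, f (g q) = q := by
    intro q
    obtain ⟨a, rfl⟩ := s' q
    rw [hg, hf]
  have hinj : Function.Injective f := Function.LeftInverse.injective hgf
  have hbd : ∀ x, K'.bdry x = f (K.bdry x) := by
    rintro (x | x)
    · obtain ⟨a, rfl⟩ := ha x
      rw [bl, bl', hf]
    · obtain ⟨a, rfl⟩ := hb x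
      rw [br, br', hf]
  refine Surf.homeo_of_bijection f g hgf hfg (fun q => ?_) hbd
  have h1 := hq q
  have h2 := hq' (f q)
  rw [show (fun z => K'.bdry (Sum.inl z)) = fun z => f (K.bdry (Sum.inl z)) from
      funext fun z => hbd _,
    show (fun z => K'.bdry (Sum.inr z)) = fun z => f (K.bdry (Sum.inr z)) from
      funext fun z => hbd _, Surf.push_bij f hinj, Surf.push_bij f hinj] at h2
  simp only [← hf, hinj.eq_iff] at h2
  linarith

theorem saddle_comm {u v v' w : Fin D.n → Bool} {i j : Fin D.n} (hij : i ≠ j) (hui : u i = false)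
    (huj : u j = false) (hv : v = Function.update u i true) (hw : w = Function.update v j true)
    (hv' : v' = Function.update u j true) :
    (D.saddleSurf u v).comp (D.saddleSurf v w) ≈ (D.saddleSurf u v').comp (D.saddleSurf v' w) := by
  classical
  have hw' : w = Function.update v' i true := by
    rw [hw, hv, hv', Function.update_comm hij]
  obtain ⟨φ, s, k, bl, br, hq⟩ := D.saddle_comp hij hui huj hv hw
  obtain ⟨φ', s', k', bl', br', hq'⟩ := D.saddle_comp hij.symm huj hui hv' hw'
  exact homeo_of_arcs Quotient.mk_surjective Quotient.mk_surjective s k bl br hq s' k' bl' br' hq'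

end LinkDiagram
end BarNatan

namespace BarNatan

open CategoryTheory

namespace LinkDiagram

variable (D : LinkDiagram)

/-- The number of `1`-smoothings. -/
def ones (v : Fin D.n → Bool) : ℕ := (Finset.univ.filter fun i => v i = true).card

/-- The number of positive crossings. -/
def nPlus : ℕ := (Finset.univ.filter fun i => D.positive i = true).card

/-- The number of negative crossings. -/
def nMinus : ℕ := (Finset.univ.filter fun i => D.positive i = false).card

/-- The sign of the edge of the cube that leaves the vertex `v` in direction `i`. -/
def edgeSign (v : Fin D.n → Bool) (i : Fin D.n) : ℤ :=
  (-1) ^ (Finset.univ.filter fun j => j < i ∧ v j = true).card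

/-- The circles of the smoothing `v` with degree shift `m`. -/
noncomputable def smoothing (v : Fin D.n → Bool) (m : ℤ) : Cob where
  circles := D.Circles v
  shift := m

/-- The smoothings in homological degree `r`. -/
abbrev Vertex (r : ℤ) : Type := {v : Fin D.n → Bool // (D.ones v : ℤ) = r + D.nMinus}

/-- The cobordism on an edge of the cube. -/
noncomputable def saddle {v w : Fin D.n → Bool} {i : Fin D.n}
    (h : v i = false ∧ w = Function.update v i true) {m n : ℤ} (hmn : n = m + 1) :
    D.smoothing v m ⟶ D.smoothing w n :=
  Cob.ofSurf (D.saddleSurf v w) (by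
    have h1 : (D.saddleSurf v w).euler = -1 := D.euler_saddle h.1 h.2
    change (D.saddleSurf v w).euler + n - m = 0
    linarith)

/-- The degree shift in homological degree `r`. -/
def shiftAt (r : ℤ) : ℤ := r + D.nPlus - D.nMinus

theorem shiftAt_succ (r : ℤ) : D.shiftAt (r + 1) = D.shiftAt r + 1 := by
  simp only [shiftAt]; ring

/-- The column of all smoothings in homological degree `r`. -/
noncomputable def chainObj (r : ℤ) : Mat_ CobL where
  ι := D.Vertex r
  X v := CobL.of (D.smoothing v.1 (D.shiftAt r))

/-- The contribution of direction `i` to the matrix entry of the differential. -/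
noncomputable def edgeTerm (r : ℤ) (v : D.Vertex r) (w : D.Vertex (r + 1)) (i : Fin D.n) :
    CobL.of (D.smoothing v.1 (D.shiftAt r)) ⟶ CobL.of (D.smoothing w.1 (D.shiftAt (r + 1))) :=
  if h : v.1 i = false ∧ w.1 = Function.update v.1 i true then
    D.edgeSign v.1 i • CobL.mk (D.saddle h (D.shiftAt_succ r)) else 0

/-- The differential: the signed sum of the saddle cobordisms over the edges of the cube. -/
noncomputable def chainDiff (r : ℤ) : D.chainObj r ⟶ D.chainObj (r + 1) :=
  fun v w => ∑ i, D.edgeTerm r v w i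

theorem ones_update {v : Fin D.n → Bool} {i : Fin D.n} (h : v i = false) :
    D.ones (Function.update v i true) = D.ones v + 1 := by
  have : (Finset.univ.filter fun j => Function.update v i true j = true)
      = insert i (Finset.univ.filter fun j => v j = true) := by
    ext j
    by_cases hj : j = i
    · subst hj; simp
    · simp [hj]
  rw [ones, this, Finset.card_insert_of_notMem (by simp [h])]
  rfl

theorem edgeSign_update_of_lt {v : Fin D.n → Bool} {i j : Fin D.n} (h : v i = false) (hij : i < j) :
    D.edgeSign (Function.update v i true) j = - D.edgeSign v j := by
  have : (Finset.univ.filter fun k => k < j ∧ Function.update v i true k = true)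
      = insert i (Finset.univ.filter fun k => k < j ∧ v k = true) := by
    ext k
    by_cases hk : k = i
    · subst hk; simp [hij]
    · simp [hk]
  rw [edgeSign, this, Finset.card_insert_of_notMem (by simp [h]), pow_succ, edgeSign]
  ring

theorem edgeSign_update_of_gt {v : Fin D.n → Bool} {i j : Fin D.n} (hij : j < i) :
    D.edgeSign (Function.update v i true) j = D.edgeSign v j := by
  have : (Finset.univ.filter fun k => k < j ∧ Function.update v i true k = true)
      = (Finset.univ.filter fun k => k < j ∧ v k = true) := by
    ext k
    by_cases hk : k = i
    · subst hk; simp [not_lt.2 hij.le]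
    · simp [Function.update_of_ne hk]
  rw [edgeSign, this, edgeSign]

theorem edgeSign_anticomm {v : Fin D.n → Bool} {i j : Fin D.n} (hi : v i = false)
    (hj : v j = false) (hij : i ≠ j) :
    D.edgeSign v i * D.edgeSign (Function.update v i true) j
      = - (D.edgeSign v j * D.edgeSign (Function.update v j true) i) := by
  rcases lt_or_gt_of_ne hij with h | h
  · rw [D.edgeSign_update_of_lt hi h, D.edgeSign_update_of_gt h]; ring
  · rw [D.edgeSign_update_of_lt hj h, D.edgeSign_update_of_gt h]; ring

/-- The contribution of the directions `i, j` (in this order) to the square of the differential. -/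
noncomputable def squareTerm (r : ℤ) (u : D.Vertex r) (w : D.Vertex (r + 1 + 1))
    (p : Fin D.n × Fin D.n) : CobL.of (D.smoothing u.1 (D.shiftAt r)) ⟶
      CobL.of (D.smoothing w.1 (D.shiftAt (r + 1 + 1))) :=
  ∑ x : D.Vertex (r + 1), D.edgeTerm r u x p.1 ≫ D.edgeTerm (r + 1) x w p.2

theorem squareTerm_eq_zero (r : ℤ) (u : D.Vertex r) (w : D.Vertex (r + 1 + 1)) (i j : Fin D.n)
    (h : ¬ (i ≠ j ∧ u.1 i = false ∧ u.1 j = false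
      ∧ w.1 = Function.update (Function.update u.1 i true) j true)) :
    D.squareTerm r u w (i, j) = 0 := by
  refine Finset.sum_eq_zero fun x _ => ?_
  by_cases h1 : u.1 i = false ∧ x.1 = Function.update u.1 i true
  · by_cases h2 : x.1 j = false ∧ w.1 = Function.update x.1 j true
    · exfalso
      have hij : i ≠ j := by
        rintro rfl
        have := h2.1
        rw [h1.2] at this
        simp at this
      refine h ⟨hij, h1.1, ?_, ?_⟩
      · have := h2.1
        rwa [h1.2, Function.update_of_ne hij.symm] at this
      · rw [h2.2, h1.2]
    · simp only [edgeTerm]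
      rw [dif_neg h2, Limits.comp_zero]
  · simp only [edgeTerm]
    rw [dif_neg h1, Limits.zero_comp]

theorem squareTerm_eq (r : ℤ) (u : D.Vertex r) (w : D.Vertex (r + 1 + 1)) (i j : Fin D.n)
    (x : D.Vertex (r + 1)) (h1 : u.1 i = false ∧ x.1 = Function.update u.1 i true)
    (h2 : x.1 j = false ∧ w.1 = Function.update x.1 j true) :
    D.squareTerm r u w (i, j) = (D.edgeSign u.1 i * D.edgeSign x.1 j) •
      CobL.mk (D.saddle h1 (D.shiftAt_succ r) ≫ D.saddle h2 (D.shiftAt_succ (r + 1))) := by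
  rw [squareTerm, Finset.sum_eq_single x]
  · simp only [edgeTerm]
    rw [dif_pos h1, dif_pos h2, Preadditive.zsmul_comp, Preadditive.comp_zsmul, smul_smul,
      CobL.mk_comp]
  · intro y _ hy
    have : ¬ (u.1 i = false ∧ y.1 = Function.update u.1 i true) := fun h =>
      hy (Subtype.ext (h.2.trans h1.2.symm))
    simp only [edgeTerm]
    rw [dif_neg this, Limits.zero_comp]
  · intro h; exact absurd (Finset.mem_univ _) h

theorem squareTerm_anticomm (r : ℤ) (u : D.Vertex r) (w : D.Vertex (r + 1 + 1)) (i j : Fin D.n) :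
    D.squareTerm r u w (i, j) + D.squareTerm r u w (j, i) = 0 := by
  by_cases h : i ≠ j ∧ u.1 i = false ∧ u.1 j = false
      ∧ w.1 = Function.update (Function.update u.1 i true) j true
  · obtain ⟨hij, hi, hj, hw⟩ := h
    have mem : ∀ k, u.1 k = false →
        (D.ones (Function.update u.1 k true) : ℤ) = r + 1 + D.nMinus := by
      intro k hk
      rw [D.ones_update hk]
      have := u.2
      push_cast
      linarith
    let x : D.Vertex (r + 1) := ⟨Function.update u.1 i true, mem i hi⟩
    let y : D.Vertex (r + 1) := ⟨Function.update u.1 j true, mem j hj⟩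
    have hx : u.1 i = false ∧ x.1 = Function.update u.1 i true := ⟨hi, rfl⟩
    have hy : u.1 j = false ∧ y.1 = Function.update u.1 j true := ⟨hj, rfl⟩
    have hxw : x.1 j = false ∧ w.1 = Function.update x.1 j true :=
      ⟨by simp only [x]; rw [Function.update_of_ne hij.symm, hj], hw⟩
    have hyw : y.1 i = false ∧ w.1 = Function.update y.1 i true :=
      ⟨by simp only [y]; rw [Function.update_of_ne hij, hi], by
        rw [hw]; exact Function.update_comm hij _ _ _⟩
    rw [D.squareTerm_eq r u w i j x hx hxw, D.squareTerm_eq r u w j i y hy hyw]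
    have hcomm : D.saddle hx (D.shiftAt_succ r) ≫ D.saddle hxw (D.shiftAt_succ (r + 1))
        = D.saddle hy (D.shiftAt_succ r) ≫ D.saddle hyw (D.shiftAt_succ (r + 1)) :=
      Subtype.ext (Quotient.sound (D.saddle_comm hij hi hj hx.2 hxw.2 hy.2))
    rw [hcomm, ← add_smul, D.edgeSign_anticomm hi hj hij]
    simp [y]
  · have h' : ¬ (j ≠ i ∧ u.1 j = false ∧ u.1 i = false
      ∧ w.1 = Function.update (Function.update u.1 j true) i true) := by
      rintro ⟨h1, h2, h3, h4⟩
      exact h ⟨h1.symm, h3, h2, by rw [h4]; exact Function.update_comm h1 _ _ _⟩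
    rw [D.squareTerm_eq_zero r u w i j h, D.squareTerm_eq_zero r u w j i h', add_zero]

theorem chainDiff_comp (r : ℤ) : D.chainDiff r ≫ D.chainDiff (r + 1) = 0 := by
  refine Mat_.hom_ext _ _ fun u w => ?_
  rw [Mat_.comp_apply]
  have h1 : ∑ x : D.Vertex (r + 1), (∑ i, D.edgeTerm r u x i) ≫ (∑ j, D.edgeTerm (r + 1) x w j)
      = ∑ p : Fin D.n × Fin D.n, D.squareTerm r u w p := by
    simp only [squareTerm]
    rw [Finset.sum_comm]
    refine Finset.sum_congr rfl fun x _ => ?_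
    rw [Preadditive.sum_comp, Fintype.sum_prod_type]
    refine Finset.sum_congr rfl fun i _ => ?_
    rw [Preadditive.comp_sum]
  refine Eq.trans h1 ?_
  refine Finset.sum_involution (fun p _ => p.swap) (fun p _ => D.squareTerm_anticomm r u w p.1 p.2)
    (fun p _ hp heq => hp ?_) (fun _ _ => Finset.mem_univ _) (fun _ _ => Prod.swap_swap _)
  have : p.1 = p.2 := congrArg Prod.snd heq
  exact D.squareTerm_eq_zero r u w p.1 p.2 fun h => h.1 this

/-- The geometric complex of a link diagram. -/
noncomputable def geometricComplex : CochainComplex (Mat_ CobL) ℤ :=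
  CochainComplex.of D.chainObj D.chainDiff D.chainDiff_comp

end LinkDiagram
end BarNatan

namespace BarNatan

open CategoryTheory

/-- The combinations of cobordisms for which the circles `a` (incoming) and `b` (outgoing) bound
the same component. -/
noncomputable def specialSpan {X Y : Cob} (a : X.circles) (b : Y.circles) :
    AddSubgroup (CobL.of X ⟶ CobL.of Y) :=
  AddSubgroup.closure {φ | ∃ (f : X ⟶ Y) (F : Surf X.circles Y.circles),
    Cob.surf f = Quotient.mk _ F ∧ F.bdry (Sum.inl a) = F.bdry (Sum.inr b) ∧ φ = CobL.mk f}

namespace LinkDiagram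

variable (D : LinkDiagram)

/-- The special circle of a smoothing: the one that contains the marked arc `p`. -/
def specialCircle (p : D.Arc) (v : Fin D.n → Bool) : D.Circles v := Quotient.mk _ p

/-- The graded free `ℤ[H]`-module in homological degree `r` when the diagram is marked on the arc
`p`. The basis consists of the smoothings in that degree with a sign for each non-special circle;
a plus sign shifts the degree by `1`, a minus sign by `-1`. -/
noncomputable def deloopedObj (p : D.Arc) (r : ℤ) : GrFree where
  index := Σ v : D.Vertex r, ({c : D.Circles v.1 // c ≠ D.specialCircle p v.1} → Bool)
  fintype := Fintype.ofFinite _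
  deg b := by
    classical
    exact D.shiftAt r + ∑ c, if b.2 c then 1 else -1

end LinkDiagram

end BarNatan

open CategoryTheory

/-! A non-special circle can be removed at the cost of doubling the object, because the special
component is always available as a place to attach tubes. Cut the cylinder over such a circle into
two discs and apply 4TU to these two discs and to two discs on the special component. The result is
that the cylinder, plus both discs together with a special handle, equals the sum of the two
surfaces in which one of the discs is tubed to the special component (`Deloop.neck_cutting`).
Combined with relation S and the evident compositions of births, caps, merges and splits, this says
that the column `merge - deathHandle`, `death` and the row `birth`, `split` are mutually inverse. So
the object is a sum of two copies of itself without the circle, shifted by `1` and `-1`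
(`splits_circle`). Iterating leaves only special lines, one for each choice of signs
(`splits_optObj`). Every surface used keeps the two special circles on one component.

The same relation computes the morphisms between special lines. With two discs on a closed component
and two on the special one, 4TU expresses a closed component of genus `g + 1` through surfaces in
which it has genus `g` or has been absorbed by the special component. Spheres vanish, so only
curtains remain (`ofSurf_mem_range_polyH`), and the degree then allows one power of `H` for given
shifts.

That no nonzero multiple of `H ^ k` vanishes needs an invariant. Colour each component by a sign
`u`, give it the weight `u` to the power genus minus one, and add one factor `u` for each outgoing
circle. The resulting state sum is multiplicative under gluing and kills S, T and 4TU
(`Surf.stateSum_comp`, `linStateSum_localRel`), while a curtain coloured by `+1` has weight `1`.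
Hence the functor `specialLine` is faithful.

A saddle is assembled from arcs, so the marked arc `p` puts the special circles at its two ends on
the same component. Conjugating the differential of the cube by the delooping isomorphisms therefore
gives matrices that come from `ℤ[H]` (`exists_specialLine_map_eq`). Faithfulness transports the
vanishing of the square, and homogeneity makes each entry a monomial. The delooping isomorphisms
commute with the differentials by construction, so the result is an isomorphism of complexes and not
merely a homotopy equivalence. -/

namespace BarNatan

/-! ### Recognising glued and tubed surfaces, and their Euler characteristics. -/

namespace Surf

variable {A B C I : Type}

theorem isGluing_tube (F : Surf A B) (i j : F.comps) :
    IsGluing F.wt (fun _ : Unit => i) (fun _ => j) F.bdry (F.tube i j)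
      (Glue.mk (E := Unit) (fun _ => i) (fun _ => j)) where
  surj := Glue.mk_surjective _ _
  glue e := Glue.sound _ _ e
  univ X f hf := ⟨Quot.lift f (by rintro i j ⟨e, rfl, rfl⟩; exact hf e), fun i => rfl⟩
  wt q := glueGenus_spec _ _ _ q
  bdry _ := rfl

/-- Once a section `σ` of `φ` is chosen, the only candidate for the factorisation of `f` through `φ`
is `f ∘ σ`. The universal property thus reduces to checking that `f` does not change under `σ ∘ φ`,
which is a finite case check in the examples below. -/
theorem IsGluing.of_section {J E : Type} [Fintype J] [Fintype E] {w : J → ℤ} {s t : E → J}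
    {b : A ⊕ B → J} {H : Surf A B} {φ : J → H.comps} (σ : H.comps → J) (hσ : ∀ q, φ (σ q) = q)
    (glue : ∀ e, φ (s e) = φ (t e))
    (univ : ∀ (X : Type) (f : J → X), (∀ e, f (s e) = f (t e)) → ∀ i, f (σ (φ i)) = f i)
    (wt : ∀ q, H.wt q = push φ w q + push (fun e => φ (s e)) (fun _ => 1) q)
    (bdry : ∀ x, H.bdry x = φ (b x)) : IsGluing w s t b H φ :=
  ⟨fun q => ⟨σ q, hσ q⟩, glue, fun X f hf => ⟨fun q => f (σ q), univ X f hf⟩, wt, bdry⟩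

theorem IsGluing.euler [Fintype A] [Fintype B] {J E : Type} [Fintype J] [Fintype E] {w : J → ℤ}
    {s t : E → J} {b : A ⊕ B → J} {H : Surf A B} {φ : J → H.comps}
    (h : IsGluing w s t b H φ) :
    H.euler = -2 * (∑ i, w i + Fintype.card E) - Fintype.card A - Fintype.card B := by
  rw [euler_eq, Finset.sum_congr rfl fun q _ => h.wt q, Finset.sum_add_distrib, sum_push, sum_push]
  simp

theorem euler_tube [Fintype A] [Fintype B] (F : Surf A B) (i j : F.comps) :
    (F.tube i j).euler = F.euler - 2 := by
  rw [(isGluing_tube F i j).euler, euler_eq]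
  simp
  ring

theorem euler_addClosed [Fintype A] [Fintype B] (F : Surf A B) (g : ℕ) :
    (F.addClosed g).euler = F.euler + 2 - 2 * g := by
  have : ∑ i, (F.addClosed g).wt i = ∑ i, F.wt i + ((g : ℤ) - 1) := by
    refine (Fintype.sum_sum_type (α₁ := F.comps) (α₂ := Unit) _).trans ?_
    simp [addClosed, wt]
  rw [euler_eq, euler_eq, this]
  ring

/-- The working tool for composites of explicit surfaces. The quotient that defines the composite is
never computed: it suffices to name the expected components `R`, a representative piece of each, and
to check the additivity of genus minus one, where every gluing circle contributes one. -/
theorem mk_comp_homeo [Fintype B] {P Q R : Type} [Fintype P] [Fintype Q] [Fintype R] {g : P → ℕ}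
    {b : A ⊕ B → P} {g' : Q → ℕ} {b' : B ⊕ C → Q} {g'' : R → ℕ} {b'' : A ⊕ C → R} (φ : P → R)
    (ψ : Q → R) (σ : R → P ⊕ Q) (hσ : ∀ r, Sum.elim φ ψ (σ r) = r)
    (glue : ∀ x, φ (b (Sum.inr x)) = ψ (b' (Sum.inl x)))
    (univ : ∀ (X : Type) (f : P → X) (f' : Q → X),
      (∀ x, f (b (Sum.inr x)) = f' (b' (Sum.inl x))) →
      (∀ i, Sum.elim f f' (σ (φ i)) = f i) ∧ ∀ i, Sum.elim f f' (σ (ψ i)) = f' i)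
    (wt : ∀ r, (g'' r : ℤ) - 1 = push φ (fun i => (g i : ℤ) - 1) r
      + push ψ (fun i => (g' i : ℤ) - 1) r + push (fun x => φ (b (Sum.inr x))) (fun _ => 1) r)
    (bdry : ∀ x, b'' x = Sum.elim (fun a => φ (b (Sum.inl a))) (fun c => ψ (b' (Sum.inr c))) x) :
    (Surf.mk P g b).comp (Surf.mk Q g' b') ≈ Surf.mk R g'' b'' := by
  refine (isGluing_comp (Surf.mk P g b) (Surf.mk Q g' b')).homeo (H' := Surf.mk R g'' b'')
    (φ' := Sum.elim φ ψ) (IsGluing.of_section σ hσ glue ?_ (fun q => ?_) ?_)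
  · rintro X f hf
    have := univ X (fun i => f (Sum.inl i)) (fun i => f (Sum.inr i)) hf
    have e : Sum.elim (fun i => f (Sum.inl i)) (fun i => f (Sum.inr i)) = f := by
      funext i; cases i <;> rfl
    rw [e] at this
    rintro (i | i)
    · exact this.1 i
    · exact this.2 i
  · exact (wt q).trans (congrArg₂ (· + ·)
      (push_sum (Sum.elim φ ψ) (Sum.elim (Surf.mk P g b).wt (Surf.mk Q g' b').wt) q).symm rfl)
  · rintro (x | x)
    · exact bdry _
    · exact bdry _

/-- The analogue of `mk_comp_homeo` for a tube, which is a gluing along a single circle. -/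
theorem mk_tube_homeo {P R : Type} [Fintype P] [Fintype R] {g : P → ℕ} {b : A ⊕ B → P} {i j : P}
    {g'' : R → ℕ} {b'' : A ⊕ B → R} (φ : P → R) (σ : R → P) (hσ : ∀ r, φ (σ r) = r)
    (glue : φ i = φ j) (univ : ∀ (X : Type) (f : P → X), f i = f j → ∀ x, f (σ (φ x)) = f x)
    (wt : ∀ r, (g'' r : ℤ) - 1 = push φ (fun i => (g i : ℤ) - 1) r
      + push (fun _ : Unit => φ i) (fun _ => 1) r)
    (bdry : ∀ x, b'' x = φ (b x)) : (Surf.mk P g b).tube i j ≈ Surf.mk R g'' b'' :=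
  (isGluing_tube (Surf.mk P g b) i j).homeo (H' := Surf.mk R g'' b'')
    (φ' := φ) (IsGluing.of_section σ hσ (fun _ => glue)
      (fun X f hf => univ X f (hf ())) wt bdry)

theorem push_id {J : Type} [Fintype J] (w : J → ℤ) (q : J) : push (fun i => i) w q = w q :=
  push_injective (fun i => i) (fun _ _ h => h) w q

open Classical in
theorem push_point {Q : Type} (x q : Q) :
    push (fun _ : Unit => x) (fun _ => 1) q = if q = x then 1 else 0 := by
  simp [push, @eq_comm _ q x]

open Classical in
/-- Add `k` handles to the component `i`. -/
noncomputable def raise (F : Surf A B) (i : F.comps) (k : ℕ) : Surf A B where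
  comps := F.comps
  genus j := F.genus j + if j = i then k else 0
  bdry := F.bdry

theorem euler_raise [Fintype A] [Fintype B] (F : Surf A B) (i : F.comps) (k : ℕ) :
    (F.raise i k).euler = F.euler - 2 * k := by
  classical
  have h : ∑ j : F.comps, (((F.genus j + if j = i then k else 0 : ℕ) : ℤ) - 1)
      = ∑ j, F.wt j + k := by
    simp only [Surf.wt]
    push_cast
    simp only [add_sub_right_comm, Finset.sum_add_distrib]
    simp
  have h' : (F.raise i k).euler = -2 * (∑ j, F.wt j + k) - Fintype.card A - Fintype.card B := by
    rw [euler_eq, ← h]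
    rfl
  rw [h', euler_eq]
  ring

/-- No components are identified, while the one gluing circle raises genus minus one by one. -/
theorem tube_self (F : Surf A B) (i : F.comps) : F.tube i i ≈ F.raise i 1 := by
  classical
  refine mk_tube_homeo (fun x => x) (fun x => x) (fun _ => rfl) rfl (fun _ _ _ _ => rfl)
    (fun r => ?_) fun _ => rfl
  rw [push_id, push_point]
  push_cast
  ring

theorem mk_tube_self_homeo {P : Type} [Fintype P] {g g' : P → ℕ} {b : A ⊕ B → P} {i : P}
    (hi : g' i = g i + 1) (hj : ∀ j, j ≠ i → g' j = g j) :
    (Surf.mk P g b).tube i i ≈ Surf.mk P g' b := by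
  classical
  refine Setoid.trans (tube_self _ _) ⟨Equiv.refl P, fun j => ?_, fun _ => rfl⟩
  change g' j = g j + if j = i then 1 else 0
  split_ifs with h
  · rw [h, hi]
  · exact hj j h

theorem addClosed_tube_self (F : Surf A B) (g : ℕ) :
    (F.addClosed g).tube (Sum.inr ()) (Sum.inr ()) ≈ F.addClosed (g + 1) := by
  refine mk_tube_self_homeo rfl ?_
  rintro (i | i) h
  · rfl
  · exact absurd rfl h

theorem addClosed_tube_inl (F : Surf A B) (s : F.comps) (g : ℕ) :
    (F.addClosed g).tube (Sum.inl s) (Sum.inl s) ≈ (F.raise s 1).addClosed g := by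
  refine mk_tube_self_homeo (P := F.comps ⊕ Unit) (g' := Sum.elim (F.raise s 1).genus fun _ => g)
    (congrArg _ (if_pos rfl)) ?_
  rintro (i | i) h
  · exact congrArg _ (if_neg fun e => h (congrArg _ e))
  · rfl

/-- This is a connected sum with the closed component: its weight `g - 1` and the `1` of the gluing
circle add `g` to the genus of `s`. -/
theorem addClosed_tube (F : Surf A B) (s : F.comps) (g : ℕ) :
    (F.addClosed g).tube (Sum.inr ()) (Sum.inl s) ≈ F.raise s g := by
  classical
  refine mk_tube_homeo (P := F.comps ⊕ Unit) (Sum.elim (fun x => x) fun _ => s) Sum.inl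
    (fun _ => rfl) rfl ?_ (fun r => ?_) fun _ => rfl
  · rintro X f hf (i | i)
    · rfl
    · exact hf.symm
  · rw [push_sum]
    simp only [Sum.elim_inl, Sum.elim_inr, push_id, push_point]
    simp only [push, Finset.univ_unique, Finset.sum_const,
      Finset.card_singleton, one_smul, @eq_comm _ s r]
    split_ifs <;> push_cast <;> ring

/-- A surface with a closed component `c`. -/
theorem exists_addClosed (F : Surf A B) (c : F.comps) (hc : ∀ x, F.bdry x ≠ c) :
    ∃ F' : Surf A B, Fintype.card F'.comps + 1 = Fintype.card F.comps
      ∧ (∀ x y, F.bdry x = F.bdry y → F'.bdry x = F'.bdry y)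
      ∧ F'.addClosed (F.genus c) ≈ F := by
  classical
  refine ⟨⟨{i // i ≠ c}, fun i => F.genus i.1, fun x => ⟨F.bdry x, hc x⟩⟩, ?_, ?_, ?_⟩
  · have := Fintype.card_subtype_compl (fun i => i = c)
    have h1 : 0 < Fintype.card F.comps := Fintype.card_pos_iff.2 ⟨c⟩
    simp only [Fintype.card_unique] at this
    change Fintype.card {i // i ≠ c} + 1 = _
    simp only [ne_eq]
    omega
  · intro x y h
    exact Subtype.ext h
  · refine homeo_of_bijection (Sum.elim Subtype.val fun _ => c)
      (fun i => if h : i = c then Sum.inr () else Sum.inl ⟨i, h⟩) ?_ ?_ ?_ ?_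
    · rintro (⟨i, hi⟩ | i)
      · exact dif_neg hi
      · exact dif_pos rfl
    · intro i
      by_cases h : i = c <;> simp [h]
    · rintro (⟨i, hi⟩ | i) <;> rfl
    · intro x; rfl

/-! ### Removing one circle

The circles `Option (Option I)` consist of the marked circle `none`, the circle `some none`
and the remaining circles `I`; the surfaces below remove or create the circle `some none`. -/

/-- A disc bounds the removed circle; the marked component has genus `k`. -/
def death (I : Type) [Fintype I] (k : ℕ) : Surf (Option (Option I)) (Option I) where
  comps := Option (Option I)
  genus c := c.elim k fun _ => 0
  bdry := Sum.elim id (Option.map some)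

/-- A disc bounds the created circle. -/
def birth (I : Type) [Fintype I] : Surf (Option I) (Option (Option I)) where
  comps := Option (Option I)
  genus _ := 0
  bdry := Sum.elim (Option.map some) id

/-- The removed circle is merged into the marked circle. -/
def merge (I : Type) [Fintype I] : Surf (Option (Option I)) (Option I) where
  comps := Option I
  genus _ := 0
  bdry := Sum.elim Option.join id

/-- The created circle is split off from the marked circle. -/
def split (I : Type) [Fintype I] : Surf (Option I) (Option (Option I)) where
  comps := Option I
  genus _ := 0
  bdry := Sum.elim id Option.join

/-- The cylinder with a handle on the marked component. -/
def handle (I : Type) [Fintype I] : Surf (Option I) (Option I) where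
  comps := Option I
  genus c := c.elim 1 fun _ => 0
  bdry := Sum.elim id id

/-- A disc (`true`) bounds the incoming circle `some none` and a disc (`false`) the outgoing one;
the marked component has genus `k`. -/
def capCup (I : Type) [Fintype I] (k : ℕ) : Surf (Option (Option I)) (Option (Option I)) where
  comps := Option I ⊕ Bool
  genus := Sum.elim (fun c => c.elim k fun _ => 0) fun _ => 0
  bdry := Sum.elim (fun c => c.elim (Sum.inl none) fun d => d.elim (Sum.inr true) fun i =>
    Sum.inl (some i)) (fun c => c.elim (Sum.inl none) fun d => d.elim (Sum.inr false) fun i =>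
    Sum.inl (some i))

variable (I) [Fintype I]

theorem euler_death (k : ℕ) : (death I k).euler = 1 - 2 * k := by
  have : (death I k).euler = ∑ i : Option (Option I),
      (2 - 2 * ((i.elim k fun _ => 0 : ℕ) : ℤ)) - _ - _ := rfl
  rw [this]
  simp [Fintype.sum_option]
  ring

theorem euler_birth : (birth I).euler = 1 := by
  have : (birth I).euler = ∑ _i : Option (Option I), (2 - 2 * ((0 : ℕ) : ℤ)) - _ - _ := rfl
  rw [this]
  simp
  ring

theorem euler_merge : (merge I).euler = -1 := by
  have : (merge I).euler = ∑ _i : Option I, (2 - 2 * ((0 : ℕ) : ℤ)) - _ - _ := rfl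
  rw [this]
  simp
  ring

theorem euler_split : (split I).euler = -1 := by
  have : (split I).euler = ∑ _i : Option I, (2 - 2 * ((0 : ℕ) : ℤ)) - _ - _ := rfl
  rw [this]
  simp
  ring

theorem euler_handle : (handle I).euler = -2 := by
  have : (handle I).euler = ∑ i : Option I,
      (2 - 2 * ((i.elim 1 fun _ => 0 : ℕ) : ℤ)) - _ - _ := rfl
  rw [this]
  simp [Fintype.sum_option]
  ring

theorem birth_comp_merge : (birth I).comp (merge I) ≈ cyl (Option I) := by
  classical
  refine mk_comp_homeo Option.join id Sum.inr (fun _ => rfl) ?_ ?_ ?_ ?_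
  · intro x; rfl
  · exact fun X f f' h => ⟨fun i => (h i).symm, fun i => rfl⟩
  · rintro (_ | r) <;> simp [push, Fintype.sum_option]
  · rintro ((_ | i) | (_ | i)) <;> rfl

theorem split_comp_death : (split I).comp (death I 0) ≈ cyl (Option I) := by
  classical
  refine mk_comp_homeo id Option.join Sum.inl (fun _ => rfl) ?_ ?_ ?_ ?_
  · intro x; rfl
  · exact fun X f f' h => ⟨fun i => rfl, fun i => h i⟩
  · rintro (_ | r) <;> simp [push, Fintype.sum_option]
  · rintro ((_ | i) | (_ | i)) <;> rfl

/-- The marked component consists of two pairs of pants glued along two circles, so its genus minus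
one is `-1 - 1 + 2 = 0`. This is how the special handle arises. -/
theorem split_comp_merge : (split I).comp (merge I) ≈ handle I := by
  classical
  refine mk_comp_homeo id id Sum.inl (fun _ => rfl) ?_ ?_ ?_ ?_
  · intro x; rfl
  · exact fun X f f' h => ⟨fun i => rfl, by
      rintro (_ | i)
      · exact h none
      · exact h (some (some i))⟩
  · rintro (_ | r) <;> simp [push, Fintype.sum_option]
  · rintro (a | a) <;> rfl

/-- The disc that creates the circle and the disc that caps it close up to a sphere. It is the only
closed component that occurs among the delooping surfaces, and S kills it. -/
theorem birth_comp_death : (birth I).comp (death I 0) ≈ (cyl (Option I)).addClosed 0 := by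
  classical
  refine mk_comp_homeo (R := Option I ⊕ Unit)
    (fun c => c.elim (Sum.inl none) fun d => d.elim (Sum.inr ()) fun i => Sum.inl (some i))
    (fun c => c.elim (Sum.inl none) fun d => d.elim (Sum.inr ()) fun i => Sum.inl (some i))
    (Sum.elim (fun c => Sum.inl (c.map some)) fun _ => Sum.inl (some none)) ?_ ?_ ?_ ?_ ?_
  · rintro ((_ | i) | i) <;> rfl
  · intro x; rfl
  · refine fun X f f' h => ⟨?_, ?_⟩
    · rintro (_ | _ | i) <;> rfl
    · rintro (_ | _ | i) <;> exact h _
  · rintro ((_ | r) | r) <;> simp [push, Fintype.sum_option, cyl]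
  · rintro ((_ | i) | (_ | i)) <;> rfl

theorem death_comp_handle : (death I 0).comp (handle I) ≈ death I 1 := by
  classical
  refine mk_comp_homeo id (Option.map some) Sum.inl (fun _ => rfl) ?_ ?_ ?_ ?_
  · intro x; rfl
  · exact fun X f f' h => ⟨fun i => rfl, fun i => h i⟩
  · rintro (_ | _ | r) <;> simp [push]
  · rintro (a | a) <;> rfl

theorem death_comp_birth (k : ℕ) : (death I k).comp (birth I) ≈ capCup I k := by
  classical
  refine mk_comp_homeo (R := Option I ⊕ Bool)
    (fun c => c.elim (Sum.inl none) fun d => d.elim (Sum.inr true) fun i => Sum.inl (some i))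
    (fun c => c.elim (Sum.inl none) fun d => d.elim (Sum.inr false) fun i => Sum.inl (some i))
    (Sum.elim (fun c => Sum.inl (c.map some)) fun b => if b then Sum.inl (some none)
      else Sum.inr (some none)) ?_ ?_ ?_ ?_ ?_
  · rintro ((_ | i) | (_ | _)) <;> rfl
  · rintro (_ | x) <;> rfl
  · refine fun X f f' h => ⟨?_, ?_⟩
    · rintro (_ | _ | i) <;> rfl
    · rintro (_ | _ | i)
      · exact h none
      · rfl
      · exact h (some i)
  · rintro ((_ | r) | (_ | _)) <;> simp [push, Fintype.sum_option, Function.comp_def, -Finset.sum_boole]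
  · rintro (a | a) <;> rfl

/-- Tubing the disc on the incoming circle to the marked component merges that circle into it, and
the disc on the outgoing circle is left as the birth. Both sides are compared with one explicit
surface, in which the incoming `some none` lies on the marked component and the outgoing one on its
own disc. -/
theorem merge_comp_birth :
    (merge I).comp (birth I) ≈ (capCup I 0).tube (Sum.inr true) (Sum.inl none) := by
  classical
  refine Setoid.trans (b := Surf.mk (Option (Option I)) (fun _ => 0)
    (Sum.elim (fun c => c.join.map some) id)) ?_ (Setoid.symm ?_)
  · refine mk_comp_homeo (Option.map some) id Sum.inr (fun _ => rfl) ?_ ?_ ?_ ?_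
    · intro x; rfl
    · exact fun X f f' h => ⟨fun i => (h i).symm, fun i => rfl⟩
    · rintro (_ | _ | r) <;> simp [push]
    · rintro (a | a) <;> rfl
  · refine mk_tube_homeo (P := Option I ⊕ Bool)
      (Sum.elim (Option.map some) fun b => if b then none else some none)
      (fun c => c.elim (Sum.inl none) fun d => d.elim (Sum.inr false) fun i => Sum.inl (some i))
      ?_ rfl ?_ ?_ ?_
    · rintro (_ | _ | i) <;> rfl
    · rintro X f h ((_ | i) | (_ | _))
      · rfl
      · rfl
      · rfl
      · exact h.symm
    · rintro (_ | _ | r) <;> simp [push]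
    · rintro ((_ | _ | i) | (_ | _ | i)) <;> rfl

/-- The mirror image of `merge_comp_birth`: now the outgoing disc is tubed to the marked component
and the incoming one stays a cap. -/
theorem death_comp_split :
    (death I 0).comp (split I) ≈ (capCup I 0).tube (Sum.inr false) (Sum.inl none) := by
  classical
  refine Setoid.trans (b := Surf.mk (Option (Option I)) (fun _ => 0)
    (Sum.elim id (fun c => c.join.map some))) ?_ (Setoid.symm ?_)
  · refine mk_comp_homeo id (Option.map some) Sum.inl (fun _ => rfl) ?_ ?_ ?_ ?_
    · intro x; rfl
    · exact fun X f f' h => ⟨fun i => rfl, fun i => h i⟩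
    · rintro (_ | _ | r) <;> simp [push]
    · rintro (a | a) <;> rfl
  · refine mk_tube_homeo (P := Option I ⊕ Bool)
      (Sum.elim (Option.map some) fun b => if b then some none else none)
      (fun c => c.elim (Sum.inl none) fun d => d.elim (Sum.inr true) fun i => Sum.inl (some i))
      ?_ rfl ?_ ?_ ?_
    · rintro (_ | _ | i) <;> rfl
    · rintro X f h ((_ | i) | (_ | _))
      · rfl
      · rfl
      · exact h.symm
      · rfl
    · rintro (_ | _ | r) <;> simp [push]
    · rintro ((_ | _ | i) | (_ | _ | i)) <;> rfl

/-- Two discs joined by a tube form an annulus, which restores the cylinder over the removed circle.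
-/
theorem capCup_tube_discs :
    (capCup I 0).tube (Sum.inr true) (Sum.inr false) ≈ cyl (Option (Option I)) := by
  classical
  refine mk_tube_homeo (P := Option I ⊕ Bool)
    (Sum.elim (Option.map some) fun _ => some none)
    (fun c => c.elim (Sum.inl none) fun d => d.elim (Sum.inr true) fun i => Sum.inl (some i))
    ?_ rfl ?_ ?_ ?_
  · rintro (_ | _ | i) <;> rfl
  · rintro X f h ((_ | i) | (_ | _))
    · rfl
    · rfl
    · exact h
    · rfl
  · rintro (_ | _ | r) <;> simp [push]
  · rintro ((_ | _ | i) | (_ | _ | i)) <;> rfl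

theorem capCup_tube_marked : (capCup I 0).tube (Sum.inl none) (Sum.inl none) ≈ capCup I 1 := by
  refine mk_tube_self_homeo rfl ?_
  rintro ((_ | i) | i) h
  · exact absurd rfl h
  · rfl
  · rfl

end Surf
-- The local relations as identities between classes of surfaces.
instance : (Quotient.functor localHomRel).Additive where
  map_add := rfl

namespace CobL

variable {X Y Z : Cob}

theorem map_eq_zero {φ : Free.of ℤ X ⟶ Free.of ℤ Y} (h : LocalRel φ) :
    (Quotient.functor localHomRel).map φ = 0 := by
  rw [← (Quotient.functor localHomRel).map_zero, Quotient.functor_map_eq_iff]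
  change φ - 0 ∈ localIdeal _ _
  rw [sub_zero]
  exact AddSubgroup.subset_closure ⟨X, Y, 𝟙 _, φ, 𝟙 _, h, by simp⟩

/-- The class of a surface of degree zero. -/
noncomputable def ofSurf (F : Surf X.circles Y.circles) (h : F.euler + Y.shift - X.shift = 0) :
    CobL.of X ⟶ CobL.of Y := CobL.mk (Cob.ofSurf F h)

theorem ofSurf_congr {F G : Surf X.circles Y.circles} (hFG : F ≈ G)
    (hF : F.euler + Y.shift - X.shift = 0) (hG : G.euler + Y.shift - X.shift = 0) :
    ofSurf F hF = ofSurf G hG :=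
  congrArg CobL.mk (Subtype.ext (Quotient.sound hFG))

theorem ofSurf_comp {F : Surf X.circles Y.circles} {G : Surf Y.circles Z.circles}
    {K : Surf X.circles Z.circles} (hFG : F.comp G ≈ K) (hF : F.euler + Y.shift - X.shift = 0)
    (hG : G.euler + Z.shift - Y.shift = 0) (hK : K.euler + Z.shift - X.shift = 0) :
    ofSurf F hF ≫ ofSurf G hG = ofSurf K hK := by
  rw [ofSurf, ofSurf, ← CobL.mk_comp]
  exact congrArg CobL.mk (Subtype.ext (Quotient.sound hFG))

theorem ofSurf_cyl {F : Surf X.circles X.circles} (h : F ≈ Surf.cyl X.circles)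
    (hF : F.euler + X.shift - X.shift = 0) : ofSurf F hF = 𝟙 _ := by
  rw [← CobL.mk_id]
  exact congrArg CobL.mk (Subtype.ext (Quotient.sound h))

theorem ofSurf_sphere {F G : Surf X.circles Y.circles} (hFG : G ≈ F.addClosed 0)
    (hG : G.euler + Y.shift - X.shift = 0) : ofSurf G hG = 0 := 
  map_eq_zero (LocalRel.sphere F _ (Quotient.sound hFG))

/-- The four tubed surfaces enter only up to homeomorphism, so the relation can be applied directly
to surfaces already identified by the lemmas above. -/
theorem ofSurf_fourTube (F : Surf X.circles Y.circles) (a b c d : F.comps)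
    {F₁₂ F₃₄ F₁₃ F₂₄ : Surf X.circles Y.circles} (e₁₂ : F.tube a b ≈ F₁₂) (e₃₄ : F.tube c d ≈ F₃₄)
    (e₁₃ : F.tube a c ≈ F₁₃) (e₂₄ : F.tube b d ≈ F₂₄)
    (h₁₂ : F₁₂.euler + Y.shift - X.shift = 0) (h₃₄ : F₃₄.euler + Y.shift - X.shift = 0)
    (h₁₃ : F₁₃.euler + Y.shift - X.shift = 0) (h₂₄ : F₂₄.euler + Y.shift - X.shift = 0) :
    ofSurf F₁₂ h₁₂ + ofSurf F₃₄ h₃₄ = ofSurf F₁₃ h₁₃ + ofSurf F₂₄ h₂₄ := by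
  have h := map_eq_zero (LocalRel.fourTube F ![a, b, c, d] (Cob.ofSurf F₁₂ h₁₂)
    (Cob.ofSurf F₃₄ h₃₄) (Cob.ofSurf F₁₃ h₁₃) (Cob.ofSurf F₂₄ h₂₄)
    (Quotient.sound (Setoid.symm e₁₂)) (Quotient.sound (Setoid.symm e₃₄))
    (Quotient.sound (Setoid.symm e₁₃)) (Quotient.sound (Setoid.symm e₂₄)))
  rw [Functor.map_sub, Functor.map_sub, Functor.map_add, sub_sub, sub_eq_zero] at h
  exact h

end CobL

/-! ### Morphisms that join the marked circles, and splittings built from them. -/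

theorem ofSurf_mem_specialSpan {X Y : Cob} {a : X.circles} {b : Y.circles}
    (F : Surf X.circles Y.circles) (hF : F.euler + Y.shift - X.shift = 0)
    (h : F.bdry (Sum.inl a) = F.bdry (Sum.inr b)) : CobL.ofSurf F hF ∈ specialSpan a b :=
  AddSubgroup.subset_closure ⟨_, F, rfl, h, rfl⟩

theorem mk_mem_specialSpan {X Y : Cob} {a : X.circles} {b : Y.circles} (f : X ⟶ Y)
    (F : Surf X.circles Y.circles) (hf : Cob.surf f = ⟦F⟧)
    (h : F.bdry (Sum.inl a) = F.bdry (Sum.inr b)) : CobL.mk f ∈ specialSpan a b :=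
  AddSubgroup.subset_closure ⟨f, F, hf, h, rfl⟩

theorem id_mem_specialSpan {X : Cob} (a : X.circles) : 𝟙 (CobL.of X) ∈ specialSpan a a := by
  rw [← CobL.mk_id]
  exact mk_mem_specialSpan _ (Surf.cyl X.circles) rfl rfl

/-- In a composite, the component through `a` and the component through `c` both contain the middle
marked circle `b`, so they become one. Bilinearity reduces the claim to single surfaces. -/
theorem comp_mem_specialSpan {X Y Z : Cob} {a : X.circles} {b : Y.circles} {c : Z.circles}
    {φ : CobL.of X ⟶ CobL.of Y} {ψ : CobL.of Y ⟶ CobL.of Z} (hφ : φ ∈ specialSpan a b)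
    (hψ : ψ ∈ specialSpan b c) : φ ≫ ψ ∈ specialSpan a c := by
  induction hφ using AddSubgroup.closure_induction with
  | zero => rw [Limits.zero_comp]; exact zero_mem _
  | add x y _ _ hx hy => rw [Preadditive.add_comp]; exact add_mem hx hy
  | neg x _ hx => rw [Preadditive.neg_comp]; exact neg_mem hx
  | mem x hx =>
    obtain ⟨f, F, hf, hF, rfl⟩ := hx
    induction hψ using AddSubgroup.closure_induction with
    | zero => rw [Limits.comp_zero]; exact zero_mem _
    | add x y _ _ hx hy => rw [Preadditive.comp_add]; exact add_mem hx hy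
    | neg x _ hx => rw [Preadditive.comp_neg]; exact neg_mem hx
    | mem y hy =>
      obtain ⟨g, G, hg, hG, rfl⟩ := hy
      rw [← CobL.mk_comp]
      refine mk_mem_specialSpan _ (F.comp G) ?_ ?_
      · change Cob.compClass (Cob.surf f) (Cob.surf g) = _
        rw [hf, hg]
        rfl
      · have h := Surf.isGluing_comp F G
        rw [h.bdry, h.bdry]
        simp only [Sum.elim_inl, Sum.elim_inr]
        rw [hF, h.glue, hG]

/-- The marked object `X` is isomorphic to the direct sum of the marked objects `Y k`, by
combinations of cobordisms for which the marked circles bound the same component. -/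
def Splits (X : Cob) (s : X.circles) {K : Type} [Fintype K] (Y : K → Cob)
    (t : ∀ k, (Y k).circles) : Prop :=
  ∃ (Φ : ∀ k, CobL.of X ⟶ CobL.of (Y k)) (Ψ : ∀ k, CobL.of (Y k) ⟶ CobL.of X),
    (∀ k, Φ k ∈ specialSpan s (t k)) ∧ (∀ k, Ψ k ∈ specialSpan (t k) s) ∧
    (∀ k, Ψ k ≫ Φ k = 𝟙 _) ∧ (∀ k l, k ≠ l → Ψ k ≫ Φ l = 0) ∧ ∑ k, Φ k ≫ Ψ k = 𝟙 _

namespace Splits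

variable {X : Cob} {s : X.circles} {K : Type} [Fintype K] {Y : K → Cob} {t : ∀ k, (Y k).circles}

theorem reindex {J : Type} [Fintype J] (h : Splits X s Y t) (e : J ≃ K) :
    Splits X s (fun j => Y (e j)) fun j => t (e j) := by
  obtain ⟨Φ, Ψ, h1, h2, h3, h4, h5⟩ := h
  refine ⟨fun j => Φ (e j), fun j => Ψ (e j), fun j => h1 _, fun j => h2 _, fun j => h3 _,
    fun j l hjl => h4 _ _ (e.injective.ne hjl), ?_⟩
  rw [← h5]
  exact e.sum_comp fun k => Φ k ≫ Ψ k

/-- This is what makes delooping iterable. Orthogonality of two summands comes from the outer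
splitting when their outer indices differ, and from the inner one when they agree. -/
theorem trans {L : K → Type} [∀ k, Fintype (L k)] {Z : ∀ k, L k → Cob}
    {u : ∀ k l, (Z k l).circles} (h : Splits X s Y t) (h' : ∀ k, Splits (Y k) (t k) (Z k) (u k)) :
    Splits X s (K := Σ k, L k) (fun p => Z p.1 p.2) fun p => u p.1 p.2 := by
  obtain ⟨Φ, Ψ, h1, h2, h3, h4, h5⟩ := h
  choose Φ' Ψ' h1' h2' h3' h4' h5' using h'
  refine ⟨fun p => Φ p.1 ≫ Φ' p.1 p.2, fun p => Ψ' p.1 p.2 ≫ Ψ p.1,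
    fun p => comp_mem_specialSpan (h1 _) (h1' _ _), fun p => comp_mem_specialSpan (h2' _ _) (h2 _),
    fun p => ?_, ?_, ?_⟩
  · rw [Category.assoc, reassoc_of% h3 p.1, h3']
  · rintro ⟨k, l⟩ ⟨k', l'⟩ hp
    simp only [Category.assoc]
    by_cases hk : k = k'
    · subst hk
      rw [reassoc_of% h3 k, h4']
      rintro rfl
      exact hp rfl
    · rw [reassoc_of% h4 k k' hk, Limits.zero_comp, Limits.comp_zero]
  · rw [Fintype.sum_sigma, ← h5]
    refine Finset.sum_congr rfl fun k _ => ?_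
    have : ∀ l, (Φ k ≫ Φ' k l) ≫ Ψ' k l ≫ Ψ k = Φ k ≫ (Φ' k l ≫ Ψ' k l) ≫ Ψ k := by
      intro l; simp only [Category.assoc]
    simp only [this]
    rw [← Preadditive.comp_sum, ← Preadditive.sum_comp, h5', Category.id_comp]

end Splits

/-- The cylinder of a bijection between circles. -/
def Surf.relabel {A B : Type} [Fintype A] (e : A ≃ B) : Surf A B where
  comps := A
  genus _ := 0
  bdry := Sum.elim id e.symm

theorem Surf.relabel_comp {A B : Type} [Fintype A] [Fintype B] (e : A ≃ B) :
    (Surf.relabel e).comp (Surf.relabel e.symm) ≈ Surf.cyl A := by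
  classical
  refine Surf.mk_comp_homeo id e.symm Sum.inl (fun _ => rfl) ?_ ?_ ?_ ?_
  · intro x; rfl
  · exact fun X f f' h => ⟨fun i => rfl, fun i => h i⟩
  · intro r
    -- Each annulus of the second cylinder has weight `-1` and is met by exactly one gluing circle,
    -- so the two contributions cancel and only the first cylinder counts.
    have h : push (fun i => e.symm i) (fun _ => (-1 : ℤ)) r
        + push (fun i => e.symm i) (fun _ => 1) r = 0 := by
      rw [← congrFun (push_add (fun i => e.symm i) (fun _ => (-1 : ℤ)) (fun _ => 1)) r]
      simp [push]
    have h' := Surf.push_id (fun _ : A => (-1 : ℤ)) r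
    have h'' : push (fun x => id (Sum.elim id e.symm (Sum.inr x : A ⊕ B))) (fun _ => 1) r
        = push (fun i => e.symm i) (fun _ => 1) r := rfl
    simp only [Nat.cast_zero, zero_sub]
    rw [h'', add_assoc, h, add_zero]
    exact h'.symm
  · rintro (a | a)
    · rfl
    · exact (e.symm_apply_apply a).symm

theorem Surf.euler_relabel {A B : Type} [Fintype A] [Fintype B] (e : A ≃ B) :
    (Surf.relabel e).euler = 0 := by
  have : (Surf.relabel e).euler = ∑ _i : A, (2 - 2 * ((0 : ℕ) : ℤ)) - Fintype.card A
    - Fintype.card B := rfl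
  rw [this, Fintype.card_congr e]
  simp [Fintype.card_congr e]
  ring

namespace Splits

variable {X : Cob} {s : X.circles} {K : Type} [Fintype K] {Y : K → Cob} {t : ∀ k, (Y k).circles}

/-- Cylinders over `e` and its inverse are mutually inverse, and they join the marked circles
because `e` matches `s'` with `s`. This lets the delooping be done on the model `Option I` only. -/
theorem relabel {X' : Cob} {s' : X'.circles} (h : Splits X s Y t) (e : X'.circles ≃ X.circles)
    (hs : e s' = s) (hsh : X'.shift = X.shift) : Splits X' s' Y t := by
  obtain ⟨Φ, Ψ, h1, h2, h3, h4, h5⟩ := h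
  have he : (Surf.relabel e).euler + X.shift - X'.shift = 0 := by
    rw [Surf.euler_relabel, hsh]; ring
  have he' : (Surf.relabel e.symm).euler + X'.shift - X.shift = 0 := by
    rw [Surf.euler_relabel, hsh]; ring
  have c1 : CobL.ofSurf (Surf.relabel e) he ≫ CobL.ofSurf (Surf.relabel e.symm) he' = 𝟙 _ := by
    rw [CobL.ofSurf_comp (Surf.relabel_comp e) he he' (by rw [Surf.euler_cyl]; ring)]
    exact CobL.ofSurf_cyl (Setoid.refl _) _
  have c2 : CobL.ofSurf (Surf.relabel e.symm) he' ≫ CobL.ofSurf (Surf.relabel e) he = 𝟙 _ := by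
    refine (CobL.ofSurf_comp (Surf.relabel_comp e.symm) he' he
      (by rw [Surf.euler_cyl]; ring)).trans ?_
    exact CobL.ofSurf_cyl (Setoid.refl _) _
  subst hs
  refine ⟨fun k => CobL.ofSurf _ he ≫ Φ k, fun k => Ψ k ≫ CobL.ofSurf _ he',
    fun k => comp_mem_specialSpan (ofSurf_mem_specialSpan _ _ (e.symm_apply_apply s').symm) (h1 k),
    fun k => comp_mem_specialSpan (h2 k) (ofSurf_mem_specialSpan _ _ rfl), fun k => ?_,
    fun k l hkl => ?_, ?_⟩
  · rw [Category.assoc, reassoc_of% c2, h3]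
  · rw [Category.assoc, reassoc_of% c2, h4 k l hkl]
  · have : ∀ k, (CobL.ofSurf _ he ≫ Φ k) ≫ Ψ k ≫ CobL.ofSurf _ he'
        = CobL.ofSurf _ he ≫ (Φ k ≫ Ψ k) ≫ CobL.ofSurf _ he' := by
      intro k; simp only [Category.assoc]
    simp only [this]
    rw [← Preadditive.comp_sum, ← Preadditive.sum_comp, h5, Category.id_comp, c1]

theorem of_unique [Unique K] (X : Cob) (s : X.circles) :
    Splits X s (fun _ : K => X) fun _ => s :=
  ⟨fun _ => 𝟙 _, fun _ => 𝟙 _, fun _ => id_mem_specialSpan s, fun _ => id_mem_specialSpan s,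
    fun _ => Category.id_comp _, fun k l h => absurd (Subsingleton.elim k l) h, by simp⟩

theorem of_bool {Y : Bool → Cob} {t : ∀ k, (Y k).circles} (u : CobL.of X ⟶ CobL.of (Y true))
    (u' : CobL.of X ⟶ CobL.of (Y false)) (w : CobL.of (Y true) ⟶ CobL.of X)
    (w' : CobL.of (Y false) ⟶ CobL.of X) (hu : u ∈ specialSpan s (t true))
    (hu' : u' ∈ specialSpan s (t false)) (hw : w ∈ specialSpan (t true) s)
    (hw' : w' ∈ specialSpan (t false) s) (h1 : w ≫ u = 𝟙 _) (h2 : w' ≫ u' = 𝟙 _)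
    (h3 : w ≫ u' = 0) (h4 : w' ≫ u = 0) (h5 : u ≫ w + u' ≫ w' = 𝟙 _) : Splits X s Y t := by
  refine ⟨fun k => match k with | true => u | false => u',
    fun k => match k with | true => w | false => w', ?_, ?_, ?_, ?_, ?_⟩
  · rintro (_ | _)
    · exact hu'
    · exact hu
  · rintro (_ | _)
    · exact hw'
    · exact hw
  · rintro (_ | _)
    · exact h2
    · exact h1
  · rintro (_ | _) (_ | _) h
    · exact absurd rfl h
    · exact h4
    · exact h3
    · exact absurd rfl h
  · rw [Fintype.sum_bool]
    exact h5

end Splits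

/-! ### Delooping a single circle. -/

/-- The circles `Option I`, marked at `none`. -/
def optObj (I : Type) [Fintype I] (m : ℤ) : Cob where
  circles := Option I
  shift := m

namespace Deloop

variable (I : Type) [Fintype I] (m : ℤ)

/-- Merge the circle `some none` into the marked circle. -/
noncomputable def merge : CobL.of (optObj (Option I) m) ⟶ CobL.of (optObj I (m + 1)) :=
  CobL.ofSurf (X := optObj (Option I) m) (Y := optObj I (m + 1)) (Surf.merge I)
    ((congrArg (fun x : ℤ => x + (m + 1) - m) (Surf.euler_merge I)).trans (by ring))

/-- Cap off the circle `some none`. -/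
noncomputable def death : CobL.of (optObj (Option I) m) ⟶ CobL.of (optObj I (m + -1)) :=
  CobL.ofSurf (X := optObj (Option I) m) (Y := optObj I (m + -1)) (Surf.death I 0)
    ((congrArg (fun x : ℤ => x + (m + -1) - m) (Surf.euler_death I 0)).trans (by push_cast; ring))

/-- Cap off the circle `some none` and add a special handle. -/
noncomputable def deathHandle : CobL.of (optObj (Option I) m) ⟶ CobL.of (optObj I (m + 1)) :=
  CobL.ofSurf (X := optObj (Option I) m) (Y := optObj I (m + 1)) (Surf.death I 1)
    ((congrArg (fun x : ℤ => x + (m + 1) - m) (Surf.euler_death I 1)).trans (by push_cast; ring))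

/-- Create the circle `some none` by a disc. -/
noncomputable def birth : CobL.of (optObj I (m + 1)) ⟶ CobL.of (optObj (Option I) m) :=
  CobL.ofSurf (X := optObj I (m + 1)) (Y := optObj (Option I) m) (Surf.birth I)
    ((congrArg (fun x : ℤ => x + m - (m + 1)) (Surf.euler_birth I)).trans (by ring))

/-- Split the circle `some none` off from the marked circle. -/
noncomputable def split : CobL.of (optObj I (m + -1)) ⟶ CobL.of (optObj (Option I) m) :=
  CobL.ofSurf (X := optObj I (m + -1)) (Y := optObj (Option I) m) (Surf.split I)
    ((congrArg (fun x : ℤ => x + m - (m + -1)) (Surf.euler_split I)).trans (by ring))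

/-- Add a special handle. -/
noncomputable def handle : CobL.of (optObj I (m + -1)) ⟶ CobL.of (optObj I (m + 1)) :=
  CobL.ofSurf (X := optObj I (m + -1)) (Y := optObj I (m + 1)) (Surf.handle I)
    ((congrArg (fun x : ℤ => x + (m + 1) - (m + -1)) (Surf.euler_handle I)).trans (by ring))

theorem birth_merge : birth I m ≫ merge I m = 𝟙 _ :=
  (CobL.ofSurf_comp (Surf.birth_comp_merge I) _ _
    ((congrArg (fun x : ℤ => x + (m + 1) - (m + 1)) Surf.euler_cyl).trans (by ring))).trans
    (CobL.ofSurf_cyl (Setoid.refl _) _)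

theorem split_death : split I m ≫ death I m = 𝟙 _ :=
  (CobL.ofSurf_comp (Surf.split_comp_death I) _ _
    ((congrArg (fun x : ℤ => x + (m + -1) - (m + -1)) Surf.euler_cyl).trans (by ring))).trans
    (CobL.ofSurf_cyl (Setoid.refl _) _)

theorem split_merge : split I m ≫ merge I m = handle I m :=
  CobL.ofSurf_comp (Surf.split_comp_merge I) _ _ _

theorem death_handle : death I m ≫ handle I m = deathHandle I m :=
  CobL.ofSurf_comp (Surf.death_comp_handle I) _ _ _

theorem birth_death : birth I m ≫ death I m = 0 := by
  have h : ((Surf.cyl (Option I)).addClosed 0).euler = 2 := by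
    rw [Surf.euler_addClosed, Surf.euler_cyl]; norm_num
  have h1 := CobL.ofSurf_comp (X := optObj I (m + 1)) (Y := optObj (Option I) m)
    (Z := optObj I (m + -1)) (Surf.birth_comp_death I)
    ((congrArg (fun x : ℤ => x + m - (m + 1)) (Surf.euler_birth I)).trans (by ring))
    ((congrArg (fun x : ℤ => x + (m + -1) - m) (Surf.euler_death I 0)).trans (by push_cast; ring))
    ((congrArg (fun x : ℤ => x + (m + -1) - (m + 1)) h).trans (by ring))
  exact h1.trans (CobL.ofSurf_sphere (X := optObj I (m + 1)) (Y := optObj I (m + -1))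
    (F := Surf.cyl (Option I)) (Setoid.refl _) _)

/-- Cutting the neck of the cylinder over the circle `some none`. -/
theorem neck_cutting : 𝟙 (CobL.of (optObj (Option I) m)) + deathHandle I m ≫ birth I m
    = merge I m ≫ birth I m + death I m ≫ split I m := by
  have deg : ∀ {x : ℤ}, x = 0 → x + m - m = 0 := by
    intro x hx; rw [hx]; ring
  have e0 : (Surf.capCup I 0).euler = 2 := by
    rw [← Surf.euler_congr (Surf.death_comp_birth I 0), Surf.euler_comp, Surf.euler_death,
      Surf.euler_birth]
    norm_num
  have e1 : (Surf.capCup I 1).euler = 0 := by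
    rw [← Surf.euler_congr (Surf.death_comp_birth I 1), Surf.euler_comp, Surf.euler_death,
      Surf.euler_birth]
    norm_num
  have et : ∀ i j, ((Surf.capCup I 0).tube i j).euler = 0 := fun i j => by
    rw [Surf.euler_tube, e0]; norm_num
  -- Discs `1` and `2` are those bounding the incoming and the outgoing copy of the circle; discs
  -- `3` and `4` both lie on the marked component. Tube `12` rebuilds the cylinder, tube `34` is a
  -- special handle, and tubes `13` and `24` attach one disc each to the marked component.
  have h := CobL.ofSurf_fourTube (X := optObj (Option I) m) (Y := optObj (Option I) m)
    (Surf.capCup I 0) (Sum.inr true) (Sum.inr false) (Sum.inl none) (Sum.inl none)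
    (Surf.capCup_tube_discs I) (Surf.capCup_tube_marked I) (Setoid.refl _) (Setoid.refl _)
    (deg Surf.euler_cyl) (deg e1) (deg (et _ _)) (deg (et _ _))
  have h1 := CobL.ofSurf_comp (X := optObj (Option I) m) (Y := optObj I (m + 1))
    (Z := optObj (Option I) m) (Surf.death_comp_birth I 1)
    ((congrArg (fun x : ℤ => x + (m + 1) - m) (Surf.euler_death I 1)).trans (by push_cast; ring))
    ((congrArg (fun x : ℤ => x + m - (m + 1)) (Surf.euler_birth I)).trans (by ring)) (deg e1)
  have h2 := CobL.ofSurf_comp (X := optObj (Option I) m) (Y := optObj I (m + 1))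
    (Z := optObj (Option I) m) (Surf.merge_comp_birth I)
    ((congrArg (fun x : ℤ => x + (m + 1) - m) (Surf.euler_merge I)).trans (by ring))
    ((congrArg (fun x : ℤ => x + m - (m + 1)) (Surf.euler_birth I)).trans (by ring))
    (deg (et _ _))
  have h3 := CobL.ofSurf_comp (X := optObj (Option I) m) (Y := optObj I (m + -1))
    (Z := optObj (Option I) m) (Surf.death_comp_split I)
    ((congrArg (fun x : ℤ => x + (m + -1) - m) (Surf.euler_death I 0)).trans (by push_cast; ring))
    ((congrArg (fun x : ℤ => x + m - (m + -1)) (Surf.euler_split I)).trans (by ring))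
    (deg (et _ _))
  exact (congrArg₂ (· + ·) (CobL.ofSurf_cyl (X := optObj (Option I) m) (Setoid.refl _) _).symm
    h1).trans (h.trans (congrArg₂ (· + ·) h2 h3).symm)

theorem merge_mem : merge I m ∈ specialSpan (X := optObj (Option I) m) (Y := optObj I (m + 1))
    (none : Option (Option I)) (none : Option I) := ofSurf_mem_specialSpan _ _ rfl

theorem death_mem : death I m ∈ specialSpan (X := optObj (Option I) m) (Y := optObj I (m + -1))
    (none : Option (Option I)) (none : Option I) := ofSurf_mem_specialSpan _ _ rfl

theorem deathHandle_mem : deathHandle I m ∈ specialSpan (X := optObj (Option I) m)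
    (Y := optObj I (m + 1)) (none : Option (Option I)) (none : Option I) :=
  ofSurf_mem_specialSpan _ _ rfl

theorem birth_mem : birth I m ∈ specialSpan (X := optObj I (m + 1)) (Y := optObj (Option I) m)
    (none : Option I) (none : Option (Option I)) := ofSurf_mem_specialSpan _ _ rfl

theorem split_mem : split I m ∈ specialSpan (X := optObj I (m + -1)) (Y := optObj (Option I) m)
    (none : Option I) (none : Option (Option I)) := ofSurf_mem_specialSpan _ _ rfl

end Deloop

open Deloop in
/-- Delooping: removing a circle, with the help of the marked component. -/
theorem splits_circle (I : Type) [Fintype I] (m : ℤ) :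
    Splits (optObj (Option I) m) (none : Option (Option I))
      (fun b : Bool => optObj I (m + if b then 1 else -1)) fun _ => (none : Option I) := by
  -- The correction `- deathHandle I m` is what `neck_cutting` leaves over; it also makes the
  -- projection orthogonal to `split`. The shifts `m + 1` and `m + -1` are the two values of `m + if
  -- b then 1 else -1`.
  refine Splits.of_bool (X := optObj (Option I) m)
    (Y := fun b : Bool => optObj I (m + if b then 1 else -1))
    (merge I m - deathHandle I m) (death I m) (birth I m) (split I m)
    (sub_mem (merge_mem I m) (deathHandle_mem I m)) (death_mem I m) (birth_mem I m) (split_mem I m)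
    ?_ (split_death I m) (birth_death I m) ?_ ?_
  -- The correction term contains `birth I m ≫ death I m`, a sphere, and drops out.
  · refine (Preadditive.comp_sub (birth I m) (merge I m) (deathHandle I m)).trans ?_
    rw [← death_handle, reassoc_of% birth_death I m, birth_merge, Limits.zero_comp, sub_zero]
    rfl
  -- Both terms equal the special handle: one by gluing two pairs of pants, the other because
  -- `split` followed by `death` is the identity.
  · refine (Preadditive.comp_sub (split I m) (merge I m) (deathHandle I m)).trans ?_
    rw [← death_handle, reassoc_of% split_death I m, split_merge, sub_self]
  · refine (congrArg (· + _) (Preadditive.sub_comp (merge I m) (deathHandle I m)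
      (birth I m))).trans ?_
    rw [sub_add_eq_add_sub, ← neck_cutting, add_sub_cancel_right]

/-! ### Delooping all circles except the marked one. -/

/-- The marked object `X` splits into special lines with the shifts `n k`. -/
abbrev SplitsLines (X : Cob) (s : X.circles) {K : Type} [Fintype K] (n : K → ℤ) : Prop :=
  Splits X s (fun k => lineObj (n k)) fun _ => ()

/-- Delooping all circles except for the marked one. -/
theorem splits_optObj (I : Type) [Fintype I] [Fintype (I → Bool)] (m : ℤ) (n : (I → Bool) → ℤ)
    (hn : ∀ ε, n ε = m + ∑ i, if ε i then 1 else -1) :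
    SplitsLines (optObj I m) none n := by
  classical
  -- Induction on the finite type `I` up to bijection. The shift `m` and the function `n` must vary,
  -- since removing one circle moves `m` by its sign and restricts `n`.
  have key : ∀ (I : Type) [Finite I], ∀ [Fintype I] [Fintype (I → Bool)] (m : ℤ)
      (n : (I → Bool) → ℤ), (∀ ε, n ε = m + ∑ i, if ε i then 1 else -1) →
      SplitsLines (optObj I m) none n := by
    intro I _
    induction I using Finite.induction_empty_option with
    | of_equiv e ih =>
      rename_i I J
      intro _ _ m n hn
      let : Fintype I := Fintype.ofEquiv J e.symm
      let f : (J → Bool) ≃ (I → Bool) := (e.arrowCongr (Equiv.refl Bool)).symm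
      have h := (ih m (fun ε => n (f.symm ε)) (fun ε => by
        rw [hn, ← e.sum_comp]
        simp [f])).reindex f
      have hf : n = fun ε => n (f.symm (f ε)) := by
        funext ε; rw [f.symm_apply_apply]
      rw [hf]
      exact h.relabel (X' := optObj J m) (s' := none) e.symm.optionCongr rfl rfl
    | h_empty =>
      intro _ _ m n hn
      obtain rfl : n = fun _ => m := by
        funext ε; rw [hn]; simp
      refine (Splits.of_unique (lineObj m) ()).relabel (X' := optObj PEmpty m)
        (Equiv.ofUnique (Option PEmpty) Unit) rfl rfl
    | h_option ih =>
      rename_i I _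
      intro _ _ m n hn
      obtain rfl : ‹Fintype (Option I)› = instFintypeOption := Subsingleton.elim _ _
      -- A choice of signs on `Option I` is the sign of the circle removed now together with the
      -- signs of the circles removed later.
      let f : (Option I → Bool) ≃ Σ _ : Bool, I → Bool :=
        (Equiv.piOptionEquivProd (β := fun _ => Bool)).trans (Equiv.sigmaEquivProd _ _).symm
      have h := ((splits_circle I m).trans fun b => ih (m + if b then 1 else -1)
        (fun ε => n (f.symm ⟨b, ε⟩)) (fun ε => by
          rw [hn, Fintype.sum_option]
          simp [f, add_assoc])).reindex f
      have hf : n = fun ε => n (f.symm (f ε)) := by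
        funext ε; rw [f.symm_apply_apply]
      rw [hf]
      exact h
  exact key I m n hn

/-- Delooping all circles of an object except for the marked one. -/
theorem splits_lines (X : Cob) (s : X.circles) [Fintype {c // c ≠ s}]
    [Fintype ({c // c ≠ s} → Bool)] (n : ({c // c ≠ s} → Bool) → ℤ)
    (hn : ∀ ε, n ε = X.shift + ∑ i, if ε i then 1 else -1) :
    SplitsLines X s n := by
  classical
  exact (splits_optObj {c // c ≠ s} X.shift n hn).relabel (Equiv.optionSubtypeNe s).symm
    (Equiv.optionSubtypeNe_symm_self s) rfl

/-! ### Curtains generate the special morphisms between special lines. -/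

/-- `polyH` as a homomorphism. -/
noncomputable def polyHHom (m n : ℤ) :
    Polynomial ℤ →+ (CobL.of (lineObj m) ⟶ CobL.of (lineObj n)) :=
  AddMonoidHom.mk' (polyH m n) (polyH_add m n)

/-- A surface between special lines for which the special circles bound the same component is a
multiple of a curtain: closed components are removed by cutting their handles. -/
theorem ofSurf_mem_range_polyH (N : ℕ) : ∀ (F : Surf Unit Unit), Fintype.card F.comps = N →
    F.bdry (Sum.inl ()) = F.bdry (Sum.inr ()) → ∀ (m n : ℤ) (h : F.euler + n - m = 0),
    CobL.ofSurf (X := lineObj m) (Y := lineObj n) F h ∈ (polyHHom m n).range := by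
  induction N using Nat.strong_induction_on with
  | _ N ih =>
  intro F hN hF m n h
  -- Inside the induction on the number of components runs an induction on the genus `g` of one
  -- closed component. It treats all `G` at once, because its step replaces `G` by `G.raise s 1`.
  have closed : ∀ (g : ℕ) (G : Surf Unit Unit), Fintype.card G.comps + 1 = N →
      G.bdry (Sum.inl ()) = G.bdry (Sum.inr ()) → ∀ h : (G.addClosed g).euler + n - m = 0,
      CobL.ofSurf (X := lineObj m) (Y := lineObj n) (G.addClosed g) h
        ∈ (polyHHom m n).range := by
    intro g
    induction g with
    | zero =>
      intro G _ _ h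
      have h0 := CobL.ofSurf_sphere (X := lineObj m) (Y := lineObj n) (F := G) (Setoid.refl _) h
      exact h0 ▸ zero_mem _
    | succ g ihg =>
      intro G hG hb h
      rw [Surf.euler_addClosed] at h
      push_cast at h
      let s := G.bdry (Sum.inl ())
      have h34 : ((G.raise s 1).addClosed g).euler + n - m = 0 := by
        rw [Surf.euler_addClosed, Surf.euler_raise]; push_cast; linarith
      have h13 : (G.raise s g).euler + n - m = 0 := by
        rw [Surf.euler_raise]; linarith
      -- Discs `1, 2` lie on the closed component and discs `3, 4` on the special component `s`.
      -- Hence the closed component of genus `g + 1` equals twice the connected sum `G.raise s g`,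
      -- which has one component fewer, minus a surface whose closed component has genus `g`.
      have h4 := CobL.ofSurf_fourTube (X := lineObj m) (Y := lineObj n) (G.addClosed g) (Sum.inr ())
        (Sum.inr ()) (Sum.inl s) (Sum.inl s) (Surf.addClosed_tube_self G g)
        (Surf.addClosed_tube_inl G s g) (Surf.addClosed_tube G s g) (Surf.addClosed_tube G s g)
        (by change (G.addClosed (g + 1)).euler + n - m = 0
            rw [Surf.euler_addClosed]; push_cast; linarith) h34 h13 h13
      rw [eq_sub_of_add_eq h4]
      have h5 := ih (Fintype.card G.comps) (by omega) (G.raise s g) rfl hb m n h13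
      exact sub_mem (add_mem h5 h5) (ihg (G.raise s 1) hG hb h34)
  -- Both boundary circles lie on the special component, so any other component is closed. If there
  -- is none, `F` is connected and hence a curtain.
  by_cases hc : ∃ c, c ≠ F.bdry (Sum.inl ())
  · obtain ⟨c, hc⟩ := hc
    obtain ⟨G, hG1, hG2, hG3⟩ := F.exists_addClosed c (by
      rintro (⟨⟩ | ⟨⟩)
      · exact hc.symm
      · rw [← hF]; exact hc.symm)
    have h' : (G.addClosed (F.genus c)).euler + n - m = 0 := by
      rw [Surf.euler_congr hG3]; exact h
    rw [← CobL.ofSurf_congr (X := lineObj m) (Y := lineObj n) hG3 h' h]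
    exact closed _ G (hG1.trans hN) (hG2 _ _ hF) h'
  · push Not at hc
    have e : F ≈ curtainSurf (F.genus (F.bdry (Sum.inl ()))) :=
      Surf.homeo_of_bijection (fun _ => ()) (fun _ => F.bdry (Sum.inl ())) (fun i => (hc i).symm)
        (fun _ => rfl) (fun i => by rw [hc i]; rfl) (fun _ => rfl)
    have hk : n = m + 2 * (F.genus (F.bdry (Sum.inl ())) : ℕ) := by
      rw [Surf.euler_congr e, euler_curtain] at h
      linarith
    refine ⟨Polynomial.monomial (F.genus (F.bdry (Sum.inl ()))) 1, ?_⟩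
    change polyH m n _ = _
    rw [polyH_monomial, dif_pos hk, one_smul]
    exact congrArg CobL.mk (Subtype.ext (Quotient.sound (Setoid.symm e)))

/-- The substantial inclusion is `ofSurf_mem_range_polyH`; the other holds because a curtain is
connected. -/
theorem specialSpan_line (m n : ℤ) :
    specialSpan (X := lineObj m) (Y := lineObj n) () () = (polyHHom m n).range := by
  refine le_antisymm ((AddSubgroup.closure_le _).2 ?_) ?_
  · rintro _ ⟨⟨S, hS⟩, F, hf, hF, rfl⟩
    change S = _ at hf
    subst hf
    exact ofSurf_mem_range_polyH _ F rfl hF m n hS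
  · rintro _ ⟨p, rfl⟩
    change polyH m n p ∈ _
    rw [polyH, Polynomial.sum_def]
    refine sum_mem fun k _ => ?_
    split_ifs with h
    · exact zsmul_mem (mk_mem_specialSpan _ (curtainSurf k) rfl rfl) _
    · exact zero_mem _

/-! ### A state sum over signs that detects multiples of curtains. -/

open Classical in
/-- `1` if `p` holds and `0` otherwise. -/
noncomputable def indicator (p : Prop) : ℤ := if p then 1 else 0

theorem indicator_of {p : Prop} (h : p) : indicator p = 1 := if_pos h

theorem indicator_of_not {p : Prop} (h : ¬ p) : indicator p = 0 := if_neg h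

namespace Surf

variable {A B C : Type}

open Classical in
-- Colourings of the glued components are the colourings of the pieces that agree along every gluing
-- circle. Since genus minus one adds up with an extra `1` for each gluing circle, the weight
-- factors over the pieces with one additional sign per circle.
theorem IsGluing.sum_colourings {J E : Type} [Fintype J] [Fintype E] {w : J → ℤ} {s t : E → J}
    {b : A ⊕ B → J} {H : Surf A B} {φ : J → H.comps} (h : IsGluing w s t b H φ)
    [Fintype (J → ℤˣ)] (g : (J → ℤˣ) → ℤ) :
    ∑ c : H.comps → ℤˣ, g (fun i => c (φ i)) * ((∏ q, c q ^ H.wt q : ℤˣ) : ℤ)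
      = ∑ c : J → ℤˣ, indicator (∀ e, c (s e) = c (t e)) *
          (g c * (((∏ i, c i ^ w i) * ∏ e, c (s e) : ℤˣ) : ℤ)) := by
  -- An exponent that is a sum over a fibre turns into a product over the fibre, and all fibres
  -- together exhaust `I`.
  have hpush : ∀ {I : Type} [Fintype I] (ψ : I → H.comps) (w : I → ℤ) (c : H.comps → ℤˣ),
      ∏ q, c q ^ push ψ w q = ∏ i, c (ψ i) ^ w i := by
    intro I _ ψ w c
    have hz : ∀ (x : ℤˣ) (v : I → ℤ), x ^ ∑ i, v i = ∏ i, x ^ v i := fun x v =>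
      map_prod (zpowersHom ℤˣ x) (fun i => Multiplicative.ofAdd (v i)) Finset.univ
    simp only [push, hz]
    rw [Finset.prod_comm]
    refine Finset.prod_congr rfl fun i _ => ?_
    rw [Finset.prod_eq_single (ψ i)]
    · rw [if_pos rfl]
    · intro q _ hq
      rw [if_neg hq.symm, zpow_zero]
    · intro hq; exact absurd (Finset.mem_univ _) hq
  simp only [indicator, ite_mul, one_mul, zero_mul]
  rw [← Finset.sum_filter]
  refine Finset.sum_nbij (fun c i => c (φ i)) (fun c _ => ?_) ?_ ?_ (fun c _ => ?_)
  · simp only [Finset.mem_filter, Finset.mem_univ, true_and]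
    intro e
    rw [h.glue]
  · intro c _ c' _ hcc
    funext q
    obtain ⟨i, rfl⟩ := h.surj q
    exact congrFun hcc i
  · intro c hc
    simp only [Finset.coe_filter, Finset.mem_univ, true_and, Set.mem_ofPred_eq] at hc
    obtain ⟨c', hc'⟩ := h.univ _ c hc
    exact ⟨c', by simp, funext hc'⟩
  · congr 2
    simp only [h.wt, zpow_add, Finset.prod_mul_distrib, hpush, zpow_one]

/-- The weight of a colouring of the components by signs. -/
noncomputable def colourWeight [Fintype B] (F : Surf A B) (c : F.comps → ℤˣ) : ℤ :=
  (((∏ q, c q ^ F.wt q) * ∏ b, c (F.bdry (Sum.inr b)) : ℤˣ) : ℤ)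

open Classical in
/-- Sum of the weights of all colourings of the components that extend given colourings of the
boundary circles. -/
noncomputable def stateSum [Fintype B] (F : Surf A B) :
    Matrix (A → ℤˣ) (B → ℤˣ) ℤ := fun α β =>
  ∑ c : F.comps → ℤˣ, (indicator ((fun a => c (F.bdry (Sum.inl a))) = α))
    * (indicator ((fun b => c (F.bdry (Sum.inr b))) = β)) * F.colourWeight c

theorem stateSum_congr [Fintype B] {F G : Surf A B} (h : F ≈ G) : F.stateSum = G.stateSum := by
  classical
  obtain ⟨e, h1, h2⟩ := h
  ext α β
  refine Eq.symm (Eq.trans (Equiv.sum_comp (e.arrowCongr (Equiv.refl ℤˣ)) _).symm ?_)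
  refine Finset.sum_congr rfl fun c _ => ?_
  simp only [colourWeight, h2, Equiv.arrowCongr_apply, Equiv.coe_refl, Function.comp_apply, id,
    Equiv.symm_apply_apply]
  refine congrArg (fun x : ℤˣ => _ * ((x * _ : ℤˣ) : ℤ)) ?_
  rw [← e.prod_comp]
  refine Finset.prod_congr rfl fun q _ => ?_
  simp only [wt, h1, Equiv.symm_apply_apply]

theorem mk_stateSum {P : Type} [Fintype P] [Fintype (P → ℤˣ)] [Fintype B] (g : P → ℕ) (b : A ⊕ B → P) (α : A → ℤˣ) (β : B → ℤˣ) :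
    (Surf.mk P g b).stateSum α β = ∑ c : P → ℤˣ,
      (indicator ((fun a => c (b (Sum.inl a))) = α))
      * (indicator ((fun x => c (b (Sum.inr x))) = β))
      * (((∏ q, c q ^ ((g q : ℤ) - 1)) * ∏ x, c (b (Sum.inr x)) : ℤˣ) : ℤ) := by
  unfold stateSum colourWeight wt
  congr!

/-- Gluing produces one sign for each circle of `B`. These are exactly the signs that `colourWeight`
assigns to the outgoing circles of `F`, which is why only outgoing circles are counted there. -/
theorem stateSum_comp [Fintype B] [Fintype C] [Fintype (B → ℤˣ)] (F : Surf A B) (G : Surf B C) :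
    (F.comp G).stateSum = F.stateSum * G.stateSum := by
  classical
  ext α γ
  have h := isGluing_comp F G
  have h1 := h.sum_colourings fun c =>
    (indicator ((fun a => c (Sum.inl (F.bdry (Sum.inl a)))) = α))
    * (indicator ((fun b => c (Sum.inr (G.bdry (Sum.inr b)))) = γ))
    * ((∏ b, c (Sum.inr (G.bdry (Sum.inr b))) : ℤˣ) : ℤ)
  have h2 : (F.comp G).stateSum α γ = _ := Eq.trans (Finset.sum_congr rfl fun c _ => by
    simp only [h.bdry, colourWeight, Sum.elim_inl, Sum.elim_inr]
    push_cast
    ring) h1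
  refine h2.trans (((Equiv.sumArrowEquivProdArrow F.comps G.comps ℤˣ).symm.sum_comp
    (M := ℤ) _).symm.trans ?_)
  rw [Fintype.sum_prod_type, Matrix.mul_apply]
  simp only [stateSum, Finset.sum_mul_sum]
  refine Eq.trans (Finset.sum_congr rfl fun c _ => ?_) Finset.sum_comm
  refine Eq.trans (Finset.sum_congr rfl fun c' _ => ?_) Finset.sum_comm
  -- The sum over colourings of the middle circles collapses to the one induced by `c`; the
  -- indicator for `c'` then becomes the gluing condition.
  refine Eq.trans ?_ (Finset.sum_eq_single (fun b => c (F.bdry (Sum.inr b))) ?_ ?_).symm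
  · simp only [Equiv.sumArrowEquivProdArrow_symm_apply_inl,
      Equiv.sumArrowEquivProdArrow_symm_apply_inr, colourWeight, Fintype.prod_sum_type,
      Sum.elim_inl, Sum.elim_inr, indicator_of, funext_iff, @eq_comm _ (c _) (c' _)]
    push_cast
    ring
  · intro β _ hβ
    rw [indicator_of_not (Ne.symm hβ)]
    ring
  · intro h; exact absurd (Finset.mem_univ _) h

open Classical in
-- A tube is a gluing along one circle, so it multiplies the weight of each colouring of `F` by a
-- factor that depends only on the colours at its two ends. Relation 4TU becomes an identity between
-- four signs.
theorem stateSum_tube [Fintype B] (F : Surf A B) (i j : F.comps) (α : A → ℤˣ) (β : B → ℤˣ) :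
    (F.tube i j).stateSum α β =
      ∑ c : F.comps → ℤˣ, indicator ((fun a => c (F.bdry (Sum.inl a))) = α)
        * indicator ((fun b => c (F.bdry (Sum.inr b))) = β) * F.colourWeight c
        * (indicator (c i = c j) * ((c i : ℤˣ) : ℤ)) := by
  classical
  have h := isGluing_tube F i j
  have h1 := h.sum_colourings fun c =>
    (indicator ((fun a => c (F.bdry (Sum.inl a))) = α))
    * (indicator ((fun b => c (F.bdry (Sum.inr b))) = β))
    * ((∏ b, c (F.bdry (Sum.inr b)) : ℤˣ) : ℤ)
  have h2 : (F.tube i j).stateSum α β = _ := Eq.trans (Finset.sum_congr rfl fun c _ => by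
    simp only [h.bdry, colourWeight]
    push_cast
    ring) h1
  rw [h2]
  refine Finset.sum_congr rfl fun c _ => ?_
  simp only [colourWeight, forall_const, Finset.univ_unique, Finset.prod_singleton]
  push_cast
  ring

/-- The colour of a closed component is subject to no boundary condition, so it contributes an
independent factor. This factor is `1 + (-1) = 0` for a sphere and `1 + 1 = 2` for a torus, as S and
T demand. -/
theorem stateSum_addClosed [Fintype B] (F : Surf A B) (g : ℕ) :
    (F.addClosed g).stateSum = (∑ u : ℤˣ, ((u ^ ((g : ℤ) - 1) : ℤˣ) : ℤ)) • F.stateSum := by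
  classical
  ext α β
  refine (mk_stateSum _ _ _ _).trans ?_
  rw [← (Equiv.sumArrowEquivProdArrow F.comps Unit ℤˣ).symm.sum_comp, Fintype.sum_prod_type_right,
    Matrix.smul_apply, smul_eq_mul, Finset.sum_mul, ← (Equiv.funUnique Unit ℤˣ).sum_comp]
  refine Finset.sum_congr rfl fun u _ => ?_
  simp only [stateSum, Finset.mul_sum]
  refine Finset.sum_congr rfl fun c _ => ?_
  simp only [Equiv.sumArrowEquivProdArrow_symm_apply_inl,
      Equiv.sumArrowEquivProdArrow_symm_apply_inr, colourWeight, Fintype.prod_sum_type, wt,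
      Sum.elim_inl, Sum.elim_inr, Finset.univ_unique, Finset.prod_singleton]
  push_cast
  simp only [Equiv.funUnique_apply]
  ring

end Surf
/-- The state sum of a cobordism. -/
noncomputable def Cob.stateSum {X Y : Cob} (f : X ⟶ Y) :
    Matrix (X.circles → ℤˣ) (Y.circles → ℤˣ) ℤ :=
  Quotient.lift Surf.stateSum (fun _ _ h => Surf.stateSum_congr h) (Cob.surf f)

theorem Cob.stateSum_eq {X Y : Cob} {f : X ⟶ Y} {F : Surf X.circles Y.circles}
    (h : Cob.surf f = ⟦F⟧) : Cob.stateSum f = F.stateSum := by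
  rw [Cob.stateSum, h]
  rfl

theorem Cob.stateSum_comp {X Y Z : Cob} [Fintype (Y.circles → ℤˣ)] (f : X ⟶ Y) (g : Y ⟶ Z) :
    Cob.stateSum (f ≫ g) = Cob.stateSum f * Cob.stateSum g := by
  obtain ⟨F, hF⟩ := Quotient.exists_rep (Cob.surf f)
  obtain ⟨G, hG⟩ := Quotient.exists_rep (Cob.surf g)
  have h : Cob.surf (f ≫ g) = ⟦F.comp G⟧ := by
    change Cob.compClass (Cob.surf f) (Cob.surf g) = _
    rw [← hF, ← hG]
    rfl
  rw [Cob.stateSum_eq hF.symm, Cob.stateSum_eq hG.symm, Cob.stateSum_eq h, Surf.stateSum_comp]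

/-- The linear extension of the state sum. -/
noncomputable def linStateSum (X Y : Cob) :
    (Free.of ℤ X ⟶ Free.of ℤ Y) →+ Matrix (X.circles → ℤˣ) (Y.circles → ℤˣ) ℤ :=
  (Finsupp.liftAddHom fun f : X ⟶ Y =>
    AddMonoidHom.mk' (fun c : ℤ => c • Cob.stateSum f) fun a b => add_smul a b _)

theorem linStateSum_single {X Y : Cob} (f : X ⟶ Y) (c : ℤ) :
    linStateSum X Y (Finsupp.single f c) = c • Cob.stateSum f :=
  Finsupp.liftAddHom_apply_single _ _ _

theorem linStateSum_lin {X Y : Cob} (f : X ⟶ Y) :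
    linStateSum X Y (Cob.lin f) = Cob.stateSum f :=
  (linStateSum_single f 1).trans (one_smul _ _)

/-- Multiplicativity extends bilinearly from single cobordisms. It is needed because the local ideal
is closed under composition on both sides. -/
theorem linStateSum_comp {X Y Z : Cob} [Fintype (Y.circles → ℤˣ)] (φ : Free.of ℤ X ⟶ Free.of ℤ Y)
    (ψ : Free.of ℤ Y ⟶ Free.of ℤ Z) :
    linStateSum X Z (φ ≫ ψ) = linStateSum X Y φ * linStateSum Y Z ψ := by
  refine Finsupp.induction_linear (motive := fun φ : (X ⟶ Y) →₀ ℤ =>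
    linStateSum X Z ((show Free.of ℤ X ⟶ Free.of ℤ Y from φ) ≫ ψ)
      = linStateSum X Y φ * linStateSum Y Z ψ) φ ?_ ?_ ?_
  · refine (congrArg _ Limits.zero_comp).trans ?_
    rw [map_zero]
    exact (Eq.trans (congrArg (· * _) (map_zero (linStateSum X Y))) (Matrix.zero_mul _)).symm
  · intro a b ha hb
    refine (congrArg _ (Preadditive.add_comp _ _ _ _ _ _)).trans ?_
    rw [map_add, ha, hb]
    exact (Eq.trans (congrArg (· * _) (map_add (linStateSum X Y) a b)) (Matrix.add_mul _ _ _)).symm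
  intro f c
  refine Finsupp.induction_linear (motive := fun ψ : (Y ⟶ Z) →₀ ℤ =>
    linStateSum X Z ((show Free.of ℤ X ⟶ Free.of ℤ Y from Finsupp.single f c)
      ≫ (show Free.of ℤ Y ⟶ Free.of ℤ Z from ψ))
      = linStateSum X Y (Finsupp.single f c) * linStateSum Y Z ψ) ψ ?_ ?_ ?_
  · refine (congrArg _ Limits.comp_zero).trans ?_
    rw [map_zero]
    exact (Eq.trans (congrArg (_ * ·) (map_zero (linStateSum Y Z))) (Matrix.mul_zero _)).symm
  · intro a b ha hb
    refine (congrArg _ (Preadditive.comp_add _ _ _ _ _ _)).trans ?_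
    rw [map_add, ha, hb]
    exact (Eq.trans (congrArg (_ * ·) (map_add (linStateSum Y Z) a b)) (Matrix.mul_add _ _ _)).symm
  · intro g d
    refine (congrArg _ (Free.single_comp_single ℤ _ f g c d)).trans ?_
    refine (linStateSum_single (f ≫ g) (c * d)).trans (Eq.trans ?_ (congrArg₂ (· * ·)
      (linStateSum_single f c) (linStateSum_single g d)).symm)
    rw [Cob.stateSum_comp, Matrix.smul_mul, Matrix.mul_smul, smul_smul]

/-- The state sum is compatible with the local relations. -/
theorem linStateSum_localRel {X Y : Cob} {φ : Free.of ℤ X ⟶ Free.of ℤ Y} (h : LocalRel φ) :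
    linStateSum X Y φ = 0 := by
  classical
  cases h with
  | sphere F f hf =>
    rw [linStateSum_lin, Cob.stateSum_eq hf, Surf.stateSum_addClosed]
    have : ∑ u : ℤˣ, ((u ^ (((0 : ℕ) : ℤ) - 1) : ℤˣ) : ℤ) = 0 := by decide
    rw [this, zero_smul]
  | torus F f g hf hg =>
    rw [map_sub, map_zsmul, linStateSum_lin, linStateSum_lin, Cob.stateSum_eq hf,
      Cob.stateSum_eq hg, Surf.stateSum_addClosed]
    have : ∑ u : ℤˣ, ((u ^ (((1 : ℕ) : ℤ) - 1) : ℤˣ) : ℤ) = 2 := by decide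
    rw [this, sub_self]
  | fourTube F p f₁₂ f₃₄ f₁₃ f₂₄ h₁₂ h₃₄ h₁₃ h₂₄ =>
    rw [map_sub, map_sub, map_add, linStateSum_lin, linStateSum_lin, linStateSum_lin,
      linStateSum_lin, Cob.stateSum_eq h₁₂, Cob.stateSum_eq h₃₄, Cob.stateSum_eq h₁₃,
      Cob.stateSum_eq h₂₄]
    ext α β
    -- For signs, `indicator (a = b) * a` is half of `a + b`, so the two positive and the two
    -- negative terms both amount to half of `a + b + c + d`.
    have key : ∀ a b c d : ℤˣ, indicator (a = b) * (a : ℤ) + indicator (c = d) * (c : ℤ)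
        - indicator (a = c) * (a : ℤ) - indicator (b = d) * (b : ℤ) = 0 := by
      have hd : ∀ a b c d : ℤˣ, (if a = b then 1 else 0) * (a : ℤ)
        + (if c = d then 1 else 0) * (c : ℤ) - (if a = c then 1 else 0) * (a : ℤ)
        - (if b = d then 1 else 0) * (b : ℤ) = 0 := by decide
      intro a b c d
      rw [← hd a b c d]
      simp only [indicator]
      congr!
    simp only [Matrix.sub_apply, Matrix.add_apply, Surf.stateSum_tube, Matrix.zero_apply]
    rw [← Finset.sum_add_distrib, ← Finset.sum_sub_distrib, ← Finset.sum_sub_distrib]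
    refine Finset.sum_eq_zero fun c _ => ?_
    rw [← mul_add, ← mul_sub, ← mul_sub, key, mul_zero]

theorem linStateSum_localIdeal {X Y : Cob} {φ : Free.of ℤ X ⟶ Free.of ℤ Y}
    (h : φ ∈ localIdeal (Free.of ℤ X) (Free.of ℤ Y)) : linStateSum X Y φ = 0 := by
  classical
  have : localIdeal (Free.of ℤ X) (Free.of ℤ Y) ≤ (linStateSum X Y).ker := by
    refine (AddSubgroup.closure_le _).2 ?_
    rintro _ ⟨X', Y', f, ρ, g, hρ, rfl⟩
    rw [SetLike.mem_coe, AddMonoidHom.mem_ker]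
    have h1 := linStateSum_comp (X := X) (Y := X') (Z := Y) f (ρ ≫ g)
    have h2 := linStateSum_comp (X := X') (Y := Y') (Z := Y) ρ g
    rw [h1, h2, linStateSum_localRel hρ, Matrix.zero_mul, Matrix.mul_zero]
  exact this h

/-- The boundary forces the single component to have colour `+1`, whose powers are all `1` whatever
the genus. -/
theorem stateSum_curtain (k : ℕ) : (curtainSurf k).stateSum 1 1 = 1 := by
  classical
  refine (Surf.mk_stateSum _ _ _ _).trans ?_
  rw [Finset.sum_eq_single 1]
  · refine (congrArg₂ (· * ·) (congrArg₂ (· * ·) (indicator_of rfl) (indicator_of rfl)) rfl).trans ?_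
    simp
  · intro c _ hc
    refine (congrArg₂ (· * ·) (congrArg₂ (· * ·) (indicator_of_not hc) rfl) rfl).trans ?_
    simp
  · intro h; exact absurd (Finset.mem_univ _) h

/-- The powers of the special 1-handle operator are linearly independent. -/
theorem smul_handlePow_eq_zero {m n : ℤ} {k : ℕ} (h : n = m + 2 * k) {c : ℤ}
    (hc : c • CobL.mk (handlePow k h) = 0) : c = 0 := by
  have h1 : (Quotient.functor localHomRel).map (c • Cob.lin (handlePow k h))
      = (Quotient.functor localHomRel).map 0 := by
    rw [Functor.map_zsmul, Functor.map_zero]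
    exact hc
  rw [Quotient.functor_map_eq_iff] at h1
  -- Vanishing modulo the local relations means lying in the local ideal, where the state sum is
  -- zero. Its entry at the constant colouring `1` reads off `c`.
  have h2 := linStateSum_localIdeal h1
  rw [sub_zero, map_zsmul, linStateSum_lin,
    Cob.stateSum_eq (F := curtainSurf k) (f := handlePow k h) rfl] at h2
  have h3 := congrFun (congrFun h2 1) 1
  have h4 : (c • (curtainSurf k).stateSum) 1 1 = c * (curtainSurf k).stateSum 1 1 := by
    rw [Matrix.smul_apply, smul_eq_mul]
  rw [stateSum_curtain, mul_one] at h4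
  exact h4.symm.trans h3

/-- A homogeneous polynomial is a monomial, so only multiples of a single power of `H` have to be
excluded. Without homogeneity this fails, since `polyH` discards terms of the wrong degree. -/
theorem eq_zero_of_polyH_eq_zero {m n : ℤ} {p : Polynomial ℤ}
    (hp : ∀ k, p.coeff k ≠ 0 → n = m + 2 * k) (h : polyH m n p = 0) : p = 0 := by
  by_contra h0
  obtain ⟨k, c, hk, rfl⟩ := eq_monomial_of_homogeneous hp h0
  rw [polyH_monomial, dif_pos hk] at h
  exact h0 (by rw [smul_handlePow_eq_zero hk h, Polynomial.monomial_zero_right])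

/-! ### Faithfulness, and lifting matrices of special morphisms to `ℤ[H]`. -/

namespace GrFree

variable {M N : GrFree}

theorem hom_ext_coef {f g : M ⟶ N} (h : ∀ i j, coef f i j = coef g i j) : f = g := by
  classical
  refine Subtype.ext (LinearMap.pi_ext' fun i => LinearMap.ext_ring (funext fun j => ?_))
  have := h i j
  simp only [coef, entry] at this
  simp only [LinearMap.comp_apply, LinearMap.single_apply]
  convert! this

theorem coef_sub (f g : M ⟶ N) (i : M.index) (j : N.index) :
    coef (f - g) i j = coef f i j - coef g i j := rfl

theorem exists_hom_coef (P : M.index → N.index → Polynomial ℤ)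
    (hP : ∀ i j k, (P i j).coeff k ≠ 0 → N.deg j = M.deg i + 2 * k) :
    ∃ f : M ⟶ N, ∀ i j, coef f i j = P i j := by
  classical
  -- Entries are indexed by source and then target, so the matrix acts on row vectors.
  have h : ∀ i j, entry (M := M) (N := N) (Matrix.vecMulLinear (Matrix.of P)) i j = P i j := by
    intro i j
    simp only [entry, Matrix.vecMulLinear_apply]
    convert! congrFun (Matrix.single_one_vecMul i (Matrix.of P)) j
  exact ⟨⟨Matrix.vecMulLinear (Matrix.of P), fun i j k hk => hP i j k (by rwa [h] at hk)⟩, h⟩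

theorem coef_eq_monomial (f : M ⟶ N) (i : M.index) (j : N.index) :
    ∃ (k : ℕ) (c : ℤ), coef f i j = Polynomial.monomial k c := by
  by_cases h0 : coef f i j = 0
  · exact ⟨0, 0, by rw [h0, Polynomial.monomial_zero_right]⟩
  · obtain ⟨k, c, -, h⟩ := eq_monomial_of_homogeneous (fun k hk => f.2 i j k hk) h0
    exact ⟨k, c, h⟩

end GrFree

/-- Applied to `f - g`, whose entries are homogeneous because it has degree zero, the injectivity of
`polyH` on homogeneous polynomials gives the claim entry by entry. -/
theorem specialLine_faithful : specialLine.Faithful where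
  map_injective {M N f g} h := by
    refine GrFree.hom_ext_coef fun i j => ?_
    rw [← sub_eq_zero, ← GrFree.coef_sub]
    refine eq_zero_of_polyH_eq_zero (fun k hk => (f - g).2 i j k hk) ?_
    have h1 : specialLine.map (f - g) = 0 := by rw [Functor.map_sub, h, sub_self]
    exact congrFun (congrFun h1 i) j

/-- Terms of the wrong degree contribute nothing to `polyH`, so they may be dropped. The remaining
polynomial is admissible as an entry of a map of degree zero. -/
theorem exists_homogeneous (m n : ℤ) (p : Polynomial ℤ) :
    ∃ q : Polynomial ℤ, (∀ k, q.coeff k ≠ 0 → n = m + 2 * k) ∧ polyH m n q = polyH m n p := by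
  induction p using Polynomial.induction_on' with
  | add p q hp hq =>
    obtain ⟨p', hp1, hp2⟩ := hp
    obtain ⟨q', hq1, hq2⟩ := hq
    refine ⟨p' + q', fun k hk => ?_, by rw [polyH_add, polyH_add, hp2, hq2]⟩
    by_cases h : p'.coeff k = 0
    · exact hq1 k fun h' => hk (by rw [Polynomial.coeff_add, h, h', add_zero])
    · exact hp1 k h
  | monomial k c =>
    by_cases h : n = m + 2 * k
    · refine ⟨Polynomial.monomial k c, fun l hl => ?_, rfl⟩
      rw [Polynomial.coeff_monomial] at hl
      split_ifs at hl with hkl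
      · rw [← hkl]; exact h
      · exact absurd rfl hl
    · exact ⟨0, fun l hl => absurd (Polynomial.coeff_zero l) hl, by
        rw [polyH_zero, polyH_monomial, dif_neg h]⟩

/-- A restricted form of fullness: by `specialSpan_line` each entry is a polynomial in `H`, and its
homogeneous part provides the matrix over `ℤ[H]`. -/
theorem exists_specialLine_map_eq {M N : GrFree} (φ : specialLineObj M ⟶ specialLineObj N)
    (hφ : ∀ i j, φ i j ∈ specialSpan (X := lineObj (M.deg i)) (Y := lineObj (N.deg j)) () ()) :
    ∃ f : M ⟶ N, specialLine.map f = φ := by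
  have h : ∀ i j, ∃ q : Polynomial ℤ, (∀ k, q.coeff k ≠ 0 → N.deg j = M.deg i + 2 * k)
      ∧ polyH (M.deg i) (N.deg j) q = φ i j := by
    intro i j
    have h1 := hφ i j
    rw [specialSpan_line] at h1
    obtain ⟨p, hp⟩ := h1
    obtain ⟨q, hq1, hq2⟩ := exists_homogeneous (M.deg i) (N.deg j) p
    exact ⟨q, hq1, hq2.trans hp⟩
  choose P hP1 hP2 using h
  obtain ⟨f, hf⟩ := GrFree.exists_hom_coef P hP1
  refine ⟨f, Mat_.hom_ext _ _ fun i j => ?_⟩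
  exact (congrArg (polyH (M.deg i) (N.deg j)) (hf i j)).trans (hP2 i j)

/-! ### Delooping a whole column of smoothings. -/

/-- A column of marked objects, each of which splits into special lines, is isomorphic to a column
of special lines. -/
theorem exists_iso_of_splitsLines {ι : Type} [Fintype ι] (X : ι → Cob) (s : ∀ i, (X i).circles)
    {K : ι → Type} [∀ i, Fintype (K i)] [Fintype (Σ i, K i)] (n : (Σ i, K i) → ℤ)
    (h : ∀ i, SplitsLines (X i) (s i) fun k => n ⟨i, k⟩) :
    ∃ e : (Mat_.mk ι fun i => CobL.of (X i)) ≅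
        (Mat_.mk (Σ i, K i) fun j => CobL.of (lineObj (n j)) : Mat_ CobL),
      ∀ i j, e.hom i j ∈ specialSpan (X := X i) (Y := lineObj (n j)) (s i) ()
        ∧ e.inv j i ∈ specialSpan (X := lineObj (n j)) (Y := X i) () (s i) := by
  classical
  choose Φ Ψ h1 h2 h3 h4 h5 using h
  let C : Mat_ CobL := Mat_.mk ι fun i => CobL.of (X i)
  let L : Mat_ CobL := Mat_.mk (Σ i, K i) fun j => CobL.of (lineObj (n j))
  -- Both matrices are block diagonal, with the splitting of `X i` as block `i`. The transports
  -- along equalities of indices are identities on the diagonal, and off it the zero entries lie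
  -- trivially in the special span.
  let a : ∀ (i : ι) (j : Σ i, K i), CobL.of (X i) ⟶ CobL.of (lineObj (n j)) := fun i j =>
    if h : i = j.1 then eqToHom (congrArg (fun i => CobL.of (X i)) h) ≫ Φ j.1 j.2 else 0
  let b : ∀ (j : Σ i, K i) (i : ι), CobL.of (lineObj (n j)) ⟶ CobL.of (X i) := fun j i =>
    if h : j.1 = i then Ψ j.1 j.2 ≫ eqToHom (congrArg (fun i => CobL.of (X i)) h) else 0
  have ha : ∀ i k, a i ⟨i, k⟩ = Φ i k := fun i k => (dif_pos rfl).trans (Category.id_comp _)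
  have hb : ∀ i k, b ⟨i, k⟩ i = Ψ i k := fun i k => (dif_pos rfl).trans (Category.comp_id _)
  have ha' : ∀ i j, i ≠ j.1 → a i j = 0 := fun i j h => dif_neg h
  have hb' : ∀ i j, j.1 ≠ i → b j i = 0 := fun i j h => dif_neg h
  have hab : ∀ i i', ∑ j, a i j ≫ b j i' = ∑ k, a i ⟨i, k⟩ ≫ b ⟨i, k⟩ i' := by
    intro i i'
    have e : ∑ j, a i j ≫ b j i' = ∑ x, ∑ k, a i ⟨x, k⟩ ≫ b ⟨x, k⟩ i' := by
      rw [← Fintype.sum_sigma' (fun x k => a i ⟨x, k⟩ ≫ b ⟨x, k⟩ i')]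
      congr!
    rw [e, Finset.sum_eq_single i]
    · intro x _ hx
      refine Finset.sum_eq_zero fun k _ => ?_
      rw [ha' i ⟨x, k⟩ hx.symm, Limits.zero_comp]
    · intro h; exact absurd (Finset.mem_univ _) h
  have hba : ∀ j j' : Σ i, K i, ∑ i, b j i ≫ a i j' = b j j.1 ≫ a j.1 j' := by
    intro j j'
    refine Finset.sum_eq_single j.1 (fun i _ hi => ?_) fun h => absurd (Finset.mem_univ _) h
    rw [hb' i j hi.symm, Limits.zero_comp]
  refine ⟨⟨(a : C ⟶ L), (b : L ⟶ C), ?_, ?_⟩, ?_⟩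
  · refine Mat_.hom_ext _ _ fun i i' => ?_
    refine (hab i i').trans ?_
    by_cases hi : i = i'
    · subst hi
      refine Eq.trans ?_ (Mat_.id_apply_self C i).symm
      simp only [ha, hb]
      exact h5 i
    · refine Eq.trans ?_ (Mat_.id_apply_of_ne C i i' hi).symm
      refine Finset.sum_eq_zero fun k _ => ?_
      rw [hb' i' ⟨i, k⟩ hi, Limits.comp_zero]
  · refine Mat_.hom_ext _ _ fun j j' => ?_
    refine (hba j j').trans ?_
    obtain ⟨i, k⟩ := j
    obtain ⟨i', k'⟩ := j'
    by_cases hj : (⟨i, k⟩ : Σ i, K i) = ⟨i', k'⟩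
    · cases hj
      refine Eq.trans ?_ (Mat_.id_apply_self L _).symm
      rw [ha, hb]
      exact h3 i k
    · refine Eq.trans ?_ (Mat_.id_apply_of_ne L _ _ hj).symm
      by_cases hi : i = i'
      · subst hi
        rw [ha, hb]
        exact h4 i k k' fun h => hj (by rw [h])
      · rw [ha' i ⟨i', k'⟩ hi, Limits.comp_zero]
  · rintro i ⟨i', k⟩
    change a i ⟨i', k⟩ ∈ _ ∧ b ⟨i', k⟩ i ∈ _
    by_cases hi : i = i'
    · subst hi
      rw [ha, hb]
      exact ⟨h1 i k, h2 i k⟩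
    · rw [ha' i ⟨i', k⟩ hi, hb' i ⟨i', k⟩ (Ne.symm hi)]
      exact ⟨zero_mem _, zero_mem _⟩

/-! ### The cube of smoothings of a marked diagram. -/

namespace LinkDiagram

variable (D : LinkDiagram) (p : D.Arc)

theorem exists_iso_deloopedObj (r : ℤ) :
    ∃ e : D.chainObj r ≅ specialLineObj (D.deloopedObj p r),
      ∀ (v : D.Vertex r) (i : (D.deloopedObj p r).index),
        e.hom v i ∈ specialSpan (X := D.smoothing v.1 (D.shiftAt r))
          (Y := lineObj ((D.deloopedObj p r).deg i)) (D.specialCircle p v.1) () ∧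
        e.inv i v ∈ specialSpan (X := lineObj ((D.deloopedObj p r).deg i))
          (Y := D.smoothing v.1 (D.shiftAt r)) () (D.specialCircle p v.1) := by
  classical
  let : Fintype (Σ v : D.Vertex r, ({c : D.Circles v.1 // c ≠ D.specialCircle p v.1} → Bool)) :=
    (D.deloopedObj p r).fintype
  let inst : ∀ v : D.Vertex r, Fintype ({c : D.Circles v.1 // c ≠ D.specialCircle p v.1} → Bool) :=
    fun _ => inferInstance
  have h : ∀ v : D.Vertex r, SplitsLines (D.smoothing v.1 (D.shiftAt r)) (D.specialCircle p v.1)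
      fun ε : {c : D.Circles v.1 // c ≠ D.specialCircle p v.1} → Bool =>
        (D.deloopedObj p r).deg ⟨v, ε⟩ := by
    intro v
    refine @splits_lines (D.smoothing v.1 (D.shiftAt r)) (D.specialCircle p v.1)
      (Fintype.ofFinite _) (inst v) _ fun ε => ?_
    exact congrArg (D.shiftAt r + ·) (@Fintype.sum_equiv _ _ _ (_) (_) _ (Equiv.refl _) _ _ fun _ => rfl)
  exact exists_iso_of_splitsLines (fun v : D.Vertex r => D.smoothing v.1 (D.shiftAt r))
    (fun v => D.specialCircle p v.1) (D.deloopedObj p r).deg h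

/-- Components of a saddle are classes of arcs, and both special circles are sent to the class of
`p`. They lie on the same component by definition, wherever the saddle takes place. -/
theorem chainDiff_mem (r : ℤ) (v : D.Vertex r) (w : D.Vertex (r + 1)) :
    D.chainDiff r v w ∈ specialSpan (X := D.smoothing v.1 (D.shiftAt r))
      (Y := D.smoothing w.1 (D.shiftAt (r + 1))) (D.specialCircle p v.1)
      (D.specialCircle p w.1) := by
  refine sum_mem fun i _ => ?_
  rw [edgeTerm]
  split_ifs with h
  · exact zsmul_mem (mk_mem_specialSpan _ (D.saddleSurf v.1 w.1) rfl rfl) _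
  · exact zero_mem _

end LinkDiagram

end BarNatan

theorem theorem5p1 (D : BarNatan.LinkDiagram) (p : D.Arc) :
    BarNatan.specialLine.Faithful ∧
    (∀ m n : ℤ,
      (BarNatan.specialSpan (X := BarNatan.lineObj m) (Y := BarNatan.lineObj n) () () : Set _)
        = Set.range (BarNatan.polyH m n)) ∧
    ∃ (d : ∀ r : ℤ, D.deloopedObj p r ⟶ D.deloopedObj p (r + 1))
      (hd : ∀ r, d r ≫ d (r + 1) = 0),
      (∀ r i j, ∃ (k : ℕ) (c : ℤ), BarNatan.GrFree.coef (d r) i j = Polynomial.monomial k c) ∧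
      (∃ e : D.geometricComplex ≅
          (BarNatan.specialLine.mapHomologicalComplex (ComplexShape.up ℤ)).obj
            (CochainComplex.of (D.deloopedObj p) d hd),
        ∀ (r : ℤ) (v : D.Vertex r) (i : (D.deloopedObj p r).index),
          e.hom.f r v i ∈ BarNatan.specialSpan
            (X := D.smoothing v.1 (D.shiftAt r))
            (Y := BarNatan.lineObj ((D.deloopedObj p r).deg i)) (D.specialCircle p v.1) () ∧
          e.inv.f r i v ∈ BarNatan.specialSpan
            (X := BarNatan.lineObj ((D.deloopedObj p r).deg i))
            (Y := D.smoothing v.1 (D.shiftAt r)) () (D.specialCircle p v.1)) ∧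
      Nonempty ((HomotopyCategory.quotient (Mat_ BarNatan.CobL) (ComplexShape.up ℤ)).obj
          D.geometricComplex ≅
        (HomotopyCategory.quotient (Mat_ BarNatan.CobL) (ComplexShape.up ℤ)).obj
          ((BarNatan.specialLine.mapHomologicalComplex (ComplexShape.up ℤ)).obj
            (CochainComplex.of (D.deloopedObj p) d hd))) := by
  have faithful := BarNatan.specialLine_faithful
  refine ⟨faithful, fun m n => by rw [BarNatan.specialSpan_line]; rfl, ?_⟩
  choose e he using D.exists_iso_deloopedObj p
  -- The differential transported along the delooping has all its entries in the special span, since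
  -- its three factors do; so it lifts to `ℤ[H]`.
  have hconj : ∀ r, ∃ f : D.deloopedObj p r ⟶ D.deloopedObj p (r + 1),
      BarNatan.specialLine.map f = (e r).inv ≫ D.chainDiff r ≫ (e (r + 1)).hom := by
    intro r
    refine BarNatan.exists_specialLine_map_eq _ fun i j => ?_
    change (∑ v : D.Vertex r, (e r).inv i v ≫ ∑ w : D.Vertex (r + 1),
      D.chainDiff r v w ≫ (e (r + 1)).hom w j) ∈ _
    refine sum_mem fun v _ => BarNatan.comp_mem_specialSpan (he r v i).2
      (sum_mem fun w _ => BarNatan.comp_mem_specialSpan (D.chainDiff_mem p r v w) (he (r + 1) w j).1)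
  choose d hd using hconj
  have hdd : ∀ r, d r ≫ d (r + 1) = 0 := by
    intro r
    -- The lifts were chosen one degree at a time, so the relation between consecutive ones is
    -- recovered by faithfulness from the vanishing of the square in the geometric complex.
    refine BarNatan.specialLine.map_injective ?_
    have h : ((e r).inv ≫ D.chainDiff r ≫ (e (r + 1)).hom)
        ≫ (e (r + 1)).inv ≫ D.chainDiff (r + 1) ≫ (e (r + 1 + 1)).hom = 0 := by
      simp only [Category.assoc, Iso.hom_inv_id_assoc]
      rw [reassoc_of% D.chainDiff_comp r, Limits.zero_comp, Limits.comp_zero]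
    exact (Functor.map_comp _ _ _).trans ((congrArg₂ (· ≫ ·) (hd r) (hd (r + 1))).trans
      (h.trans (Functor.map_zero BarNatan.specialLine _ _).symm))
  let E : D.geometricComplex ≅ (BarNatan.specialLine.mapHomologicalComplex (ComplexShape.up ℤ)).obj
      (CochainComplex.of (D.deloopedObj p) d hdd) :=
    HomologicalComplex.Hom.isoOfComponents (fun r => e r) (by
      -- The squares commute because the image of `d i` is by choice the conjugate of the geometric
      -- differential.
      rintro i j (rfl : i + 1 = j)
      have h1 : (CochainComplex.of (D.deloopedObj p) d hdd).d i (i + 1) = d i :=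
        CochainComplex.of_d _ _ _
      have h2 : D.geometricComplex.d i (i + 1) = D.chainDiff i := CochainComplex.of_d _ _ _
      refine (congrArg (fun f => (e i).hom ≫ BarNatan.specialLine.map f) h1).trans ?_
      refine (congrArg (fun f => (e i).hom ≫ f) (hd i)).trans ?_
      exact (Iso.hom_inv_id_assoc _ _).trans (congrArg (· ≫ (e (i + 1)).hom) h2.symm))
  exact ⟨d, hdd, fun r i j => BarNatan.GrFree.coef_eq_monomial _ i j, ⟨E, fun r v i => he r v i⟩,
    ⟨(HomotopyCategory.quotient _ _).mapIso E⟩⟩
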